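/- Let $m\ge 1$ and $n\ne 0$ be coprime integers and let $\mathcal K_{m,n}$ be the torus knot of type $(m,n)$ in $S^3$, the closure of the $m$-strand braid $(\sigma_1\sigma_2\cdots\sigma_{m-1})^n$, where the $\sigma_i$ are positive crossings. For integers $1\le\alpha<K$ let $$Z_\alpha(K)=\sqrt{\tfrac2K}\,\sin\tfrac{\pi}{K}\;J_\alpha(\mathcal K_{m,n};q=e^{2\pi i/K}),$$ where $J_\alpha$ is the coloured Jones polynomial of the zero-framed knot for the $\alpha$-dimensional representation of quantum $sl_2$, with $J_\alpha(\text{unknot})=\sin(\pi\alpha/K)/\sin(\pi/K)$ and with the convention that a unit of framing contributes the factor $e^{i\pi(\alpha^2-1)/2K}$. (So $Z_\alpha(K)$ is the $SU(2)$ Jones polynomial in Witten's normalization, $K=k+2$.) Let $\Delta$ be the Alexander polynomial of $\mathcal K_{m,n}$. Put $\Phi_K=\exp\left[\frac{i\pi}{2K}\,\frac{m^2n^2-m^2-n^2}{mn}\right]$ and, for $J\ge 0$, real $x$ and $l\in\mathbb Z$, $$R_J(K,x)=\sqrt{\tfrac2K}\,\Phi_K\sum_{j=0}^{J}\frac1{j!}\Big(\frac{2\pi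 i}{K}mn\Big)^{-j}\partial_x^{2j}\left[\frac{\sin(\pi nx/K)\,\sin(\pi mx/K)}{\sin(\pi mnx/K)}\right],$$ $$I_l(K,x)=\frac i2\,e^{\frac{i\pi}4\mathrm{sign}(mn)+i\pi l}\exp\left[-i\pi K\frac{mn}{2}\Big(\frac xK-\frac l{mn}\Big)^2\right]\frac{4\sin(\pi l/m)\sin(\pi l/n)}{\sqrt{|mn|}}\,\Phi_K$$ (the contributions of the reducible connection, with its series cut off after $j=J$, and of the $l$-th irreducible connection). Quotients are extended by continuity over their removable singularities. (1) ($a=\alpha/K$ fixed.) Let $0<a<1$ with $\Delta(e^{2\pi ia})\ne0$. For every $J$ there is a constant $C$ such that for all $K,\alpha$ with $\alpha=aK$ $$\Big|Z_\alpha(K)-R_J(K,\alpha)-\sum_{l\in\mathbb Z,\;0<l/(mn)<a}I_l(K,\alpha)\Big|\le C\,K^{-J-3/2}.$$ (For $mn>0$ the condition on $l$ is $0<l<mna$.) (2) ($\alpha$ fixed.) There are numbers $c_{p,q}$, $p,q\ge0$, depending only on $m,n$, with $c_{p,q}=0$ for $p>q$, such that for all $\alpha\ge1$ and $J\ge0$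 there is a constant $C$ such that for all $K>\alpha$ $$|Z_\alpha(K)-R_J(K,\alpha)|\le C\,K^{-J-5/2},\qquad \Big|R_J(K,\alpha)-\sqrt{\tfrac2K}\sum_{q=0}^{J}\sum_{p=0}^{q}c_{p,q}\,\alpha^pK^{-q}\Big|\le C\,K^{-J-3/2},$$ so that the reducible contribution alone gives the $1/K$ expansion of the Jones polynomial. (3) (Singularity of the reducible contribution.) If $0<a<1$ and $\Delta(e^{2\pi ia})=0$, then $a=l_0/(mn)$ for an integer $l_0$, and $|R_J(K,x)|\to\infty$ as $x\to Ka$, $x\neq Ka$, for all $K\ge1$ and $J\ge0$. (4) (Smoothness of the whole.) Let $l_0\in\mathbb Z$ with $0<l_0/(mn)<1$ and put $$T_J(K,\gamma)=i\,e^{\frac{i\pi}4\mathrm{sign}(mn)+i\pi l_0}\,\frac{\sin(\pi l_0/m)\sin(\pi l_0/n)}{\sqrt{|mn|}}\,e^{-\frac{i\pi}{2K}mn\gamma^2}\,\Phi_K+\sqrt{\tfrac2K}\,e^{i\pi l_0}\,\Phi_K\sum_{j=0}^{J}\frac1{j!}\Big(\frac{2\pi i}{K}mn\Big)^{-j}$$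 $$\times\;\partial_y^{2j}\left[\frac{\sin\pi\big(\frac{l_0}m+\frac nKy\big)\sin\pi\big(\frac{l_0}n+\frac mKy\big)}{\sin(\pi mny/K)}-\frac K\pi\,\frac{\sin(\pi l_0/m)\sin(\pi l_0/n)}{mn\,y}\,e^{-\frac{i\pi}{K}mny\gamma}\right]_{y=\gamma}.$$ Then, for every $J$ and $K\ge 1$, $T_J(K,\gamma)$ is a $C^\infty$ function of $\gamma$ for $|\gamma|<K/|mn|$, and for every $J$ there is a constant $C$ such that for all $K$, $1\le\alpha<K$ and $\gamma=\alpha-Kl_0/(mn)$ with $|\gamma|\le\sqrt K$ $$\Big|Z_\alpha(K)-T_J(K,\gamma)-\sum_{l\in\mathbb Z,\;0<l/(mn)<l_0/(mn)}I_l(K,\alpha)\Big|\le C\,(1+|\gamma|)^{2J+3}\,K^{-J-3/2}.$$ -/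

import Mathlib

open Filter Topology

open scoped Real

noncomputable section

/-! ### Braid words -/

/-- Words in the standard generators of the braid group on `m` strands: the letter `(i, true)` is
the generator `σ_{i+1}`, a positive crossing of the neighbouring strands `i` and `i + 1` (strands
are numbered from `0`), and `(i, false)` is its inverse. -/
abbrev BraidWord (m : ℕ) : Type := List (Fin (m - 1) × Bool)

namespace BraidWord

/-- The left strand on which the `i`-th generator acts. -/
def left {m : ℕ} (i : Fin (m - 1)) : Fin m := ⟨i, by omega⟩

/-- The right strand on which the `i`-th generator acts. -/
def right {m : ℕ} (i : Fin (m - 1)) : Fin m := ⟨i + 1, by omega⟩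

/-- The exponent sum of a braid word, which is the writhe of the diagram of its closure. -/
def writhe {m : ℕ} (w : BraidWord m) : ℤ := (w.map fun p => if p.2 then (1 : ℤ) else -1).sum

/-- The value of a braid word in the representation that sends the `i`-th generator to the
(invertible) matrix `g i`. -/
def eval {m : ℕ} {ι : Type} [Fintype ι] [DecidableEq ι] (g : Fin (m - 1) → Matrix ι ι ℂ)
    (w : BraidWord m) : Matrix ι ι ℂ :=
  (w.map fun p => if p.2 then g p.1 else (g p.1)⁻¹).prod

/-- The word `(σ₁ σ₂ ⋯ σ_{m-1})ⁿ`, with `n` an arbitrary integer. If `n` is prime to `m`, its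
closure is the torus knot of type `(m, n)`. -/
def torus (m : ℕ) : ℤ → BraidWord m
  | Int.ofNat n => (List.replicate n ((List.finRange (m - 1)).map fun i => (i, true))).flatten
  | Int.negSucc n =>
      (List.replicate (n + 1) ((List.finRange (m - 1)).reverse.map fun i => (i, false))).flatten

end BraidWord

/-! ### The coloured Jones polynomial of the closure of a braid

This is the invariant attached to the `N`-dimensional irreducible representation of the quantum
group `U_v(sl₂)`, where `v = t²`. That representation has the basis `e₀, …, e_{N-1}` with
`E e_i = [N - i] e_{i-1}`, `F e_i = [i + 1] e_{i+1}`, and `e_i` has weight `N - 1 - 2 i`. -/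

/-- The weight of the basis vector `e_i` of the `N`-dimensional representation. -/
def slWeight (N : ℕ) (i : Fin N) : ℤ := (N : ℤ) - 1 - 2 * (i : ℤ)

/-- The Gaussian binomial coefficient `[n]! / ([k]! [n-k]!)` with `[r] = (v^r - v^{-r})/(v - v⁻¹)`,
as a Laurent polynomial in `v`. -/
def gaussBinom (v : ℂ) : ℕ → ℕ → ℂ
  | _, 0 => 1
  | 0, _ + 1 => 0
  | n + 1, k + 1 =>
      v ^ (-((k : ℤ) + 1)) * gaussBinom v n (k + 1) + v ^ ((n : ℤ) - (k : ℤ)) * gaussBinom v n k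

/-- The matrix of the braiding `P ∘ R` on the square of the `N`-dimensional representation, where
`P` is the flip and
`R = v^{H ⊗ H / 2} ∑_k v^{k(k-1)/2} (v - v⁻¹)^k / [k]! · E^k ⊗ F^k`, `v = t²`.
The summand with index `k` sends `e_i ⊗ e_j` to a multiple of `e_c ⊗ e_d` with `c = j + k` and
`d = i - k`; the rows are indexed by `(c, d)` and the columns by `(i, j)`. -/
def braiding (N : ℕ) (t : ℂ) : Matrix (Fin N × Fin N) (Fin N × Fin N) ℂ :=
  fun out inp =>
    let c : ℕ := out.1
    let d : ℕ := out.2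
    let i : ℕ := inp.1
    let j : ℕ := inp.2
    let k : ℕ := c - j
    if j ≤ c ∧ c + d = i + j then
      t ^ (k * (k - 1)) * gaussBinom (t ^ 2) (N - 1 - d) k *
        (∏ r ∈ Finset.range k, (t ^ (2 * (j + r + 1)) - (t ^ (2 * (j + r + 1)))⁻¹)) *
        t ^ (slWeight N out.1 * slWeight N out.2)
    else 0

/-- The action of the `i`-th braid generator on the `m`-th tensor power of the `N`-dimensional
representation, whose basis is indexed by the functions `Fin m → Fin N`. -/
def tensorGen (m N : ℕ) (t : ℂ) (i : Fin (m - 1)) :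
    Matrix (Fin m → Fin N) (Fin m → Fin N) ℂ :=
  fun y x =>
    if ∀ s : Fin m, s ≠ BraidWord.left i → s ≠ BraidWord.right i → y s = x s then
      braiding N t (y (BraidWord.left i), y (BraidWord.right i))
        (x (BraidWord.left i), x (BraidWord.right i))
    else 0

/-- The coloured Jones polynomial of the closure of a braid word: the quantum trace of the braid on
the `m`-th tensor power of the `N`-dimensional representation, corrected by a power of the
framing factor `t^{N²-1}` to the framing with self-linking number zero (when the closure is a
knot). The unknot has the value `[N]`; the usual variable is `q = t⁴`. -/
def colouredJones (m N : ℕ) (t : ℂ) (w : BraidWord m) : ℂ :=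
  t ^ (-(((N : ℤ) ^ 2 - 1) * w.writhe)) *
    Matrix.trace (Matrix.diagonal (fun x : Fin m → Fin N => ∏ s, t ^ (2 * slWeight N (x s))) *
      w.eval (tensorGen m N t))

/-- The `SU(2)` Jones polynomial `Z_α(S³, K_{m,n}; k)`, `K = k + 2`, of the torus knot of type
`(m, n)` in Witten's normalization: the unknot has the value `√(2/K) sin(π α / K)`. The quantum
parameter is `q = exp(2πi/K)`. -/
def jonesTorus (m : ℕ) (n : ℤ) (K α : ℕ) : ℂ :=
  (√(2 / (K : ℝ)) * Real.sin (π / K) : ℝ) *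
    colouredJones m α (Complex.exp (Complex.I * π / (2 * K))) (BraidWord.torus m n)

/-! ### The Alexander polynomial of the closure of a braid -/

/-- The (unreduced) Burau matrix of the `i`-th braid generator: the identity, except for the block
`(1 - t, t; 1, 0)` on the two strands that the generator involves. -/
def burauGen (m : ℕ) (t : ℂ) (i : Fin (m - 1)) : Matrix (Fin m) (Fin m) ℂ :=
  fun r s =>
    if r = BraidWord.left i then
      (if s = BraidWord.left i then 1 - t else if s = BraidWord.right i then t else 0)
    else if r = BraidWord.right i then (if s = BraidWord.left i then 1 else 0)
    else if r = s then 1 else 0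

/-- The Alexander polynomial of the closure of a braid word (when the closure is a knot), evaluated
at `t ≠ 0`. The Fox calculus for the presentation of the knot group which the braid defines has
the Jacobian matrix `1 - B`, with `B` the Burau matrix of the braid, and the Alexander polynomial
is the minor of this matrix in which one row and one column are deleted. As always it is
defined up to a unit `± t^k`, which does not affect its zeros. -/
def alexander (m : ℕ) (w : BraidWord m) (t : ℂ) : ℂ :=
  ((1 - w.eval (burauGen m t)).submatrix
    (Subtype.val : {s : Fin m // (s : ℕ) ≠ 0} → Fin m)
    (Subtype.val : {s : Fin m // (s : ℕ) ≠ 0} → Fin m)).det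

/-! ### The contributions to the asymptotics -/

/-- The extension of a function by continuity: its value at `x` is the limit at `x`. This removes
the removable singularities of a quotient, and does not change a continuous function. -/
def contExt {E : Type} [TopologicalSpace E] [Nonempty E] (f : ℝ → E) (x : ℝ) : E :=
  limUnder (𝓝[≠] x) f

/-- The phase `exp((iπ/2K) (m²n² - m² - n²)/(mn))`. -/
def twoLoopPhase (m : ℕ) (n : ℤ) (K : ℕ) : ℂ :=
  Complex.exp (Complex.I * π / (2 * K) *
    (((m : ℂ) ^ 2 * (n : ℂ) ^ 2 - (m : ℂ) ^ 2 - (n : ℂ) ^ 2) / ((m : ℂ) * (n : ℂ))))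

/-- The function `sin(π n x / K) sin(π m x / K) / sin(π m n x / K)`. -/
def reducibleKernel (m : ℕ) (n : ℤ) (K : ℕ) : ℝ → ℝ :=
  contExt fun x : ℝ =>
    Real.sin (π / K * n * x) * Real.sin (π / K * m * x) / Real.sin (π / K * (m * n) * x)

/-- The contribution of the reducible connection, with the terms `j = 0, …, J` of its series; `x`
is the (real) value of `α`. -/
def reducible (m : ℕ) (n : ℤ) (K J : ℕ) (x : ℝ) : ℂ :=
  (√(2 / (K : ℝ)) : ℝ) * twoLoopPhase m n K *
    ∑ j ∈ Finset.range (J + 1),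
      ((j.factorial : ℂ)⁻¹ * ((2 * π * Complex.I / K * ((m : ℂ) * (n : ℂ))) ^ j)⁻¹ *
        (iteratedDeriv (2 * j) (reducibleKernel m n K) x : ℝ))

/-- The contribution of the `l`-th irreducible connection; `x` is the value of `α`. -/
def irreducible (m : ℕ) (n : ℤ) (K : ℕ) (l : ℤ) (x : ℝ) : ℂ :=
  Complex.I / 2 *
    Complex.exp (Complex.I * π / 4 * ((m * n : ℤ).sign : ℂ) + Complex.I * π * l) *
    Complex.exp (-(Complex.I * π * K * ((m * n : ℝ) / 2 * (x / K - l / (m * n)) ^ 2 : ℝ))) *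
    (4 * Real.sin (π * l / m) * Real.sin (π * l / n) / √|(m * n : ℝ)| : ℝ) *
    twoLoopPhase m n K

open Classical in
/-- The labels `l` of the irreducible connections with boundary holonomy `exp(2πia)`, `0 < a < 1`:
the integers with `0 < l/(mn) < a`, that is, `0 < l < mna` when `mn > 0`. -/
def irreducibleLabels (m : ℕ) (n : ℤ) (a : ℝ) : Finset ℤ :=
  (Finset.Icc (-|(m * n : ℤ)|) |(m * n : ℤ)|).filter
    fun l => 0 < (l : ℝ) / (m * n) ∧ (l : ℝ) / (m * n) < a

/-- The difference of the singular function of the reducible contribution at `α = K l₀/(mn) + y`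
(up to the sign `(-1)^{l₀}`) and a multiple of `exp(-iπmnyγ/K)/y` which cancels its pole at
`y = 0`. -/
def criticalKernel (m : ℕ) (n : ℤ) (K : ℕ) (l₀ : ℤ) (γ : ℝ) : ℝ → ℂ :=
  contExt fun y : ℝ =>
    ((Real.sin (π * (l₀ / m + n / K * y)) * Real.sin (π * (l₀ / n + m / K * y)) /
        Real.sin (π / K * (m * n) * y) : ℝ) : ℂ) -
      ((K / π * (Real.sin (π * l₀ / m) * Real.sin (π * l₀ / n)) / (m * n * y) : ℝ) : ℂ) *
        Complex.exp (-(Complex.I * (π / K * (m * n) * y * γ : ℝ)))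

/-- The combined contribution of the reducible connection and of the `l₀`-th irreducible one near
the critical point, at `α = K l₀/(mn) + γ`, with the terms `j = 0, …, J` of its series. -/
def critical (m : ℕ) (n : ℤ) (K J : ℕ) (l₀ : ℤ) (γ : ℝ) : ℂ :=
  Complex.I *
      Complex.exp (Complex.I * π / 4 * ((m * n : ℤ).sign : ℂ) + Complex.I * π * l₀) *
      (Real.sin (π * l₀ / m) * Real.sin (π * l₀ / n) / √|(m * n : ℝ)| : ℝ) *
      Complex.exp (-(Complex.I * (π / (2 * K) * (m * n) * γ ^ 2 : ℝ))) *
      twoLoopPhase m n K +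
    (√(2 / (K : ℝ)) : ℝ) * Complex.exp (Complex.I * π * l₀) * twoLoopPhase m n K *
      ∑ j ∈ Finset.range (J + 1),
        ((j.factorial : ℂ)⁻¹ * ((2 * π * Complex.I / K * ((m : ℂ) * (n : ℂ))) ^ j)⁻¹ *
          iteratedDeriv (2 * j) (criticalKernel m n K l₀ γ) γ)

end

/-! The Jones polynomial of a torus knot is an exact Gaussian contour integral of an elementary
meromorphic function, and the four statements express what its poles, its saddle point and its
parity imply.

Trace formula. Let A be the transposed action of σ₁⋯σ_{m-1} on the m-th tensor power of the
N-dimensional representation, and let G be the transposed action of the generator E (up to a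
factor), which commutes with A. A strand that carries an extreme weight vector crosses the others
without mixing. Therefore A agrees modulo the image of G with a twisted cyclic shift R₊, and agrees
on the kernel of G with another one, R₋; moreover R₊ G = G R₋. Hence Aⁿ - R₊ⁿ = G X and Aⁿ - R₋ⁿ = Y
G, and their quantum traces agree up to the factor t⁻⁴ (`Matrix.trace_eq_of_intertwine`). Solving
for the trace of Aⁿ leaves traces of powers of the shifts, to which only the N constant labellings
contribute, n being prime to m. This is the Rosso–Jones formula `colouredJones_torus`, obtained
without decomposing the tensor power.

Contour integral. After completing squares, each term of that formula is the average of an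
exponential against a Gaussian of variance 2b, b = π m|n|/(2K). Summation gives
`jonesTorus_eq_lineAvg`: the integral of `kern` = sinh(y/m) sinh(y/|n|)/sinh y along a line through
0, tilted by exp(±iπ/4), against a Gaussian centred at iθ₀, θ₀ = π m|n|α/K. Moving the line to the
centre crosses the poles iπl with 0 < πl < θ₀, and each of them yields exactly one irreducible
contribution (`sqrt_div_I_mul_jump`). The integral through the centre is expanded by Taylor's
formula; the even derivatives form the reducible contribution, and the remainder is of order b^{J+1}
(`norm_gavg_sub_gaussSeries_le`).

Zeros of the Alexander polynomial. The Burau matrix shows that they are the t with t^{mn} = 1, t^m ≠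
1, t^n ≠ 1 (`alexander_torus_eq_zero_iff`), so they correspond precisely to those iπl where the
residue of `kern` does not vanish. Away from them the integrand is holomorphic at the centre, which
gives (1); at them the derivatives in R_J blow up, which gives (3). Near them a multiple of
exp(-νu)/u is subtracted, with ν chosen so that its Gaussian integral is known exactly
(`gauss_mul_exp`, `integral_gauss_div`). Half of the jump together with the expansion of the smooth
rest is T_J, which gives (4).

Fixed colour. The centre then tends to 0, where `kern` is odd: its even derivatives vanish there,
which improves the remainder by a factor 1/K. All ingredients are analytic in 1/K, and α enters only
through α/K, which gives (2). -/

noncomputable section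

/-! ### Gaussian binomials -/

theorem gaussBinom_zero_right (v : ℂ) (n : ℕ) : gaussBinom v n 0 = 1 := by
  cases n <;> simp [gaussBinom]

/-- The unnormalized quantum integer `v^k - v^{-k}`. -/
def qdiff (v : ℂ) (k : ℤ) : ℂ := v ^ k - v ^ (-k)

theorem qdiff_zero (v : ℂ) : qdiff v 0 = 0 := by simp [qdiff]

/-- The definition is a Pascal rule. The ratio of neighbouring binomials, with denominators cleared
so that roots of unity are allowed, is what relates consecutive summands of the R-matrix. -/
theorem gaussBinom_succ_right {v : ℂ} (hv : v ≠ 0) (n k : ℕ) :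
    qdiff v (k + 1) * gaussBinom v n (k + 1) = qdiff v (n - k) * gaussBinom v n k := by
  induction n generalizing k with
  | zero =>
    cases k with
    | zero => simp [gaussBinom, qdiff]
    | succ k => simp [gaussBinom]
  | succ n ih =>
    have key : qdiff v (k + 1) * gaussBinom v (n + 1) (k + 1) =
        (v ^ ((n : ℤ) + 1) - v ^ (-((n : ℤ) + 1))) * gaussBinom v n k := by
      rw [gaussBinom, mul_add, mul_left_comm, ih k, ← mul_assoc, ← mul_assoc, ← add_mul]
      congr 1
      simp only [qdiff, neg_add, neg_sub, zpow_add₀ hv, zpow_sub₀ hv, zpow_neg, zpow_one]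
      field_simp
      ring
    rw [key]
    cases k with
    | zero => simp [gaussBinom_zero_right, qdiff]
    | succ k =>
      rw [gaussBinom, mul_add]
      have h := ih k
      have : qdiff v (↑(n + 1) - ↑(k + 1)) * (v ^ ((n : ℤ) - k) * gaussBinom v n k) =
          v ^ ((n : ℤ) - k) * (qdiff v (k + 1) * gaussBinom v n (k + 1)) := by
        rw [h]; push_cast; rw [add_sub_add_right_eq_sub]; ring
      rw [this, ← mul_assoc, ← mul_assoc, ← add_mul]
      congr 1
      push_cast
      simp only [qdiff, neg_add, neg_sub, zpow_add₀ hv, zpow_sub₀ hv, zpow_neg, zpow_one]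
      field_simp
      ring

theorem gaussBinom_succ_succ {v : ℂ} (hv : v ≠ 0) (n k : ℕ) :
    qdiff v (k + 1) * gaussBinom v (n + 1) (k + 1) = qdiff v (n + 1) * gaussBinom v n k := by
  rw [gaussBinom, mul_add, mul_left_comm, gaussBinom_succ_right hv n k, ← mul_assoc, ← mul_assoc,
    ← add_mul]
  congr 1
  simp only [qdiff, neg_add, neg_sub, zpow_add₀ hv, zpow_sub₀ hv, zpow_neg, zpow_one]
  field_simp
  ring

/-! ### The action of a nilpotent generator -/

/-- The weight `N - 1 - 2 a`. -/
def wt (N a : ℕ) : ℤ := (N : ℤ) - 1 - 2 * (a : ℤ)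

/-- The coefficients of the transposed braiding. -/
def braidCoeff (N : ℕ) (t : ℂ) (a b k : ℕ) : ℂ :=
  t ^ (k * (k - 1)) * gaussBinom (t ^ 2) (N - 1 - b) k *
    (∏ r ∈ Finset.range k, qdiff (t ^ 2) ((a : ℤ) - k + r + 1)) * t ^ (wt N a * wt N b)

theorem zpow_wt_succ_left {t : ℂ} (ht : t ≠ 0) (N a b : ℕ) :
    t ^ (wt N (a + 1) * wt N b) = t ^ (wt N a * wt N b) * (t ^ 2) ^ (-wt N b) := by
  rw [← zpow_natCast t 2, ← zpow_mul, ← zpow_add₀ ht]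
  congr 1; simp only [wt]; push_cast; ring

theorem braidCoeff_zero {t : ℂ} (ht : t ≠ 0) (N a b : ℕ) :
    (t ^ 2) ^ wt N b * braidCoeff N t (a + 1) b 0 = braidCoeff N t a b 0 := by
  have h := zpow_ne_zero (wt N b) (pow_ne_zero 2 ht)
  simp only [braidCoeff, gaussBinom_zero_right, zpow_wt_succ_left ht, Finset.range_zero,
    Finset.prod_empty, zpow_neg]
  field_simp

/-- The factor r = 0 of the product is `qdiff` at 0. This allows a sum over k ≤ a to be lengthened
by one term. -/
theorem braidCoeff_succ_self (N : ℕ) (t : ℂ) (a b : ℕ) : braidCoeff N t a b (a + 1) = 0 := by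
  rw [braidCoeff, Finset.prod_range_succ']
  simp [qdiff_zero]

/-- This is the compatibility of the braiding with the coproduct of E, read off at one basis vector,
where the summands k and k + 1 of the R-matrix meet. The binomials are eliminated with `e1` and
`e2'`, and what remains is the Laurent polynomial identity `main`. -/
theorem braidCoeff_intertwine {t : ℂ} (ht : t ≠ 0) {N a b : ℕ} (hb : b < N) {k : ℕ} (hk : k ≤ a) :
    qdiff (t ^ 2) (N - 1 - a) * (t ^ 2) ^ wt N b * braidCoeff N t (a + 1) b (k + 1) +
      qdiff (t ^ 2) (N - 1 - b) * braidCoeff N t a (b + 1) k =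
    braidCoeff N t a b k * (qdiff (t ^ 2) (N - 1 - (b + k)) * (t ^ 2) ^ wt N (a - k)) +
      braidCoeff N t a b (k + 1) * qdiff (t ^ 2) (N - 1 - (a - (k + 1))) := by
  obtain ⟨d, rfl⟩ := Nat.exists_eq_add_of_le' hk
  obtain ⟨n, rfl⟩ : ∃ n, N = b + n + 1 := ⟨N - 1 - b, by omega⟩
  have hv : t ^ 2 ≠ 0 := pow_ne_zero 2 ht
  set v := t ^ 2 with hvdef
  have e1 : qdiff v (((b + n + 1 : ℕ) : ℤ) - 1 - b) * gaussBinom v (b + n - (b + 1)) k =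
      qdiff v (k + 1) * gaussBinom v n (k + 1) := by
    cases n with
    | zero => simp [qdiff_zero, gaussBinom]
    | succ n =>
      rw [gaussBinom_succ_succ hv, show b + (n + 1) - (b + 1) = n by omega]
      congr 2; push_cast; ring
  have e2 := gaussBinom_succ_right hv n k
  have eT : t ^ ((k + 1) * k) = t ^ (k * (k - 1)) * v ^ k := by
    rw [hvdef, ← pow_mul, ← pow_add]; congr 1
    cases k with
    | zero => rfl
    | succ k => simp only [Nat.add_sub_cancel]; ring
  have eP1 : ∏ r ∈ Finset.range (k + 1),
      qdiff v (((d + k + 1 : ℕ) : ℤ) - ((k + 1 : ℕ) : ℤ) + r + 1) =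
      (∏ r ∈ Finset.range k, qdiff v (((d + k : ℕ) : ℤ) - k + r + 1)) * qdiff v (d + k + 1) := by
    rw [Finset.prod_range_succ]
    congr 1
    · refine Finset.prod_congr rfl fun r _ => ?_
      congr 1; push_cast; ring
    · congr 1; push_cast; ring
  have eP2 : ∏ r ∈ Finset.range (k + 1),
      qdiff v (((d + k : ℕ) : ℤ) - ((k + 1 : ℕ) : ℤ) + r + 1) =
      (∏ r ∈ Finset.range k, qdiff v (((d + k : ℕ) : ℤ) - k + r + 1)) * qdiff v d := by
    rw [Finset.prod_range_succ']
    congr 1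
    · refine Finset.prod_congr rfl fun r _ => ?_
      congr 1; push_cast; ring
    · congr 1; push_cast; ring
  have eW := zpow_wt_succ_left ht (b + n + 1) b (d + k)
  rw [mul_comm (wt _ (b + 1)), mul_comm (wt _ b)] at eW
  simp only [braidCoeff, eT, ← hvdef, eP1, eP2, zpow_wt_succ_left ht, eW,
    Nat.add_sub_cancel, Nat.add_sub_cancel_left]
  set Q := ∏ r ∈ Finset.range k, qdiff v (((d + k : ℕ) : ℤ) - k + r + 1)
  set Θ := t ^ (wt (b + n + 1) (d + k) * wt (b + n + 1) b)
  set T := t ^ (k * (k - 1))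
  set B' := gaussBinom v n (k + 1)
  set B := gaussBinom v n k
  have e2' : qdiff v (((b + n + 1 : ℕ) : ℤ) - 1 - (b + k)) * B = qdiff v (k + 1) * B' := by
    rw [e2]; congr 2; push_cast; ring
  have hw : v ^ wt (b + n + 1) b * v ^ (-wt (b + n + 1) b) = 1 := by
    rw [← zpow_add₀ hv]; simp
  have main : qdiff v (((b + n + 1 : ℕ) : ℤ) - 1 - ((d + k : ℕ) : ℤ)) * v ^ k * qdiff v (d + k + 1) +
      qdiff v (k + 1) * v ^ (-wt (b + n + 1) (d + k)) =
      qdiff v (k + 1) * v ^ wt (b + n + 1) d +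
        v ^ k * qdiff v d * qdiff v (((b + n + 1 : ℕ) : ℤ) - 1 - (((d + k : ℕ) : ℤ) - (k + 1))) := by
    simp only [wt, qdiff]
    push_cast
    have h1 : ∀ z : ℤ, v ^ (2 * z) = (v ^ z) ^ 2 := fun z => by rw [mul_comm, zpow_mul]; norm_cast
    have hd := zpow_ne_zero (d : ℤ) hv
    simp only [neg_add, neg_sub, zpow_add₀ hv, zpow_sub₀ hv, zpow_neg, zpow_one, h1, mul_add,
      ← zpow_natCast v k]
    field_simp
    ring
  linear_combination (T * Q * Θ * v ^ (-wt (b + n + 1) (d + k))) * e1 -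
    T * Q * Θ * v ^ wt (b + n + 1) d * e2' + T * Q * Θ * B' * main +
    (qdiff v (((b + n + 1 : ℕ) : ℤ) - 1 - ((d + k : ℕ) : ℤ)) * v ^ k * qdiff v (d + k + 1) *
      T * Q * Θ * B') * hw

/-- The basis vector with the given labels; it vanishes if some label is out of range. -/
def ket {m N : ℕ} (x : Fin m → ℕ) : (Fin m → Fin N) → ℂ :=
  fun y => if ∀ s, (y s : ℕ) = x s then 1 else 0

theorem ket_val {m N : ℕ} (x : Fin m → Fin N) :
    (ket (fun s => (x s : ℕ)) : (Fin m → Fin N) → ℂ) = Pi.single x 1 := by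
  ext y
  simp only [ket, Pi.single_apply, funext_iff, Fin.ext_iff]

theorem ket_eq_zero {m N : ℕ} {x : Fin m → ℕ} {s : Fin m} (h : N ≤ x s) :
    (ket x : (Fin m → Fin N) → ℂ) = 0 := by
  ext y
  have : ¬ ∀ s, (y s : ℕ) = x s := fun hy => by have := (y s).isLt; have := hy s; omega
  simp [ket, this]

/-- The coefficient with which the `s`-th tensor factor contributes to the raising operator. -/
def raiseCoeff (N : ℕ) (t : ℂ) {m : ℕ} (x : Fin m → ℕ) (s : Fin m) : ℂ :=
  qdiff (t ^ 2) ((N : ℤ) - 1 - x s) *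
    ∏ r ∈ Finset.univ.filter (fun r => s < r), (t ^ 2) ^ wt N (x r)

/-- The raising operator, which is (a multiple of) the transpose of the action of the generator `E`
of the quantum group on the tensor power. -/
def raising (m N : ℕ) (t : ℂ) : Matrix (Fin m → Fin N) (Fin m → Fin N) ℂ :=
  fun y x => ∑ s, raiseCoeff N t (fun r => (x r : ℕ)) s *
    ket (Function.update (fun r => (x r : ℕ)) s (x s + 1)) y

/-- Labels are natural numbers rather than elements of `Fin N`, so that raising may leave the range:
the vector is then zero, and no case distinction is needed later. -/
theorem raising_mulVec_ket {m N : ℕ} (t : ℂ) (x : Fin m → ℕ) :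
    (raising m N t).mulVec (ket x) =
      ∑ s, raiseCoeff N t x s • ket (Function.update x s (x s + 1)) := by
  by_cases hx : ∀ s, x s < N
  · lift x to Fin m → Fin N using hx
    rw [ket_val, Matrix.mulVec_single_one]
    ext y
    simp [raising, Matrix.col_apply, Finset.sum_apply]
  · push Not at hx
    obtain ⟨r, hr⟩ := hx
    rw [ket_eq_zero hr, Matrix.mulVec_zero, eq_comm]
    refine Finset.sum_eq_zero fun s _ => ?_
    rw [ket_eq_zero (s := r), smul_zero]
    by_cases h : r = s
    · subst h; simp; omega
    · simpa [h] using hr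

open BraidWord (left right)

/-- The labels obtained from `x` when the braiding of the strands `i`, `i + 1` transfers `k`. -/
def transfer {m : ℕ} (i : Fin (m - 1)) (x : Fin m → ℕ) (k : ℕ) : Fin m → ℕ :=
  Function.update (Function.update x (left i) (x (right i) + k)) (right i) (x (left i) - k)

theorem left_ne_right {m : ℕ} (i : Fin (m - 1)) : left i ≠ right i := by
  simp [left, right, Fin.ext_iff]

theorem transfer_left {m : ℕ} (i : Fin (m - 1)) (x : Fin m → ℕ) (k : ℕ) :
    transfer i x k (left i) = x (right i) + k := by
  simp [transfer, left_ne_right]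

theorem transfer_right {m : ℕ} (i : Fin (m - 1)) (x : Fin m → ℕ) (k : ℕ) :
    transfer i x k (right i) = x (left i) - k := by
  simp [transfer]

theorem transfer_of_ne {m : ℕ} (i : Fin (m - 1)) (x : Fin m → ℕ) (k : ℕ) {s : Fin m}
    (h1 : s ≠ left i) (h2 : s ≠ right i) : transfer i x k s = x s := by
  simp [transfer, h1, h2]

theorem tensorGen_transpose_mulVec_ket {m N : ℕ} (t : ℂ) (i : Fin (m - 1)) {x : Fin m → ℕ}
    (hx : ∀ s, x s < N) :
    (tensorGen m N t i).transpose.mulVec (ket x) =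
      ∑ k ∈ Finset.range (x (left i) + 1),
        braidCoeff N t (x (left i)) (x (right i)) k • ket (transfer i x k) := by
  lift x to Fin m → Fin N using hx
  rw [ket_val, Matrix.mulVec_single_one]
  ext y
  rw [Finset.sum_apply, Matrix.col_apply, Matrix.transpose_apply, tensorGen]
  simp only [Pi.smul_apply, smul_eq_mul, ket, mul_ite, mul_one, mul_zero]
  have hiff : ∀ k ≤ (x (left i) : ℕ), (∀ s, (y s : ℕ) = transfer i (fun s => (x s : ℕ)) k s) ↔
      (∀ s, s ≠ left i → s ≠ right i → x s = y s) ∧ (y (left i) : ℕ) = x (right i) + k ∧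
        (y (right i) : ℕ) = x (left i) - k := by
    intro k hk
    constructor
    · intro h
      refine ⟨fun s h1 h2 => ?_, ?_, ?_⟩
      · have := h s; rw [transfer_of_ne _ _ _ h1 h2] at this; exact Fin.ext this.symm
      · rw [h, transfer_left]
      · rw [h, transfer_right]
    · rintro ⟨h, h1, h2⟩ s
      by_cases hl : s = left i
      · rw [hl, transfer_left, h1]
      by_cases hr : s = right i
      · rw [hr, transfer_right, h2]
      rw [transfer_of_ne _ _ _ hl hr, h s hl hr]
  by_cases h : ∀ s, s ≠ left i → s ≠ right i → x s = y s
  · rw [if_pos h]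
    rw [braiding]
    dsimp only
    by_cases h' : (y (right i) : ℕ) ≤ x (left i) ∧
        (x (left i) : ℕ) + x (right i) = y (left i) + y (right i)
    · rw [if_pos h', Finset.sum_eq_single ((x (left i) : ℕ) - y (right i))]
      · rw [if_pos]
        · simp only [braidCoeff, slWeight, wt]
          congr 2
          refine Finset.prod_congr rfl fun r _ => ?_
          rw [Nat.cast_sub h'.1, sub_sub_cancel]
          simp only [qdiff, zpow_neg]
          norm_cast
          simp only [← pow_mul]
        · rw [hiff _ (Nat.sub_le _ _)]
          exact ⟨h, by omega, by omega⟩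
      · intro k hk hne
        rw [if_neg]
        rw [hiff _ (by simpa [Nat.lt_succ_iff] using hk)]
        rintro ⟨-, h1, h2⟩
        have := Finset.mem_range.mp hk
        omega
      · intro hk
        simp at hk
    · rw [if_neg h', eq_comm]
      refine Finset.sum_eq_zero fun k hk => if_neg ?_
      have hk := Finset.mem_range.mp hk
      rw [hiff _ (by omega)]
      rintro ⟨-, h1, h2⟩
      apply h'; omega
  · rw [if_neg h, eq_comm]
    refine Finset.sum_eq_zero fun k hk => if_neg ?_
    have hk := Finset.mem_range.mp hk
    rw [hiff _ (by omega)]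
    exact fun h'' => h h''.1

theorem wt_transfer {N a b k : ℕ} (h : k ≤ a) : wt N (b + k) + wt N (a - k) = wt N a + wt N b := by
  simp only [wt]; push_cast [h]; ring

theorem prod_wt_transfer {m N : ℕ} {t : ℂ} (ht : t ≠ 0) (i : Fin (m - 1)) (x : Fin m → ℕ) {k : ℕ}
    (hk : k ≤ x (left i)) (A : Finset (Fin m)) (hA : left i ∈ A ↔ right i ∈ A) :
    ∏ r ∈ A, (t ^ 2) ^ wt N (transfer i x k r) = ∏ r ∈ A, (t ^ 2) ^ wt N (x r) := by
  by_cases h : left i ∈ A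
  · have hr : right i ∈ A.erase (left i) :=
      Finset.mem_erase.mpr ⟨(left_ne_right i).symm, hA.mp h⟩
    simp only [← Finset.mul_prod_erase A _ h, ← Finset.mul_prod_erase _ _ hr, transfer_left,
      transfer_right, ← mul_assoc]
    rw [← zpow_add₀ (pow_ne_zero 2 ht), ← zpow_add₀ (pow_ne_zero 2 ht), wt_transfer hk]
    congr 1
    refine Finset.prod_congr rfl fun r hr => ?_
    simp only [Finset.mem_erase] at hr
    rw [transfer_of_ne _ _ _ hr.2.1 hr.1]
  · refine Finset.prod_congr rfl fun r hr => ?_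
    rw [transfer_of_ne _ _ _ (fun h' => h (h' ▸ hr)) (fun h' => h (hA.mpr (h' ▸ hr)))]

theorem mem_filter_left_iff {m : ℕ} (i : Fin (m - 1)) {s : Fin m} (h : s ≠ left i) :
    left i ∈ Finset.univ.filter (fun r => s < r) ↔ right i ∈ Finset.univ.filter (fun r => s < r) := by
  simp only [Finset.mem_filter, Finset.mem_univ, true_and, left, right, Fin.lt_def, ne_eq,
    Fin.ext_iff] at *
  omega

theorem raiseCoeff_left {m N : ℕ} (t : ℂ) (i : Fin (m - 1)) (x : Fin m → ℕ) :
    raiseCoeff N t x (left i) = qdiff (t ^ 2) ((N : ℤ) - 1 - x (left i)) *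
      ((t ^ 2) ^ wt N (x (right i)) *
        ∏ r ∈ Finset.univ.filter (fun r => right i < r), (t ^ 2) ^ wt N (x r)) := by
  rw [raiseCoeff]
  have : Finset.univ.filter (fun r => left i < r) =
      insert (right i) (Finset.univ.filter (fun r => right i < r)) := by
    ext r
    simp only [Finset.mem_filter, Finset.mem_univ, true_and, left, right, Fin.lt_def,
      Finset.mem_insert, Fin.ext_iff]
    omega
  rw [this, Finset.prod_insert (by simp)]

theorem raiseCoeff_transfer_of_ne {m N : ℕ} {t : ℂ} (ht : t ≠ 0) (i : Fin (m - 1)) (x : Fin m → ℕ)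
    {k : ℕ} (hk : k ≤ x (left i)) {s : Fin m} (h1 : s ≠ left i) (h2 : s ≠ right i) :
    raiseCoeff N t (transfer i x k) s = raiseCoeff N t x s := by
  rw [raiseCoeff, raiseCoeff, transfer_of_ne _ _ _ h1 h2,
    prod_wt_transfer ht i x hk _ (mem_filter_left_iff i h1)]

theorem transfer_update_of_ne {m : ℕ} (i : Fin (m - 1)) (x : Fin m → ℕ) (k c : ℕ) {s : Fin m}
    (h1 : s ≠ left i) (h2 : s ≠ right i) :
    transfer i (Function.update x s c) k = Function.update (transfer i x k) s c := by
  ext r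
  simp only [transfer, Function.update_apply, h1.symm, h2.symm, if_false]
  split_ifs <;> simp_all

/-- The formula for the braiding requires all labels to be below N. If raising violates this, then x
s = N - 1 and the coefficient in front vanishes. -/
theorem tensorGen_transpose_mulVec_update {m N : ℕ} (t : ℂ) (i : Fin (m - 1)) {x : Fin m → ℕ}
    (hx : ∀ s, x s < N) (s : Fin m) :
    raiseCoeff N t x s •
        (tensorGen m N t i).transpose.mulVec (ket (Function.update x s (x s + 1))) =
      raiseCoeff N t x s • ∑ k ∈ Finset.range (Function.update x s (x s + 1) (left i) + 1),
        braidCoeff N t (Function.update x s (x s + 1) (left i))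
          (Function.update x s (x s + 1) (right i)) k •
          ket (transfer i (Function.update x s (x s + 1)) k) := by
  rcases Nat.lt_or_ge (x s + 1) N with h | h
  · rw [tensorGen_transpose_mulVec_ket]
    intro r
    rw [Function.update_apply]
    split_ifs
    · exact h
    · exact hx r
  · have : raiseCoeff N t x s = 0 := by
      rw [raiseCoeff, show (N : ℤ) - 1 - x s = 0 by have := hx s; omega, qdiff_zero, zero_mul]
    rw [this, zero_smul, zero_smul]

/-- The braiding commutes with the quantum group. For a raised factor away from the two strands this
holds because a transfer preserves their total weight; the two terms that raise one of the strands
themselves are handled by `braidCoeff_intertwine`. -/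
theorem tensorGen_transpose_mul_raising {m N : ℕ} {t : ℂ} (ht : t ≠ 0) (i : Fin (m - 1)) :
    (tensorGen m N t i).transpose * raising m N t =
      raising m N t * (tensorGen m N t i).transpose := by
  refine Matrix.ext_of_mulVec_single fun x' => ?_
  rw [← ket_val]
  set x : Fin m → ℕ := fun s => (x' s : ℕ) with hxdef
  have hx : ∀ s, x s < N := fun s => (x' s).isLt
  rw [← Matrix.mulVec_mulVec, ← Matrix.mulVec_mulVec, raising_mulVec_ket,
    tensorGen_transpose_mulVec_ket t i hx, Matrix.mulVec_sum, Matrix.mulVec_sum]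
  simp only [Matrix.mulVec_smul, tensorGen_transpose_mulVec_update t i hx, raising_mulVec_ket]
  simp only [Finset.smul_sum, smul_smul]
  rw [Finset.sum_comm (s := Finset.range (x (left i) + 1))]
  have hr : right i ∈ Finset.univ.erase (left i) := by simp [(left_ne_right i).symm]
  have hl := left_ne_right i
  simp only [← Finset.add_sum_erase _ _ (Finset.mem_univ (left i)), ← Finset.add_sum_erase _ _ hr,
    ← add_assoc]
  congr 1
  · simp only [Function.update_self, Function.update_of_ne hl, Function.update_of_ne hl.symm]
    set a := x (left i)
    set b := x (right i)
    set P := ∏ r ∈ Finset.univ.filter (fun r => right i < r), (t ^ 2) ^ wt N (x r)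
    set E : ℕ → (Fin m → Fin N) → ℂ := fun k =>
      ket (Function.update (Function.update x (left i) (b + k)) (right i) (a + 1 - k))
    have hP : ∀ k ≤ a, ∏ r ∈ Finset.univ.filter (fun r => right i < r),
        (t ^ 2) ^ wt N (transfer i x k r) = P := fun k hk =>
      prod_wt_transfer ht i x hk _ (by simp [left, right, Fin.lt_def])
    have k1 : ∀ k, (ket (transfer i (Function.update x (left i) (a + 1)) k) :
        (Fin m → Fin N) → ℂ) = E k := fun k => by
      simp only [E, transfer, Function.update_self, Function.update_idem,
        Function.update_of_ne hl.symm, a, b]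
    have k2 : ∀ k, (ket (transfer i (Function.update x (right i) (b + 1)) k) :
        (Fin m → Fin N) → ℂ) = E (k + 1) := fun k => by
      simp only [E, transfer, Function.update_self, Function.update_of_ne hl, a, b]
      rw [Function.update_comm hl, Function.update_idem, Function.update_comm hl,
        show x (right i) + 1 + k = x (right i) + (k + 1) by ring, Nat.add_sub_add_right]
    have k3 : ∀ k, (ket (Function.update (transfer i x k) (left i) (transfer i x k (left i) + 1)) :
        (Fin m → Fin N) → ℂ) = E (k + 1) := fun k => by
      rw [transfer_left]
      simp only [E, transfer, a, b]
      rw [Function.update_comm hl.symm, Function.update_idem, Nat.add_sub_add_right, add_assoc]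
    have k4 : ∀ k ≤ a, (ket (Function.update (transfer i x k) (right i)
        (transfer i x k (right i) + 1)) : (Fin m → Fin N) → ℂ) = E k := fun k hk => by
      rw [transfer_right]
      simp only [E, transfer, a, b]
      rw [Function.update_idem, Nat.sub_add_comm hk]
    have hg1 : raiseCoeff N t x (left i) =
        qdiff (t ^ 2) ((N : ℤ) - 1 - a) * (t ^ 2) ^ wt N b * P := by
      rw [raiseCoeff_left, mul_assoc]
    have hg2 : raiseCoeff N t x (right i) = qdiff (t ^ 2) ((N : ℤ) - 1 - b) * P := rfl
    have hL3 : ∑ k ∈ Finset.range (a + 1), (braidCoeff N t a b k *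
        raiseCoeff N t (transfer i x k) (left i)) •
          (ket (Function.update (transfer i x k) (left i) (transfer i x k (left i) + 1)) :
            (Fin m → Fin N) → ℂ) =
        ∑ k ∈ Finset.range (a + 1), (braidCoeff N t a b k *
          (qdiff (t ^ 2) (N - 1 - (b + k)) * (t ^ 2) ^ wt N (a - k)) * P) • E (k + 1) := by
      refine Finset.sum_congr rfl fun k hk => ?_
      have hk : k ≤ a := by simpa [Nat.lt_succ_iff] using hk
      rw [k3, raiseCoeff_left, hP k hk, transfer_left, transfer_right]
      congr 1; push_cast; ring
    have hL4 : ∑ k ∈ Finset.range (a + 1), (braidCoeff N t a b k *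
        raiseCoeff N t (transfer i x k) (right i)) •
          (ket (Function.update (transfer i x k) (right i) (transfer i x k (right i) + 1)) :
            (Fin m → Fin N) → ℂ) =
        ∑ k ∈ Finset.range (a + 1 + 1), (braidCoeff N t a b k *
          qdiff (t ^ 2) (N - 1 - (a - k)) * P) • E k := by
      -- A vanishing term k = a + 1 is added, so that both sides run over the vectors E 0, …, E (a +
      -- 1).
      rw [Finset.sum_range_succ _ (a + 1), braidCoeff_succ_self]
      simp only [zero_mul, zero_smul, add_zero]
      refine Finset.sum_congr rfl fun k hk => ?_
      have hk : k ≤ a := by simpa [Nat.lt_succ_iff] using hk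
      rw [k4 k hk, raiseCoeff, hP k hk, transfer_right, Nat.cast_sub hk, ← mul_assoc]
    rw [hL3, hL4]
    simp only [k1, k2, hg1, hg2]
    -- The coefficients of E (k + 1) are compared by `braidCoeff_intertwine`, that of E 0 by
    -- `braidCoeff_zero`.
    rw [Finset.sum_range_succ' _ (a + 1), Finset.sum_range_succ' _ (a + 1),
      add_right_comm, ← add_assoc, ← Finset.sum_add_distrib, ← Finset.sum_add_distrib]
    congr 1
    · refine Finset.sum_congr rfl fun k hk => ?_
      have hk : k ≤ a := by simpa [Nat.lt_succ_iff] using hk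
      rw [← add_smul, ← add_smul]
      congr 1
      have := braidCoeff_intertwine ht (hx (right i)) hk
      push_cast
      linear_combination P * this
    · congr 1
      have := braidCoeff_zero ht N a b
      rw [Nat.cast_zero, sub_zero]
      linear_combination (qdiff (t ^ 2) ((N : ℤ) - 1 - a) * P) * this
  · refine Finset.sum_congr rfl fun s hs => ?_
    simp only [Finset.mem_erase, Finset.mem_univ, and_true] at hs
    simp only [Function.update_of_ne hs.1.symm, Function.update_of_ne hs.2.symm]
    refine Finset.sum_congr rfl fun k hk => ?_
    have hk : k ≤ x (left i) := by simpa [Nat.lt_succ_iff] using hk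
    rw [raiseCoeff_transfer_of_ne ht i x hk hs.2 hs.1, transfer_update_of_ne i x k _ hs.2 hs.1,
      transfer_of_ne i x k hs.2 hs.1, mul_comm]

/-! ### Matrices congruent modulo a singular intertwiner -/

section Intertwiner

variable {ι : Type*} [Fintype ι] [DecidableEq ι]

/-- A linear section of G over its range, extended to the whole space. It serves to insert or remove
a factor G s inside a trace although G is singular. -/
theorem Matrix.exists_pseudoinverse (G : Matrix ι ι ℂ) : ∃ s : Matrix ι ι ℂ, G * s * G = G := by
  obtain ⟨g, hg⟩ := (Matrix.toLin' G).rangeRestrict.exists_rightInverse_of_surjective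
    (LinearMap.range_rangeRestrict _)
  obtain ⟨g', hg'⟩ := g.exists_extend
  refine ⟨LinearMap.toMatrix' g', Matrix.toLin'.injective ?_⟩
  rw [Matrix.toLin'_mul, Matrix.toLin'_mul, Matrix.toLin'_toMatrix']
  ext1 i
  ext1
  set x := (LinearMap.single ℂ (fun _ : ι => ℂ) i) 1
  have h1 : g' (Matrix.toLin' G x) = g ((Matrix.toLin' G).rangeRestrict x) :=
    LinearMap.congr_fun hg' ((Matrix.toLin' G).rangeRestrict x)
  have h2 := LinearMap.congr_fun hg ((Matrix.toLin' G).rangeRestrict x)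
  have h3 := congrArg Subtype.val h2
  simp only [LinearMap.comp_apply] at h3 ⊢
  rw [h1]
  exact h3

/-- If `A` takes values in the image of `G` and `A'` vanishes on the kernel of `G`, and `G`
intertwines them, then `A` and `A'` have the same trace, also when twisted with a matrix `D` with
which `G` commutes up to a factor. -/
theorem Matrix.trace_eq_of_intertwine {A A' G X Y D : Matrix ι ι ℂ} {c : ℂ} (h1 : A = G * X)
    (h2 : A' = Y * G) (h : A * G = G * A') (hD : D * G = c • (G * D)) :
    (A * D).trace = c * (A' * D).trace := by
  obtain ⟨s, hs⟩ := G.exists_pseudoinverse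
  subst h1 h2
  -- Cyclicity carries a factor G to the right of D, and commuting it past D costs c. Then G X G = G
  -- Y G by the intertwining relation, and the same moves in reverse order remove s again.
  calc (G * X * D).trace = (G * s * G * X * D).trace := by rw [hs]
    _ = (s * (G * X * (D * G))).trace := by
      rw [Matrix.mul_assoc, Matrix.mul_assoc, Matrix.mul_assoc, Matrix.trace_mul_comm]
      simp only [Matrix.mul_assoc]
    _ = c * (s * ((G * X * G) * D)).trace := by
      rw [hD, Matrix.mul_smul, Matrix.mul_smul, Matrix.trace_smul, smul_eq_mul]
      simp only [Matrix.mul_assoc]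
    _ = (s * G * Y * (c • (G * D))).trace := by
      rw [h, Matrix.mul_smul, Matrix.trace_smul, smul_eq_mul]
      simp only [Matrix.mul_assoc]
    _ = (Y * D * (G * s * G)).trace := by
      rw [← hD, Matrix.mul_assoc, Matrix.mul_assoc, Matrix.trace_mul_comm, Matrix.mul_assoc,
        Matrix.trace_mul_comm]
      simp only [Matrix.mul_assoc]
    _ = c * (Y * G * D).trace := by
      rw [hs, Matrix.mul_assoc, hD, Matrix.mul_smul, Matrix.trace_smul, smul_eq_mul,
        Matrix.mul_assoc]

/-- A matrix that `G` intertwines with another one takes values in the image of `G` if the basis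
vectors on which it does not vanish are, up to the image of `G`, combinations of smaller ones. -/
theorem Matrix.exists_eq_mul_of_intertwine {d d' G : Matrix ι ι ℂ} (h : d * G = G * d') (f : ι → ℕ)
    (hG : ∀ x, (∀ y, d y x = 0) ∨ ∃ z, G x z ≠ 0 ∧ ∀ x', x' ≠ x → G x' z ≠ 0 → f x' < f x) :
    ∃ X, d = G * X := by
  have key : ∀ n x, f x < n → ∃ v, d.col x = G.mulVec v := by
    intro n
    induction n with
    | zero => intro x hx; omega
    | succ n ih =>
      intro x hx
      rcases hG x with h0 | ⟨z, hz, hz'⟩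
      · exact ⟨0, by ext y; simp [h0]⟩
      · have hz'' : ∀ x', ∃ v, x' ≠ x → G x' z • d.col x' = G.mulVec v := by
          intro x'
          by_cases h1 : x' = x
          · exact ⟨0, fun h => absurd h1 h⟩
          by_cases h2 : G x' z = 0
          · exact ⟨0, fun _ => by simp [h2]⟩
          · obtain ⟨v, hv⟩ := ih x' (by have := hz' x' h1 h2; omega)
            exact ⟨G x' z • v, fun _ => by rw [hv, Matrix.mulVec_smul]⟩
        choose v hv using hz''
        -- Applying d to the column z of G gives G d' e_z, which lies in the image. That column is a
        -- nonzero multiple of e_x plus smaller basis vectors, on which d takes values in the image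
        -- by induction.
        have e : G.mulVec (d'.col z) = ∑ x', G x' z • d.col x' := by
          ext y
          have := congrFun (congrFun h y) z
          rw [Matrix.mul_apply, Matrix.mul_apply] at this
          simp only [Matrix.mulVec, dotProduct, Matrix.col_apply, Finset.sum_apply, Pi.smul_apply,
            smul_eq_mul]
          rw [← this]
          exact Finset.sum_congr rfl fun _ _ => mul_comm _ _
        rw [← Finset.add_sum_erase _ _ (Finset.mem_univ x),
          Finset.sum_congr rfl fun x' hx' => hv x' (Finset.ne_of_mem_erase hx')] at e
        refine ⟨(G x z)⁻¹ • (d'.col z - ∑ x' ∈ Finset.univ.erase x, v x'), ?_⟩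
        rw [Matrix.mulVec_smul, Matrix.mulVec_sub, e, Matrix.mulVec_sum, add_sub_cancel_right,
          smul_smul, inv_mul_cancel₀ hz, one_smul]
  choose v hv using fun x => key (f x + 1) x (Nat.lt_succ_self _)
  refine ⟨Matrix.of fun y x => v x y, ?_⟩
  ext y x
  have := congrFun (hv x) y
  rw [Matrix.col_apply] at this
  rw [this]
  rfl

/-- Congruence modulo the image of `G` is compatible with integer powers. -/
theorem Matrix.zpow_sub_zpow_eq_mul {A R G : Matrix ι ι ℂ} (hA : IsUnit A.det)
    (hR : IsUnit R.det) (hAG : A * G = G * A)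
    (h : ∃ X, A - R = G * X) (n : ℤ) : ∃ X, A ^ n - R ^ n = G * X := by
  obtain ⟨X, hX⟩ := h
  have hnat : ∀ {A R X : Matrix ι ι ℂ}, A * G = G * A → A - R = G * X →
      ∀ n : ℕ, ∃ X, A ^ n - R ^ n = G * X := by
    intro A R X hAG hX n
    induction n with
    | zero => exact ⟨0, by simp⟩
    | succ n ih =>
      obtain ⟨Y, hY⟩ := ih
      refine ⟨A * Y + X * R ^ n, ?_⟩
      have e : A ^ (n + 1) - R ^ (n + 1) = A * (A ^ n - R ^ n) + (A - R) * R ^ n := by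
        rw [pow_succ', pow_succ']; noncomm_ring
      rw [e, hY, hX, ← Matrix.mul_assoc, hAG]; noncomm_ring
  have hAi : A⁻¹ * G = G * A⁻¹ := by
    rw [← Matrix.mul_one (A⁻¹ * G), ← Matrix.mul_nonsing_inv A hA, ← Matrix.mul_assoc,
      Matrix.mul_assoc A⁻¹ G A, ← hAG, ← Matrix.mul_assoc A⁻¹, Matrix.nonsing_inv_mul A hA,
      Matrix.one_mul]
  cases n with
  | ofNat n =>
    obtain ⟨Y, hY⟩ := hnat hAG hX n
    exact ⟨Y, by simpa using hY⟩
  | negSucc n =>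
    have hXi : A⁻¹ - R⁻¹ = G * (-(A⁻¹ * X * R⁻¹)) := by
      have : A⁻¹ - R⁻¹ = -(A⁻¹ * (A - R) * R⁻¹) := by
        rw [Matrix.mul_sub, Matrix.sub_mul, Matrix.nonsing_inv_mul A hA, Matrix.mul_assoc,
          Matrix.mul_nonsing_inv R hR]
        simp
      rw [this, hX, ← Matrix.mul_assoc, hAi]; noncomm_ring
    obtain ⟨Y, hY⟩ := hnat hAi hXi (n + 1)
    exact ⟨Y, by simpa [zpow_negSucc, Matrix.inv_pow'] using hY⟩

/-- Up to the permutation p the matrix is triangular. If A v = 0, the row p x involves, besides v x,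
only entries v x' with f (p x') < f (p x), so v vanishes by induction. -/
theorem Matrix.isUnit_det_of_triangular {A : Matrix ι ι ℂ} (p : Equiv.Perm ι) (f : ι → ℕ)
    (h1 : ∀ x, A (p x) x ≠ 0) (h2 : ∀ y x, A y x ≠ 0 → y ≠ p x → f (p x) < f y) :
    IsUnit A.det := by
  rw [← Matrix.isUnit_iff_isUnit_det, ← Matrix.mulVec_injective_iff_isUnit]
  rw [← Matrix.coe_mulVecLin, ← LinearMap.ker_eq_bot, LinearMap.ker_eq_bot']
  intro v hv
  have key : ∀ n x, f (p x) < n → v x = 0 := by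
    intro n
    induction n with
    | zero => intro x hx; omega
    | succ n ih =>
      intro x hx
      have := congrFun hv (p x)
      rw [Matrix.mulVecLin_apply, Matrix.mulVec, dotProduct, Finset.sum_eq_single x] at this
      · exact (mul_eq_zero.mp this).resolve_left (h1 x)
      · intro x' _ hne
        by_cases h0 : A (p x) x' = 0
        · rw [h0, zero_mul]
        · rw [ih x' (by have := h2 _ _ h0 (fun h => hne (p.injective h).symm); omega), mul_zero]
      · simp
  ext x
  exact key _ x (Nat.lt_succ_self _)

end Intertwiner

/-! ### The braid that moves one strand across all the others -/

/-- The label c = j + k being 0 forces k = 0, so only the diagonal part of the R-matrix survives. In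
the next lemma the same happens because j = N - 1 leaves no room for k > 0. -/
theorem braiding_eq_zero_left {N : ℕ} (t : ℂ) {d : Fin N} {c : Fin N} (hc : (c : ℕ) = 0)
    (i j : Fin N) :
    braiding N t (c, d) (i, j) = if i = d ∧ j = c then t ^ (slWeight N c * slWeight N d) else 0 := by
  simp only [braiding, hc, Fin.ext_iff]
  by_cases h : (j : ℕ) ≤ 0 ∧ 0 + (d : ℕ) = i + j
  · rw [if_pos h, if_pos (by omega)]
    simp [gaussBinom_zero_right]
  · rw [if_neg h, if_neg (by omega)]

theorem braiding_eq_last_right {N : ℕ} (t : ℂ) {i : Fin N} {j : Fin N} (hj : (j : ℕ) + 1 = N)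
    (c d : Fin N) :
    braiding N t (c, d) (i, j) = if c = j ∧ d = i then t ^ (slWeight N j * slWeight N i) else 0 := by
  simp only [braiding, Fin.ext_iff]
  have := c.isLt
  by_cases h : (j : ℕ) ≤ c ∧ (c : ℕ) + d = i + j
  · have hc : c = j := by ext; omega
    have hd : d = i := by ext; omega
    rw [if_pos h, if_pos (by omega), hc, hd]
    simp [gaussBinom_zero_right]
  · rw [if_neg h, if_neg (by omega)]

/-- The summand k = 0 of the braiding is the flip with nonzero coefficients, and every other summand
strictly increases the label of the left strand beyond that of the flip. -/
theorem isUnit_det_tensorGen {m N : ℕ} {t : ℂ} (ht : t ≠ 0) (i : Fin (m - 1)) :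
    IsUnit (tensorGen m N t i).det := by
  have hl := left_ne_right i
  refine Matrix.isUnit_det_of_triangular
    (Equiv.arrowCongr (Equiv.swap (left i) (right i)) (Equiv.refl _)) (fun y => y (left i)) ?_ ?_
  · intro x
    rw [tensorGen, if_pos]
    · simp only [Equiv.arrowCongr_apply, Equiv.coe_refl, Function.comp_apply, id, Equiv.symm_swap,
        Equiv.swap_apply_left, Equiv.swap_apply_right, braiding]
      rw [if_pos ⟨le_rfl, add_comm _ _⟩]
      simp only [Nat.sub_self, gaussBinom_zero_right, Finset.range_zero, Finset.prod_empty, mul_one,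
        zero_mul, pow_zero, one_mul]
      exact zpow_ne_zero _ ht
    · intro s h1 h2
      simp [Equiv.swap_apply_of_ne_of_ne h1 h2]
  · intro y x h hne
    simp only [Equiv.arrowCongr_apply, Equiv.coe_refl, Function.comp_apply, id, Equiv.symm_swap,
      Equiv.swap_apply_left]
    rw [tensorGen] at h
    split_ifs at h with h1
    · simp only [braiding] at h
      split_ifs at h with h2
      · refine lt_of_le_of_ne h2.1 fun he => hne ?_
        ext s
        simp only [Equiv.arrowCongr_apply, Equiv.coe_refl, Function.comp_apply, id,
          Equiv.symm_swap]
        by_cases hs1 : s = left i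
        · rw [hs1, Equiv.swap_apply_left, he]
        by_cases hs2 : s = right i
        · rw [hs2, Equiv.swap_apply_right]; omega
        rw [Equiv.swap_apply_of_ne_of_ne hs1 hs2, h1 s hs1 hs2]
      · exact absurd rfl h
    · exact absurd rfl h

section Products

variable {ι : Type*} [Fintype ι] [DecidableEq ι]

theorem Matrix.mulVec_ofFn_prod {M : ℕ} (g : Fin M → Matrix ι ι ℂ) (u : Fin (M + 1) → ι → ℂ)
    (c : Fin M → ℂ) (h : ∀ r, (g r).mulVec (u r.succ) = c r • u r.castSucc) :
    (List.ofFn g).prod.mulVec (u (Fin.last M)) = (∏ r, c r) • u 0 := by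
  induction M with
  | zero => simp
  | succ M ih =>
    rw [List.ofFn_succ, List.prod_cons, ← Matrix.mulVec_mulVec, ← Fin.succ_last]
    have := ih (fun r => g r.succ) (fun r => u r.succ) (fun r => c r.succ)
      (fun r => by rw [h r.succ, Fin.castSucc_succ])
    rw [this, Matrix.mulVec_smul, Fin.succ_zero_eq_one, ← Fin.succ_zero_eq_one, h 0,
      Fin.prod_univ_succ, smul_smul, mul_comm]
    rfl

theorem Matrix.vecMul_ofFn_prod {M : ℕ} (g : Fin M → Matrix ι ι ℂ) (u : Fin (M + 1) → ι → ℂ)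
    (c : Fin M → ℂ) (h : ∀ r, (g r).vecMul (u r.castSucc) = c r • u r.succ) :
    (List.ofFn g).prod.vecMul (u 0) = (∏ r, c r) • u (Fin.last M) := by
  induction M with
  | zero => simp
  | succ M ih =>
    rw [List.ofFn_succ, List.prod_cons, ← Matrix.vecMul_vecMul]
    have h0 : (g 0).vecMul (u 0) = c 0 • u 1 := h 0
    have := ih (fun r => g r.succ) (fun r => u r.succ) (fun r => c r.succ)
      (fun r => by rw [← Fin.castSucc_succ, h r.succ])
    rw [h0, Matrix.smul_vecMul, ← Fin.succ_zero_eq_one, this, Fin.prod_univ_succ, smul_smul]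
    rfl

end Products

theorem prod_zpow_eq_zpow_sum {t : ℂ} (ht : t ≠ 0) {κ : Type*} (s : Finset κ) (f : κ → ℤ) :
    ∏ r ∈ s, t ^ f r = t ^ ∑ r ∈ s, f r := by
  induction s using Finset.cons_induction with
  | empty => simp
  | cons a s ha ih => rw [Finset.prod_cons, Finset.sum_cons, zpow_add₀ ht, ih]

theorem left_eq_castSucc {M : ℕ} (r : Fin M) : (left (m := M + 1) r) = r.castSucc := rfl

theorem right_eq_succ {M : ℕ} (r : Fin M) : (right (m := M + 1) r) = r.succ := rfl

theorem insertNth_castSucc_eq_succ {α : Type*} {M : ℕ} (r : Fin M) (v : α) (a : Fin M → α)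
    {s : Fin (M + 1)} (h1 : s ≠ r.castSucc) (h2 : s ≠ r.succ) :
    (Fin.insertNth r.castSucc v a : Fin (M + 1) → α) s =
      (Fin.insertNth r.succ v a : Fin (M + 1) → α) s := by
  obtain ⟨j, rfl⟩ := Fin.exists_succAbove_eq h1
  have hj : j ≠ r := by rintro rfl; exact h2 (Fin.succAbove_castSucc_self _)
  have : r.castSucc.succAbove j = r.succ.succAbove j := by
    rcases lt_or_gt_of_ne hj with h | h
    · rw [Fin.succAbove_castSucc_of_lt _ _ h, Fin.succAbove_succ_of_le _ _ h.le]
    · rw [Fin.succAbove_castSucc_of_le _ _ h.le, Fin.succAbove_succ_of_lt _ _ h]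
  rw [Fin.insertNth_apply_succAbove, this, Fin.insertNth_apply_succAbove]

theorem eq_insertNth_castSucc_iff {α : Type*} {M : ℕ} (r : Fin M) (v : α) (a : Fin M → α)
    (y : Fin (M + 1) → α) : y = Fin.insertNth r.castSucc v a ↔
      (∀ s, s ≠ r.castSucc → s ≠ r.succ → y s = (Fin.insertNth r.succ v a : Fin (M + 1) → α) s) ∧
        y r.castSucc = v ∧ y r.succ = a r := by
  have e := Fin.insertNth_apply_succAbove (α := fun _ => α) r.castSucc v a r
  rw [Fin.succAbove_castSucc_self] at e
  constructor
  · rintro rfl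
    exact ⟨fun s h1 h2 => insertNth_castSucc_eq_succ r v a h1 h2, Fin.insertNth_apply_same _ _ _, e⟩
  · rintro ⟨h, h1, h2⟩
    ext s
    by_cases hs1 : s = r.castSucc
    · rw [hs1, h1, Fin.insertNth_apply_same]
    by_cases hs2 : s = r.succ
    · rw [hs2, h2, e]
    rw [h s hs1 hs2, insertNth_castSucc_eq_succ r v a hs1 hs2]

theorem eq_insertNth_succ_iff {α : Type*} {M : ℕ} (r : Fin M) (v : α) (a : Fin M → α)
    (y : Fin (M + 1) → α) : y = Fin.insertNth r.succ v a ↔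
      (∀ s, s ≠ r.castSucc → s ≠ r.succ →
        (Fin.insertNth r.castSucc v a : Fin (M + 1) → α) s = y s) ∧
        y r.castSucc = a r ∧ y r.succ = v := by
  have e := Fin.insertNth_apply_succAbove (α := fun _ => α) r.succ v a r
  rw [Fin.succAbove_succ_self] at e
  constructor
  · rintro rfl
    exact ⟨fun s h1 h2 => insertNth_castSucc_eq_succ r v a h1 h2, e, Fin.insertNth_apply_same _ _ _⟩
  · rintro ⟨h, h1, h2⟩
    ext s
    by_cases hs1 : s = r.castSucc
    · rw [hs1, h1, e]
    by_cases hs2 : s = r.succ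
    · rw [hs2, h2, Fin.insertNth_apply_same]
    rw [← h s hs1 hs2, insertNth_castSucc_eq_succ r v a hs1 hs2]

theorem tensorGen_vecMul_insertNth {M N : ℕ} (t : ℂ) {v : Fin N} (hv : (v : ℕ) = 0)
    (a : Fin M → Fin N) (r : Fin M) :
    (tensorGen (M + 1) N t r).vecMul (Pi.single (Fin.insertNth r.castSucc v a) 1) =
      t ^ (slWeight N v * slWeight N (a r)) • Pi.single (Fin.insertNth r.succ v a) 1 := by
  rw [Matrix.single_one_vecMul]
  ext y
  have e := Fin.insertNth_apply_succAbove (α := fun _ => Fin N) r.castSucc v a r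
  rw [Fin.succAbove_castSucc_self] at e
  rw [Matrix.row_apply, tensorGen, left_eq_castSucc, right_eq_succ, e, Fin.insertNth_apply_same,
    braiding_eq_zero_left t hv, ← ite_and, Pi.smul_apply, Pi.single_apply, smul_eq_mul, mul_ite,
    mul_one, mul_zero]
  exact if_congr (eq_insertNth_succ_iff r v a y).symm rfl rfl

theorem tensorGen_mulVec_insertNth {M N : ℕ} (t : ℂ) {v : Fin N} (hv : (v : ℕ) + 1 = N)
    (a : Fin M → Fin N) (r : Fin M) :
    (tensorGen (M + 1) N t r).mulVec (Pi.single (Fin.insertNth r.succ v a) 1) =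
      t ^ (slWeight N v * slWeight N (a r)) • Pi.single (Fin.insertNth r.castSucc v a) 1 := by
  rw [Matrix.mulVec_single_one]
  ext y
  have e := Fin.insertNth_apply_succAbove (α := fun _ => Fin N) r.succ v a r
  rw [Fin.succAbove_succ_self] at e
  rw [Matrix.col_apply, tensorGen, left_eq_castSucc, right_eq_succ, e, Fin.insertNth_apply_same,
    braiding_eq_last_right t hv, ← ite_and, Pi.smul_apply, Pi.single_apply, smul_eq_mul, mul_ite,
    mul_one, mul_zero]
  exact if_congr (eq_insertNth_castSucc_iff r v a y).symm rfl rfl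

/-- The action of the braid `σ₁ ⋯ σ_M` on the tensor power. -/
def cyclicBraid (M N : ℕ) (t : ℂ) : Matrix (Fin (M + 1) → Fin N) (Fin (M + 1) → Fin N) ℂ :=
  (List.ofFn fun r : Fin M => tensorGen (M + 1) N t r).prod

/-- The strand with label 0 is carried across all the others, picking up only a power of t at each
crossing. On these rows the braid is therefore a weighted cyclic shift; `cyclicBraid_col` is the
counterpart for the label N - 1. -/
theorem cyclicBraid_row {M N : ℕ} {t : ℂ} (ht : t ≠ 0) {v : Fin N} (hv : (v : ℕ) = 0)
    (a : Fin M → Fin N) (y : Fin (M + 1) → Fin N) :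
    cyclicBraid M N t (Fin.cons v a) y =
      if y = Fin.snoc a v then t ^ (slWeight N v * ∑ r, slWeight N (a r)) else 0 := by
  have h := Matrix.vecMul_ofFn_prod (fun r : Fin M => tensorGen (M + 1) N t r)
    (fun p => Pi.single (Fin.insertNth p v a : Fin (M + 1) → Fin N) 1) _
    (fun r => tensorGen_vecMul_insertNth t hv a r)
  have h' := congrFun h y
  rw [Matrix.single_one_vecMul, Matrix.row_apply, Fin.insertNth_zero', Fin.insertNth_last'] at h'
  rw [cyclicBraid, h', Pi.smul_apply, Pi.single_apply, smul_eq_mul, mul_ite, mul_one, mul_zero,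
    Finset.mul_sum]
  congr 1
  exact (prod_zpow_eq_zpow_sum ht _ _)

theorem cyclicBraid_col {M N : ℕ} {t : ℂ} (ht : t ≠ 0) {v : Fin N} (hv : (v : ℕ) + 1 = N)
    (a : Fin M → Fin N) (y : Fin (M + 1) → Fin N) :
    cyclicBraid M N t y (Fin.snoc a v) =
      if y = Fin.cons v a then t ^ (slWeight N v * ∑ r, slWeight N (a r)) else 0 := by
  have h := Matrix.mulVec_ofFn_prod (fun r : Fin M => tensorGen (M + 1) N t r)
    (fun p => Pi.single (Fin.insertNth p v a : Fin (M + 1) → Fin N) 1) _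
    (fun r => tensorGen_mulVec_insertNth t hv a r)
  have h' := congrFun h y
  rw [Matrix.mulVec_single_one, Matrix.col_apply, Fin.insertNth_zero', Fin.insertNth_last'] at h'
  rw [cyclicBraid, h', Pi.smul_apply, Pi.single_apply, smul_eq_mul, mul_ite, mul_one, mul_zero,
    Finset.mul_sum]
  congr 1
  exact (prod_zpow_eq_zpow_sum ht _ _)

/-! ### Monomial matrices -/

section Monomial

variable {ι : Type*} [Fintype ι] [DecidableEq ι]

/-- The matrix that maps the basis vector `e_x` to `c x • e_{p x}`. -/
def monomialMatrix (p : Equiv.Perm ι) (c : ι → ℂ) : Matrix ι ι ℂ :=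
  fun y x => if y = p x then c x else 0

theorem monomialMatrix_mul (p q : Equiv.Perm ι) (c d : ι → ℂ) :
    monomialMatrix p c * monomialMatrix q d = monomialMatrix (p * q) fun x => c (q x) * d x := by
  ext y x
  rw [Matrix.mul_apply, Finset.sum_eq_single (q x)]
  · simp only [monomialMatrix, if_true, ite_mul, zero_mul]
    exact if_congr Iff.rfl rfl rfl
  · intro z _ hz; simp [monomialMatrix, hz]
  · simp

theorem isUnit_det_monomialMatrix {p : Equiv.Perm ι} {c : ι → ℂ} (hc : ∀ x, c x ≠ 0) :
    IsUnit (monomialMatrix p c).det := by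
  refine Matrix.isUnit_det_of_triangular p (fun _ => 0) (fun x => ?_) (fun y x h hne => ?_)
  · simpa [monomialMatrix] using hc x
  · simp [monomialMatrix, hne] at h

theorem monomialMatrix_inv {p : Equiv.Perm ι} {c : ι → ℂ} (hc : ∀ x, c x ≠ 0) :
    (monomialMatrix p c)⁻¹ = monomialMatrix p⁻¹ fun x => (c (p⁻¹ x))⁻¹ := by
  refine Matrix.inv_eq_right_inv ?_
  rw [monomialMatrix_mul, mul_inv_cancel]
  ext y x
  simp [monomialMatrix, Matrix.one_apply, hc]

/-- The coefficients of the power are recorded only at the fixed points of p, since no others will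
enter the trace. -/
theorem exists_monomialMatrix_zpow (p : Equiv.Perm ι) {c : ι → ℂ} (hc : ∀ x, c x ≠ 0) (n : ℤ) :
    ∃ c' : ι → ℂ, monomialMatrix p c ^ n = monomialMatrix (p ^ n) c' ∧
      ∀ x, p x = x → c' x = c x ^ n := by
  have hnat : ∀ n : ℕ, ∃ c' : ι → ℂ, (∀ x, c' x ≠ 0) ∧
      monomialMatrix p c ^ n = monomialMatrix (p ^ n) c' ∧ ∀ x, p x = x → c' x = c x ^ n := by
    intro n
    induction n with
    | zero =>
      refine ⟨fun _ => 1, fun _ => one_ne_zero, ?_, by simp⟩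
      ext y x; simp [monomialMatrix, Matrix.one_apply]
    | succ n ih =>
      obtain ⟨c', h0, h1, h2⟩ := ih
      refine ⟨fun x => c' (p x) * c x, fun x => mul_ne_zero (h0 _) (hc _), ?_, fun x hx => ?_⟩
      · rw [pow_succ, h1, monomialMatrix_mul, pow_succ]
      · simp only [hx, h2 x hx, pow_succ]
  cases n with
  | ofNat n => obtain ⟨c', -, h⟩ := hnat n; exact ⟨c', by simpa using h⟩
  | negSucc n =>
    obtain ⟨c', h0, h1, h2⟩ := hnat (n + 1)
    refine ⟨fun x => (c' ((p ^ (n + 1))⁻¹ x))⁻¹, ?_, fun x hx => ?_⟩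
    · rw [zpow_negSucc, h1, monomialMatrix_inv h0, zpow_negSucc]
    · have : (p ^ (n + 1))⁻¹ x = x := by
        rw [Equiv.Perm.inv_eq_iff_eq]
        exact ((Function.IsFixedPt.perm_pow hx (n + 1))).symm
      simp only [this, h2 x hx, zpow_negSucc]

theorem trace_monomialMatrix_mul_diagonal (p : Equiv.Perm ι) (c d : ι → ℂ) :
    (monomialMatrix p c * Matrix.diagonal d).trace = ∑ x, if p x = x then c x * d x else 0 := by
  rw [Matrix.trace]
  refine Finset.sum_congr rfl fun x _ => ?_
  rw [Matrix.diag_apply, Matrix.mul_diagonal, monomialMatrix]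
  by_cases h : p x = x
  · rw [if_pos h.symm, if_pos h]
  · rw [if_neg fun h' => h h'.symm, if_neg h, zero_mul]

end Monomial

/-! ### Cyclic cyclicShift of the tensor factors -/

/-- The cyclicShift that moves the first label to the end. -/
def cyclicShift (M N : ℕ) : Equiv.Perm (Fin (M + 1) → Fin N) :=
  Equiv.arrowCongr (finRotate (M + 1)).symm (Equiv.refl _)

theorem cyclicShift_apply {M N : ℕ} (x : Fin (M + 1) → Fin N) (s : Fin (M + 1)) :
    cyclicShift M N x s = x (finRotate (M + 1) s) := rfl

theorem cyclicShift_cons {M N : ℕ} (v : Fin N) (a : Fin M → Fin N) :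
    cyclicShift M N (Fin.cons v a) = Fin.snoc a v := by
  ext s
  rw [cyclicShift_apply]
  refine Fin.lastCases ?_ (fun j => ?_) s
  · rw [finRotate_last, Fin.snoc_last, Fin.cons_zero]
  · rw [finRotate_apply, Fin.coeSucc_eq_succ, Fin.snoc_castSucc, Fin.cons_succ]

open scoped Fin.NatCast Fin.CommRing in
theorem cyclicShift_pow_apply {M N : ℕ} (k : ℕ) (x : Fin (M + 1) → Fin N) (s : Fin (M + 1)) :
    (cyclicShift M N ^ k) x s = x (s + (k : Fin (M + 1))) := by
  induction k generalizing s with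
  | zero => simp
  | succ k ih =>
    rw [pow_succ', Equiv.Perm.mul_apply, cyclicShift_apply, ih, finRotate_apply]
    congr 1; push_cast; ring

open scoped Fin.NatCast Fin.CommRing in
theorem cyclicShift_pow_self (M N : ℕ) : cyclicShift M N ^ (M + 1) = 1 := by
  ext x s
  rw [cyclicShift_pow_apply]
  simp

open scoped Fin.NatCast Fin.CommRing in
theorem cyclicShift_eq_self_iff {M N : ℕ} (x : Fin (M + 1) → Fin N) :
    cyclicShift M N x = x ↔ ∃ i, x = fun _ => i := by
  constructor
  · intro h
    refine ⟨x 0, funext fun s => ?_⟩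
    have h' : (cyclicShift M N ^ (s : ℕ)) x 0 = x 0 :=
      congrFun (Function.IsFixedPt.perm_pow (e := cyclicShift M N) h s) 0
    rw [cyclicShift_pow_apply] at h'
    simpa using h'
  · rintro ⟨i, rfl⟩
    rfl

/-- The (M + 1)-st power of the shift is trivial, so by coprimality the shift is itself a power of
its n-th power. In the trace formula this is where it matters that the closure is a knot. -/
theorem cyclicShift_zpow_eq_self_iff {M N : ℕ} {n : ℤ} (h : IsCoprime ((M + 1 : ℕ) : ℤ) n)
    (x : Fin (M + 1) → Fin N) : (cyclicShift M N ^ n) x = x ↔ ∃ i, x = fun _ => i := by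
  rw [← cyclicShift_eq_self_iff]
  constructor
  · intro hx
    obtain ⟨a, b, hab⟩ := h
    have e : cyclicShift M N = (cyclicShift M N ^ n) ^ b := by
      conv_lhs => rw [← zpow_one (cyclicShift M N), ← hab, zpow_add, mul_comm a, zpow_mul,
        zpow_natCast, cyclicShift_pow_self, one_zpow, one_mul, mul_comm, zpow_mul]
    rw [e]
    exact Function.IsFixedPt.perm_zpow (e := cyclicShift M N ^ n) hx b
  · intro hx
    exact Function.IsFixedPt.perm_zpow (e := cyclicShift M N) hx n

/-- The coefficients of the twisted cyclicShifts. -/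
def rotCoeff (M N : ℕ) (t : ℂ) (ε : ℤ) (x : Fin (M + 1) → Fin N) : ℂ :=
  t ^ (-((N : ℤ) ^ 2 - 1) + (∑ s, slWeight N (x s) + ε) * slWeight N (x 0))

theorem rotCoeff_ne_zero {t : ℂ} (ht : t ≠ 0) (M N : ℕ) (ε : ℤ) (x : Fin (M + 1) → Fin N) :
    rotCoeff M N t ε x ≠ 0 := zpow_ne_zero _ ht

theorem ket_cyclicShift {M N : ℕ} (x y : Fin (M + 1) → Fin N) (s : Fin (M + 1)) (c : ℕ) :
    (ket (Function.update (fun r => (cyclicShift M N x r : ℕ)) s c) : (Fin (M + 1) → Fin N) → ℂ)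
      (cyclicShift M N y) =
    ket (Function.update (fun r => (x r : ℕ)) (finRotate (M + 1) s) c) y := by
  simp only [ket]
  refine if_congr ?_ rfl rfl
  refine Iff.trans (forall_congr' fun r => ?_) ((finRotate (M + 1)).forall_congr_right
    (q := fun r => (y r : ℕ) = Function.update (fun r => (x r : ℕ)) (finRotate (M + 1) s) c r))
  simp only [cyclicShift_apply, Function.update_apply, EmbeddingLike.apply_eq_iff_eq]

/-- A comparison of exponents. If the raised factor is the first one, the shift makes it the last
and its coefficient loses the weights of all the others; for any other factor the coefficient gains
the weight of x 0. Raising lowers the total weight by 2, which turns ε = 2 into ε = -2. -/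
theorem raiseCoeff_cyclicShift {M N : ℕ} {t : ℂ} (ht : t ≠ 0) (x y : Fin (M + 1) → Fin N)
    (s : Fin (M + 1))
    (hy : ∀ r, (y r : ℕ) = Function.update (fun r => (x r : ℕ)) (finRotate (M + 1) s)
      (x (finRotate (M + 1) s) + 1) r) :
    rotCoeff M N t 2 y * raiseCoeff N t (fun r => (x r : ℕ)) (finRotate (M + 1) s) =
      raiseCoeff N t (fun r => (cyclicShift M N x r : ℕ)) s * rotCoeff M N t (-2) x := by
  have hw : ∑ r, slWeight N (y r) = ∑ r, slWeight N (x r) - 2 := by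
    have : ∀ r, slWeight N (y r) =
        slWeight N (x r) + if r = finRotate (M + 1) s then -2 else 0 := by
      intro r
      simp only [slWeight, hy, Function.update_apply]
      split_ifs with h
      · subst h; push_cast; ring
      · ring
    simp only [this, Finset.sum_add_distrib, Finset.sum_ite_eq', Finset.mem_univ, if_true]
    ring
  have hz : ∀ k : ℤ, (t ^ 2) ^ k = t ^ (2 * k) := fun k => by
    rw [zpow_mul]; norm_cast
  simp only [raiseCoeff, cyclicShift_apply, rotCoeff, hw]
  rw [mul_left_comm, mul_assoc]
  congr 1
  simp only [Finset.prod_filter]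
  revert hy
  refine Fin.lastCases (fun hy => ?_) (fun j hy => ?_) s
  · rw [finRotate_last] at *
    have h0 : slWeight N (y 0) = slWeight N (x 0) - 2 := by
      simp only [slWeight, hy, Function.update_self]; push_cast; ring
    rw [Fin.prod_univ_succ, Fin.sum_univ_succ, h0]
    simp only [lt_irrefl, if_false, one_mul, Fin.succ_pos, if_true, hz]
    rw [prod_zpow_eq_zpow_sum ht, Finset.prod_eq_one fun r _ => if_neg (not_lt.mpr (Fin.le_last r)),
      one_mul, ← zpow_add₀ ht, ← Finset.mul_sum]
    congr 1
    have : ∑ i : Fin M, wt N (x i.succ) = ∑ i : Fin M, slWeight N (x i.succ) := rfl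
    rw [this]
    ring
  · rw [finRotate_apply, Fin.coeSucc_eq_succ] at *
    have h0 : slWeight N (y 0) = slWeight N (x 0) := by
      simp only [slWeight, hy]
      rw [Function.update_of_ne (Fin.succ_ne_zero j).symm]
    rw [h0, Fin.prod_univ_succ, Fin.prod_univ_castSucc]
    simp only [finRotate_apply, Fin.coeSucc_eq_succ, Fin.not_lt_zero, if_false, one_mul,
      Fin.castSucc_lt_castSucc_iff, Fin.succ_lt_succ_iff, Fin.castSucc_lt_last, if_true,
      Fin.last_add_one, hz]
    rw [mul_comm, mul_assoc, ← zpow_add₀ ht]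
    congr 2
    have : wt N (x 0) = slWeight N (x 0) := rfl
    rw [this]
    ring

/-- The coproduct is not cocommutative, so no single weighted shift plays the part of both: two sets
of weights are needed on the two sides of the raising operator. -/
theorem cyclicShift_mul_raising {M N : ℕ} {t : ℂ} (ht : t ≠ 0) :
    monomialMatrix (cyclicShift M N) (rotCoeff M N t 2) * raising (M + 1) N t =
      raising (M + 1) N t * monomialMatrix (cyclicShift M N) (rotCoeff M N t (-2)) := by
  ext y' x
  obtain ⟨y, rfl⟩ := (cyclicShift M N).surjective y'
  rw [Matrix.mul_apply, Matrix.mul_apply, Finset.sum_eq_single y, Finset.sum_eq_single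
    (cyclicShift M N x)]
  · simp only [monomialMatrix, if_true, raising, Finset.mul_sum, Finset.sum_mul]
    rw [← Equiv.sum_comp (finRotate (M + 1))]
    refine Finset.sum_congr rfl fun s _ => ?_
    rw [cyclicShift_apply, ket_cyclicShift]
    by_cases h : ∀ r, (y r : ℕ) = Function.update (fun r => (x r : ℕ)) (finRotate (M + 1) s)
      (x (finRotate (M + 1) s) + 1) r
    · have := raiseCoeff_cyclicShift ht x y s h
      rw [← mul_assoc, this]; ring
    · simp only [ket, if_neg h, mul_zero, zero_mul]
  · intro z _ hz; simp [monomialMatrix, hz]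
  · simp
  · intro z _ hz
    rw [monomialMatrix, if_neg fun h => hz ((cyclicShift M N).injective h.symm), zero_mul]
  · simp

/-! ### The coloured Jones polynomial of torus knots -/

theorem exists_of_raising_ne_zero {m N : ℕ} {t : ℂ} {y z : Fin m → Fin N}
    (h : raising m N t y z ≠ 0) :
    ∃ s, ∀ r, (y r : ℕ) = Function.update (fun r => (z r : ℕ)) s (z s + 1) r := by
  by_contra! hne
  refine h (Finset.sum_eq_zero fun s _ => ?_)
  obtain ⟨r, hr⟩ := hne s
  rw [ket, if_neg fun h => hr (h r), mul_zero]

/-- Only one summand contributes, and its coefficient is a quantum integer of index between 1 and N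
- 1. The hypothesis `hq` says that t is generic enough for this colour. -/
theorem raising_ne_zero {m N : ℕ} {t : ℂ} (ht : t ≠ 0)
    (hq : ∀ k : ℕ, 0 < k → k < N → qdiff (t ^ 2) k ≠ 0) {y z : Fin m → Fin N} {s : Fin m}
    (h : ∀ r, (y r : ℕ) = Function.update (fun r => (z r : ℕ)) s (z s + 1) r) :
    raising m N t y z ≠ 0 := by
  rw [raising, Finset.sum_eq_single s]
  · rw [ket, if_pos h, mul_one, raiseCoeff]
    refine mul_ne_zero ?_ (Finset.prod_ne_zero_iff.mpr fun r _ =>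
      zpow_ne_zero _ (pow_ne_zero 2 ht))
    have h1 := h s
    rw [Function.update_self] at h1
    have h2 := (y s).isLt
    have := hq (N - 1 - z s) (by omega) (by omega)
    rwa [show ((N - 1 - z s : ℕ) : ℤ) = (N : ℤ) - 1 - (z s : ℕ) by omega] at this
  · intro s' _ hne
    rw [ket, if_neg, mul_zero]
    intro h'
    have h1 := h' s'
    rw [h, Function.update_self, Function.update_of_ne hne] at h1
    omega
  · simp

theorem transpose_cyclicBraid_mul_raising {M N : ℕ} {t : ℂ} (ht : t ≠ 0) :
    (cyclicBraid M N t).transpose * raising (M + 1) N t =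
      raising (M + 1) N t * (cyclicBraid M N t).transpose := by
  have h : Commute (raising (M + 1) N t).transpose (cyclicBraid M N t) := by
    refine Commute.list_prod_right _ _ fun A hA => ?_
    obtain ⟨r, rfl⟩ := (List.mem_ofFn' _ _).mp hA
    have := congrArg Matrix.transpose (tensorGen_transpose_mul_raising (N := N) ht
      (m := M + 1) r)
    rw [Matrix.transpose_mul, Matrix.transpose_mul, Matrix.transpose_transpose] at this
    exact this
  have := congrArg Matrix.transpose h.eq
  simpa [Matrix.transpose_mul] using this

theorem isUnit_det_cyclicBraid {M N : ℕ} {t : ℂ} (ht : t ≠ 0) :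
    IsUnit (cyclicBraid M N t).det := by
  rw [← Matrix.isUnit_iff_isUnit_det, cyclicBraid]
  refine List.prod_isUnit fun A hA => ?_
  obtain ⟨r, rfl⟩ := (List.mem_ofFn' _ _).mp hA
  exact (Matrix.isUnit_iff_isUnit_det _).mpr (isUnit_det_tensorGen ht _)

/-- The difference intertwines with G and vanishes on the labellings with first label 0, by
`cyclicBraid_row`. Every other basis vector is reduced to these modulo the image of G by lowering
its first label. -/
theorem exists_cyclicBraid_sub_eq_mul {M N : ℕ} {t : ℂ} (ht : t ≠ 0)
    (hq : ∀ k : ℕ, 0 < k → k < N → qdiff (t ^ 2) k ≠ 0) :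
    ∃ X, (cyclicBraid M N t).transpose - monomialMatrix (cyclicShift M N) (rotCoeff M N t 2) =
      raising (M + 1) N t * X := by
  refine Matrix.exists_eq_mul_of_intertwine (d' := (cyclicBraid M N t).transpose -
    monomialMatrix (cyclicShift M N) (rotCoeff M N t (-2))) ?_ (fun x => x 0) fun x => ?_
  · rw [Matrix.sub_mul, Matrix.mul_sub, transpose_cyclicBraid_mul_raising ht,
      cyclicShift_mul_raising ht]
  · by_cases h0 : (x 0 : ℕ) = 0
    · left
      intro y
      obtain ⟨v, a, rfl⟩ : ∃ v a, x = Fin.cons v a := ⟨x 0, Fin.tail x, (Fin.cons_self_tail x).symm⟩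
      rw [Fin.cons_zero] at h0
      rw [Matrix.sub_apply, Matrix.transpose_apply, cyclicBraid_row ht h0, monomialMatrix,
        cyclicShift_cons, sub_eq_zero]
      refine if_congr Iff.rfl ?_ rfl
      -- For first weight w = N - 1 and ε = 2 the term -(N² - 1) cancels against w(w + 2), leaving
      -- the product of w with the remaining weights. For w = -(N - 1) and ε = -2 the cancellation
      -- is the same.
      rw [rotCoeff, Fin.sum_univ_succ]
      simp only [Fin.cons_zero, Fin.cons_succ]
      congr 1
      have : slWeight N v = (N : ℤ) - 1 := by simp [slWeight, h0]
      rw [this]; ring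
    · right
      -- Raising the first factor of z gives back x; raising any other factor keeps the first label
      -- at x 0 - 1, hence smaller.
      set z := Function.update x 0 ⟨x 0 - 1, by omega⟩ with hz
      have hzx : ∀ r, (x r : ℕ) = Function.update (fun r => (z r : ℕ)) 0 (z 0 + 1) r := by
        intro r
        by_cases hr : r = 0
        · subst hr; simp only [Function.update_self, hz]; omega
        · rw [Function.update_of_ne hr, hz, Function.update_of_ne hr]
      refine ⟨z, raising_ne_zero ht hq hzx, fun x' hne hx' => ?_⟩
      obtain ⟨s, hs⟩ := exists_of_raising_ne_zero hx'
      by_cases h : s = 0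
      · subst h
        exact absurd (funext fun r => Fin.ext (by rw [hs, hzx])) hne
      · rw [hs, Function.update_of_ne (Ne.symm h), hz, Function.update_self]
        dsimp only
        omega

/-- The dual argument for the transposed matrices: the difference vanishes where the last label is N
- 1, and the induction increases the last label towards that value. -/
theorem exists_cyclicBraid_sub_eq_mul' {M N : ℕ} {t : ℂ} (ht : t ≠ 0)
    (hq : ∀ k : ℕ, 0 < k → k < N → qdiff (t ^ 2) k ≠ 0) :
    ∃ Y, ((cyclicBraid M N t).transpose -
      monomialMatrix (cyclicShift M N) (rotCoeff M N t (-2))).transpose =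
      (raising (M + 1) N t).transpose * Y := by
  refine Matrix.exists_eq_mul_of_intertwine (d' := ((cyclicBraid M N t).transpose -
    monomialMatrix (cyclicShift M N) (rotCoeff M N t 2)).transpose) ?_
      (fun y => N - y (Fin.last M)) fun y => ?_
  · rw [← Matrix.transpose_mul, ← Matrix.transpose_mul, Matrix.sub_mul, Matrix.mul_sub,
      transpose_cyclicBraid_mul_raising ht, cyclicShift_mul_raising ht]
  · by_cases h0 : (y (Fin.last M) : ℕ) + 1 = N
    · left
      intro x
      obtain ⟨a, v, rfl⟩ : ∃ a v, y = Fin.snoc a v :=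
        ⟨Fin.init y, y (Fin.last M), (Fin.snoc_init_self y).symm⟩
      rw [Fin.snoc_last] at h0
      rw [Matrix.transpose_apply, Matrix.sub_apply, Matrix.transpose_apply, cyclicBraid_col ht h0,
        monomialMatrix, sub_eq_zero, ← cyclicShift_cons]
      refine if_ctx_congr ((cyclicShift M N).injective.eq_iff.symm.trans eq_comm) (fun h => ?_)
        fun _ => rfl
      obtain rfl := (cyclicShift M N).injective h
      rw [rotCoeff, Fin.sum_univ_succ]
      simp only [Fin.cons_zero, Fin.cons_succ]
      congr 1
      have : slWeight N v = -((N : ℤ) - 1) := by simp only [slWeight]; omega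
      rw [this]; ring
    · right
      set z := Function.update y (Fin.last M)
        ⟨y (Fin.last M) + 1, by have := (y (Fin.last M)).isLt; omega⟩ with hz
      have hzy : ∀ r, (z r : ℕ) =
          Function.update (fun r => (y r : ℕ)) (Fin.last M) (y (Fin.last M) + 1) r := by
        intro r
        by_cases hr : r = Fin.last M
        · subst hr; simp only [Function.update_self, hz]
        · rw [Function.update_of_ne hr, hz, Function.update_of_ne hr]
      refine ⟨z, raising_ne_zero ht hq hzy, fun y' hne hy' => ?_⟩
      obtain ⟨s, hs⟩ := exists_of_raising_ne_zero hy'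
      have hlast := hzy (Fin.last M)
      rw [Function.update_self] at hlast
      by_cases h : s = Fin.last M
      · subst h
        refine absurd (funext fun r => Fin.ext ?_) hne
        have h1 := hs r
        rw [hzy] at h1
        by_cases hr : r = Fin.last M
        · subst hr; simp only [Function.update_self] at h1; omega
        · rw [Function.update_of_ne hr, Function.update_of_ne hr] at h1; exact h1.symm
      · have h1 := hs (Fin.last M)
        rw [Function.update_of_ne (Ne.symm h)] at h1
        have := (y (Fin.last M)).isLt
        omega

/-- The weights of the quantum trace. -/
def traceWeight (M N : ℕ) (t : ℂ) (x : Fin (M + 1) → Fin N) : ℂ := ∏ s, t ^ (2 * slWeight N (x s))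

theorem diagonal_mul_raising {M N : ℕ} {t : ℂ} (ht : t ≠ 0) :
    Matrix.diagonal (traceWeight M N t) * raising (M + 1) N t =
      t ^ (-4 : ℤ) • (raising (M + 1) N t * Matrix.diagonal (traceWeight M N t)) := by
  ext y x
  rw [Matrix.diagonal_mul, Matrix.smul_apply, Matrix.mul_diagonal, smul_eq_mul]
  by_cases h : raising (M + 1) N t y x = 0
  · rw [h]; ring
  · obtain ⟨s, hs⟩ := exists_of_raising_ne_zero h
    have : traceWeight M N t y = t ^ (-4 : ℤ) * traceWeight M N t x := by
      rw [traceWeight, traceWeight, prod_zpow_eq_zpow_sum ht, prod_zpow_eq_zpow_sum ht,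
        ← zpow_add₀ ht]
      congr 1
      have : ∀ r, 2 * slWeight N (y r) = 2 * slWeight N (x r) + if r = s then -4 else 0 := by
        intro r
        simp only [slWeight, hs, Function.update_apply]
        split_ifs with h
        · subst h; push_cast; ring
        · ring
      simp only [this, Finset.sum_add_distrib, Finset.sum_ite_eq', Finset.mem_univ, if_true]
      ring
    rw [this]; ring

theorem trace_monomialMatrix_zpow {M N : ℕ} {t : ℂ} (ht : t ≠ 0) {n : ℤ}
    (h : IsCoprime ((M + 1 : ℕ) : ℤ) n) (ε : ℤ) :
    (monomialMatrix (cyclicShift M N) (rotCoeff M N t ε) ^ n *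
      Matrix.diagonal (traceWeight M N t)).trace =
    ∑ i : Fin N, t ^ (n * (-((N : ℤ) ^ 2 - 1) + ((M + 1) * slWeight N i + ε) * slWeight N i) +
      2 * (M + 1) * slWeight N i) := by
  obtain ⟨c', h1, h2⟩ := exists_monomialMatrix_zpow (cyclicShift M N)
    (rotCoeff_ne_zero ht M N ε) n
  rw [h1, trace_monomialMatrix_mul_diagonal]
  have hval : ∀ i : Fin N, c' (fun _ => i) * traceWeight M N t (fun _ => i) =
      t ^ (n * (-((N : ℤ) ^ 2 - 1) + ((M + 1) * slWeight N i + ε) * slWeight N i) +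
        2 * (M + 1) * slWeight N i) := by
    intro i
    rw [h2 _ ((cyclicShift_eq_self_iff _).mpr ⟨i, rfl⟩), rotCoeff, traceWeight,
      prod_zpow_eq_zpow_sum ht, ← zpow_mul, ← zpow_add₀ ht]
    congr 1
    simp only [Finset.sum_const, Finset.card_univ, Fintype.card_fin, nsmul_eq_mul]
    push_cast; ring
  simp only [← hval]
  rw [← Finset.sum_filter]
  refine (Finset.sum_nbij (fun i => fun _ => i) ?_ ?_ ?_ fun _ _ => rfl).symm
  · intro i _
    simpa using (cyclicShift_zpow_eq_self_iff h _).mpr ⟨i, rfl⟩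
  · intro i _ j _ hij
    exact congrFun hij 0
  · intro x hx
    obtain ⟨i, rfl⟩ := (cyclicShift_zpow_eq_self_iff h x).mp (by simpa using hx)
    exact ⟨i, by simp, rfl⟩

/-- The n-th powers of the braid and of the two shifts still differ by G X on one side and by Y G on
the other. The equality of the traces of these differences, up to t⁻⁴, is solved for the trace of
the braid. -/
theorem trace_cyclicBraid_zpow {M N : ℕ} {t : ℂ} (ht : t ≠ 0)
    (hq : ∀ k : ℕ, 0 < k → k < N → qdiff (t ^ 2) k ≠ 0) {n : ℤ}
    (h : IsCoprime ((M + 1 : ℕ) : ℤ) n) :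
    (1 - t ^ (-4 : ℤ)) *
      (Matrix.diagonal (traceWeight M N t) * cyclicBraid M N t ^ n).trace =
    ∑ i : Fin N, t ^ (n * (-((N : ℤ) ^ 2 - 1) + ((M + 1) * slWeight N i + 2) * slWeight N i) +
      2 * (M + 1) * slWeight N i) - t ^ (-4 : ℤ) *
    ∑ i : Fin N, t ^ (n * (-((N : ℤ) ^ 2 - 1) + ((M + 1) * slWeight N i + (-2)) * slWeight N i) +
      2 * (M + 1) * slWeight N i) := by
  have hA : IsUnit (cyclicBraid M N t).transpose.det := by
    rw [Matrix.det_transpose]; exact isUnit_det_cyclicBraid ht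
  have hAG := transpose_cyclicBraid_mul_raising (M := M) (N := N) ht
  have hR := fun ε => isUnit_det_monomialMatrix (p := cyclicShift M N)
    (rotCoeff_ne_zero ht M N ε)
  set G := raising (M + 1) N t
  set A := (cyclicBraid M N t).transpose with hAdef
  let R := monomialMatrix (cyclicShift M N) (rotCoeff M N t 2)
  let R' := monomialMatrix (cyclicShift M N) (rotCoeff M N t (-2))
  obtain ⟨X, hX⟩ := Matrix.zpow_sub_zpow_eq_mul hA (hR 2) hAG
    (exists_cyclicBraid_sub_eq_mul ht hq) n
  obtain ⟨Y, hY⟩ := Matrix.zpow_sub_zpow_eq_mul (A := A.transpose) (R := R'.transpose)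
    (G := G.transpose) (by rwa [Matrix.det_transpose])
    (by rw [Matrix.det_transpose]; exact hR (-2))
    (by rw [← Matrix.transpose_mul, ← hAG, Matrix.transpose_mul])
    (by rw [← Matrix.transpose_sub]; exact exists_cyclicBraid_sub_eq_mul' ht hq) n
  have hY' : A ^ n - R' ^ n = Y.transpose * G := by
    have := congrArg Matrix.transpose hY
    rwa [Matrix.transpose_sub, Matrix.transpose_zpow, Matrix.transpose_zpow, Matrix.transpose_mul,
      Matrix.transpose_transpose, Matrix.transpose_transpose, Matrix.transpose_transpose] at this
  have hzp : ∀ {S S' : Matrix (Fin (M + 1) → Fin N) (Fin (M + 1) → Fin N) ℂ}, IsUnit S.det →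
      IsUnit S'.det → S * G = G * S' → S ^ n * G = G * S' ^ n := by
    intro S S' hS hS' hSG
    exact (Matrix.SemiconjBy.zpow_right hS' hS (show SemiconjBy G S' S from hSG.symm) n).eq.symm
  have hint : (A ^ n - R ^ n) * G = G * (A ^ n - R' ^ n) := by
    rw [Matrix.sub_mul, Matrix.mul_sub, hzp hA hA hAG, hzp (hR 2) (hR (-2))
      (cyclicShift_mul_raising ht)]
  have key := Matrix.trace_eq_of_intertwine hX hY' hint (diagonal_mul_raising ht)
  rw [Matrix.sub_mul, Matrix.sub_mul, Matrix.trace_sub, Matrix.trace_sub,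
    trace_monomialMatrix_zpow ht h, trace_monomialMatrix_zpow ht h] at key
  have htr : (Matrix.diagonal (traceWeight M N t) * cyclicBraid M N t ^ n).trace =
      (A ^ n * Matrix.diagonal (traceWeight M N t)).trace := by
    rw [← Matrix.trace_transpose, Matrix.transpose_mul, Matrix.transpose_zpow,
      Matrix.diagonal_transpose]
  rw [htr]
  linear_combination key

theorem BraidWord.eval_torus {M : ℕ} {ι : Type} [Fintype ι] [DecidableEq ι]
    (g : Fin M → Matrix ι ι ℂ) (n : ℤ) :
    (BraidWord.torus (M + 1) n).eval (m := M + 1) g = (List.ofFn g).prod ^ n := by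
  have h1 : ((List.finRange M).map g).prod = (List.ofFn g).prod := by rw [List.ofFn_eq_map]
  cases n with
  | ofNat n =>
    rw [BraidWord.torus, BraidWord.eval, List.map_flatten, List.prod_flatten, List.map_replicate,
      List.map_replicate, List.prod_replicate, List.map_map, ← h1]
    simp only [Int.ofNat_eq_natCast, zpow_natCast]
    rfl
  | negSucc n =>
    rw [BraidWord.torus, BraidWord.eval, List.map_flatten, List.prod_flatten, List.map_replicate,
      List.map_replicate, List.prod_replicate, List.map_map, ← h1, zpow_negSucc,
      ← Matrix.inv_pow', Matrix.list_prod_inv_reverse, List.map_reverse, List.map_reverse,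
      List.map_map]
    rfl

theorem BraidWord.writhe_torus (M : ℕ) (n : ℤ) :
    (BraidWord.torus (M + 1) n).writhe = M * n := by
  cases n with
  | ofNat n =>
    simp [BraidWord.torus, BraidWord.writhe, List.map_flatten, mul_comm, Function.comp_def]
  | negSucc n =>
    simp [BraidWord.torus, BraidWord.writhe, List.map_flatten, mul_comm, Function.comp_def,
      Int.negSucc_eq]
    ring

/-- The writhe is M n, so the framing correction completes the factor t^{-n(N²-1)} of the shifts to
t^{-(M+1)n(N²-1)}, and the result becomes a sum over the weights of one copy of the representation.
-/
theorem colouredJones_torus {M N : ℕ} {t : ℂ} (ht : t ≠ 0)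
    (hq : ∀ k : ℕ, 0 < k → k < N → qdiff (t ^ 2) k ≠ 0) {n : ℤ}
    (h : IsCoprime ((M + 1 : ℕ) : ℤ) n) :
    (t ^ (2 : ℤ) - t ^ (-2 : ℤ)) *
      colouredJones (M + 1) N t (BraidWord.torus (M + 1) n) =
    ∑ i : Fin N, (t ^ ((M + 1) * n * (slWeight N i ^ 2 - ((N : ℤ) ^ 2 - 1)) +
        2 * (M + 1) * slWeight N i + 2 * n * slWeight N i + 2) -
      t ^ ((M + 1) * n * (slWeight N i ^ 2 - ((N : ℤ) ^ 2 - 1)) +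
        2 * (M + 1) * slWeight N i - 2 * n * slWeight N i - 2)) := by
  have key := trace_cyclicBraid_zpow (M := M) ht hq h
  have he : (BraidWord.torus (M + 1) n).eval (tensorGen (M + 1) N t) = cyclicBraid M N t ^ n :=
    BraidWord.eval_torus _ n
  rw [colouredJones, he, BraidWord.writhe_torus]
  change _ * (_ * (Matrix.diagonal (traceWeight M N t) * cyclicBraid M N t ^ n).trace) = _
  have e : t ^ (2 : ℤ) - t ^ (-2 : ℤ) = t ^ (2 : ℤ) * (1 - t ^ (-4 : ℤ)) := by
    rw [mul_sub, mul_one, ← zpow_add₀ ht]; norm_num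
  rw [e, mul_mul_mul_comm, key, ← zpow_add₀ ht, Finset.mul_sum, ← Finset.sum_sub_distrib,
    Finset.mul_sum]
  refine Finset.sum_congr rfl fun i _ => ?_
  rw [mul_sub, ← zpow_add₀ ht, ← zpow_add₀ ht, ← zpow_add₀ ht]
  congr 2 <;> ring

/-! ### The zeros of the Alexander polynomial of torus knots -/

section Fixed

variable {ι : Type*} [Fintype ι] [DecidableEq ι]

theorem Matrix.zpow_mulVec_of_mulVec_eq_smul {A : Matrix ι ι ℂ} (hA : IsUnit A.det) {v : ι → ℂ}
    {c : ℂ} (hc : c ≠ 0) (h : A.mulVec v = c • v) (n : ℤ) : (A ^ n).mulVec v = c ^ n • v := by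
  have hnat : ∀ {A : Matrix ι ι ℂ} {c : ℂ}, A.mulVec v = c • v →
      ∀ n : ℕ, (A ^ n).mulVec v = c ^ n • v := by
    intro A c h n
    induction n with
    | zero => simp
    | succ n ih => rw [pow_succ, ← Matrix.mulVec_mulVec, h, Matrix.mulVec_smul, ih, smul_smul,
        pow_succ']
  cases n with
  | ofNat n => simpa using hnat h n
  | negSucc n =>
    rw [zpow_negSucc, zpow_negSucc, ← Matrix.inv_pow', ← inv_pow]
    refine hnat ?_ _
    have : v = c⁻¹ • A.mulVec v := by rw [h, smul_smul, inv_mul_cancel₀ hc, one_smul]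
    conv_lhs => rw [this]
    rw [Matrix.mulVec_smul, Matrix.mulVec_mulVec, Matrix.nonsing_inv_mul A hA, Matrix.one_mulVec]

theorem Matrix.mulVec_eq_smul_of_isCoprime {A : Matrix ι ι ℂ} (hA : IsUnit A.det) {v : ι → ℂ}
    {c : ℂ} (hc : c ≠ 0) {k l : ℤ} (hkl : IsCoprime k l) (hk : (A ^ k).mulVec v = c ^ k • v)
    (hl : (A ^ l).mulVec v = c ^ l • v) : A.mulVec v = c • v := by
  obtain ⟨a, b, hab⟩ := hkl
  have h1 : A = (A ^ k) ^ a * (A ^ l) ^ b := by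
    rw [← Matrix.zpow_mul A hA, ← Matrix.zpow_mul A hA, ← Matrix.zpow_add hA, mul_comm k,
      mul_comm l, hab, zpow_one]
  rw [h1, ← Matrix.mulVec_mulVec,
    Matrix.zpow_mulVec_of_mulVec_eq_smul (hA.det_zpow l) (zpow_ne_zero _ hc) hl,
    Matrix.mulVec_smul,
    Matrix.zpow_mulVec_of_mulVec_eq_smul (hA.det_zpow k) (zpow_ne_zero _ hc) hk, smul_smul,
    ← _root_.zpow_mul, ← _root_.zpow_mul, ← zpow_add₀ hc, add_comm, mul_comm k, mul_comm l, hab, zpow_one]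

theorem Matrix.zpow_mulVec_eq_self {A : Matrix ι ι ℂ} (hA : IsUnit A.det) {v : ι → ℂ}
    (h : A.mulVec v = v) (n : ℤ) : (A ^ n).mulVec v = v := by
  simpa using Matrix.zpow_mulVec_of_mulVec_eq_smul hA one_ne_zero (by rwa [one_smul]) n

end Fixed

/-- The Burau matrix of `σ₁ ⋯ σ_M`. -/
def cyclicBurau (M : ℕ) (t : ℂ) : Matrix (Fin (M + 1)) (Fin (M + 1)) ℂ :=
  (List.ofFn fun r : Fin M => burauGen (M + 1) t r).prod

/-- The vector of the powers of `t`. -/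
def powVec (M : ℕ) (t : ℂ) : Fin (M + 1) → ℂ := fun j => t ^ (j : ℕ)

theorem burauGen_vecMul_pow {M : ℕ} (t : ℂ) (r : Fin M) :
    (burauGen (M + 1) t r).vecMul (powVec M t) = powVec M t := by
  ext s
  rw [Matrix.vecMul, dotProduct, ← Finset.add_sum_erase _ _ (Finset.mem_univ r.castSucc),
    ← Finset.add_sum_erase _ _ (show r.succ ∈ Finset.univ.erase r.castSucc by
      simp [Fin.ext_iff])]
  have hne : r.succ ≠ r.castSucc := by simp [Fin.ext_iff]
  have hrest : ∑ x ∈ (Finset.univ.erase r.castSucc).erase r.succ,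
      t ^ (x : ℕ) * burauGen (M + 1) t r x s =
      if s ≠ r.castSucc ∧ s ≠ r.succ then t ^ (s : ℕ) else 0 := by
    have : ∀ x ∈ (Finset.univ.erase r.castSucc).erase r.succ,
        t ^ (x : ℕ) * burauGen (M + 1) t r x s = if x = s then t ^ (s : ℕ) else 0 := by
      intro x hx
      simp only [Finset.mem_erase, Finset.mem_univ, and_true] at hx
      rw [burauGen, left_eq_castSucc, right_eq_succ, if_neg hx.2, if_neg hx.1]
      split_ifs with h
      · rw [h, mul_one]
      · rw [mul_zero]
    rw [Finset.sum_congr rfl this, Finset.sum_ite_eq']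
    simp [and_comm]
  simp only [powVec]
  rw [hrest]
  simp only [burauGen, left_eq_castSucc, right_eq_succ, if_true, if_neg hne]
  by_cases h1 : s = r.castSucc
  · subst h1; simp [Fin.val_succ]; ring
  · by_cases h2 : s = r.succ
    · subst h2; simp [hne]; ring
    · simp [h1, h2]

theorem cyclicBurau_vecMul_pow (M : ℕ) (t : ℂ) :
    (cyclicBurau M t).vecMul (powVec M t) = powVec M t := by
  have := Matrix.vecMul_ofFn_prod (fun r : Fin M => burauGen (M + 1) t r)
    (fun _ => powVec M t) (fun _ => 1) fun r => by rw [burauGen_vecMul_pow, one_smul]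
  rw [cyclicBurau, this, Finset.prod_const_one, one_smul]

/-- The row vector e_{j+1} is followed through the product: the generators r < j fix it, the
generator r = j turns it into e_j, and the later ones fix e_j. -/
theorem cyclicBurau_mulVec_succ {M : ℕ} (t : ℂ) (x : Fin (M + 1) → ℂ) (j : Fin M) :
    (cyclicBurau M t).mulVec x j.succ = x j.castSucc := by
  have h := Matrix.vecMul_ofFn_prod (fun r : Fin M => burauGen (M + 1) t r)
    (fun p => if p ≤ j.castSucc then Pi.single j.succ 1 else Pi.single j.castSucc 1)
    (fun _ => 1) fun r => ?_
  · rw [if_pos (Fin.zero_le _), if_neg (not_le.mpr (Fin.castSucc_lt_last j)),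
      Finset.prod_const_one, one_smul, Matrix.single_one_vecMul] at h
    rw [Matrix.mulVec, cyclicBurau]
    change Matrix.row (List.ofFn _).prod j.succ ⬝ᵥ x = _
    rw [h, single_dotProduct, one_mul]
  · rw [one_smul]
    rcases lt_trichotomy r j with h | h | h
    · have c1 : r.castSucc ≤ j.castSucc := by
        have := Fin.lt_def.mp h; rw [Fin.le_def, Fin.val_castSucc]; simp; omega
      have c2 : r.succ ≤ j.castSucc := by
        have := Fin.lt_def.mp h; rw [Fin.le_def, Fin.val_castSucc]; simp; omega
      rw [if_pos c1, if_pos c2, Matrix.single_one_vecMul]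
      ext s
      have h1 : j.succ ≠ r.castSucc := by have := Fin.lt_def.mp h; simp [Fin.ext_iff]; omega
      have h2 : j.succ ≠ r.succ := by have := Fin.lt_def.mp h; simp [Fin.ext_iff]; omega
      rw [Matrix.row_apply, burauGen, left_eq_castSucc, right_eq_succ, if_neg h1, if_neg h2,
        Pi.single_apply]
      exact if_congr eq_comm rfl rfl
    · subst h
      rw [if_pos le_rfl, if_neg (by rw [Fin.le_def]; simp), Matrix.single_one_vecMul]
      ext s
      rw [Matrix.row_apply, burauGen, left_eq_castSucc, right_eq_succ,
        if_neg (by simp [Fin.ext_iff]), if_pos rfl, Pi.single_apply]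
    · rw [if_neg (by simpa using h),
        if_neg (by have := Fin.lt_def.mp h; rw [Fin.le_def, Fin.val_castSucc]; simp; omega),
        Matrix.single_one_vecMul]
      ext s
      have h1 : j.castSucc ≠ r.castSucc := by have := Fin.lt_def.mp h; simp [Fin.ext_iff]; omega
      have h2 : j.castSucc ≠ r.succ := by have := Fin.lt_def.mp h; simp [Fin.ext_iff]; omega
      rw [Matrix.row_apply, burauGen, left_eq_castSucc, right_eq_succ, if_neg h1, if_neg h2,
        Pi.single_apply]
      exact if_congr eq_comm rfl rfl

/-- The linear form that is invariant under the Burau matrix. -/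
def burauForm {M : ℕ} (t : ℂ) (x : Fin (M + 1) → ℂ) : ℂ := powVec M t ⬝ᵥ x

theorem burauForm_mulVec {M : ℕ} (t : ℂ) (x : Fin (M + 1) → ℂ) :
    burauForm t ((cyclicBurau M t).mulVec x) = burauForm t x := by
  rw [burauForm, Matrix.dotProduct_mulVec, cyclicBurau_vecMul_pow, burauForm]

theorem burauForm_eq {M : ℕ} (t : ℂ) (x : Fin (M + 1) → ℂ) :
    burauForm t x = x 0 + t * ∑ j : Fin M, t ^ (j : ℕ) * x j.succ := by
  simp only [burauForm, dotProduct, powVec]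
  rw [Fin.sum_univ_succ, Finset.mul_sum]
  simp [pow_succ']
  exact Finset.sum_congr rfl fun _ _ => by ring

theorem burauForm_eq' {M : ℕ} (t : ℂ) (x : Fin (M + 1) → ℂ) :
    burauForm t x = ∑ j : Fin M, t ^ (j : ℕ) * x j.castSucc + t ^ M * x (Fin.last M) := by
  simp only [burauForm, dotProduct, powVec]
  rw [Fin.sum_univ_castSucc]
  simp

theorem cyclicBurau_mulVec_zero {M : ℕ} (t : ℂ) (x : Fin (M + 1) → ℂ) (hx : burauForm t x = 0) :
    (cyclicBurau M t).mulVec x 0 = t ^ (M + 1) * x (Fin.last M) := by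
  have h1 := burauForm_mulVec t x
  rw [hx, burauForm_eq] at h1
  simp only [cyclicBurau_mulVec_succ] at h1
  rw [burauForm_eq'] at hx
  rw [pow_succ]
  linear_combination h1 - t * hx

/-- The invariant form has the coefficient 1 at the entry 0, so its conservation determines the one
entry that the shift relation leaves open. No entry of the Burau matrix has to be computed. -/
theorem cyclicBurau_mulVec_eq_iff {M : ℕ} (t : ℂ) (x y : Fin (M + 1) → ℂ) :
    (cyclicBurau M t).mulVec x = y ↔
      (∀ j : Fin M, x j.castSucc = y j.succ) ∧ burauForm t x = burauForm t y := by
  constructor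
  · rintro rfl
    exact ⟨fun j => (cyclicBurau_mulVec_succ t x j).symm, (burauForm_mulVec t x).symm⟩
  · rintro ⟨h1, h2⟩
    have h3 := burauForm_mulVec t x
    rw [h2, burauForm_eq, burauForm_eq] at h3
    simp only [cyclicBurau_mulVec_succ, h1] at h3
    ext j
    refine Fin.cases ?_ (fun j => ?_) j
    · linear_combination h3
    · rw [cyclicBurau_mulVec_succ, h1]

theorem isUnit_det_cyclicBurau (M : ℕ) {t : ℂ} (ht : t ≠ 0) : IsUnit (cyclicBurau M t).det := by
  rw [← Matrix.isUnit_iff_isUnit_det, ← Matrix.mulVec_injective_iff_isUnit,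
    ← Matrix.coe_mulVecLin, ← LinearMap.ker_eq_bot, LinearMap.ker_eq_bot']
  intro x hx
  obtain ⟨h1, h2⟩ := (cyclicBurau_mulVec_eq_iff t x 0).mp hx
  have h1' : ∀ j : Fin M, x j.castSucc = 0 := h1
  rw [burauForm_eq'] at h2
  simp only [h1', mul_zero, Finset.sum_const_zero, zero_add, burauForm, dotProduct_zero,
    mul_eq_zero] at h2
  ext j
  refine Fin.lastCases ?_ h1' j
  exact h2.resolve_left (pow_ne_zero _ ht)

theorem eq_const_of_cyclicBurau_mulVec_eq_self {M : ℕ} {t : ℂ} {x : Fin (M + 1) → ℂ}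
    (h : (cyclicBurau M t).mulVec x = x) (j : Fin (M + 1)) : x j = x 0 := by
  have h1 := ((cyclicBurau_mulVec_eq_iff t x x).mp h).1
  induction j using Fin.induction with
  | zero => rfl
  | succ j ih => rw [← h1, ih]

theorem cyclicBurau_mulVec_one (M : ℕ) (t : ℂ) :
    (cyclicBurau M t).mulVec (fun _ => 1) = fun _ => 1 :=
  (cyclicBurau_mulVec_eq_iff t _ _).mpr ⟨fun _ => rfl, rfl⟩

/-- On the kernel of the form the matrix shifts entries cyclically, multiplying by t^{M+1} each time
an entry passes from the end to the beginning. After M + 1 steps each entry has passed exactly once.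
-/
theorem cyclicBurau_pow_mulVec {M : ℕ} (t : ℂ) (x : Fin (M + 1) → ℂ) (hx : burauForm t x = 0) :
    (cyclicBurau M t ^ (M + 1)).mulVec x = t ^ (M + 1) • x := by
  have key : ∀ k : ℕ, burauForm t ((cyclicBurau M t ^ k).mulVec x) = 0 ∧
      ∀ i j : Fin (M + 1), ((j : ℕ) = i + k → (cyclicBurau M t ^ k).mulVec x j = x i) ∧
        ((j : ℕ) + (M + 1) = i + k →
          (cyclicBurau M t ^ k).mulVec x j = t ^ (M + 1) * x i) := by
    intro k
    induction k with
    | zero =>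
      refine ⟨by simpa using hx, fun i j => ⟨fun h => ?_, fun h => by omega⟩⟩
      rw [show j = i from Fin.ext h]; simp
    | succ k ih =>
      obtain ⟨h1, h2⟩ := ih
      rw [pow_succ', ← Matrix.mulVec_mulVec]
      refine ⟨by rw [burauForm_mulVec, h1], fun i j => ?_⟩
      refine Fin.cases ⟨fun h => ?_, fun h => ?_⟩ (fun j => ?_) j
      · simp at h
      · rw [cyclicBurau_mulVec_zero t _ h1, (h2 i (Fin.last M)).1]
        simp only [Fin.val_zero, Fin.val_last] at h ⊢; omega
      · rw [cyclicBurau_mulVec_succ]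
        refine ⟨fun h => (h2 i j.castSucc).1 ?_, fun h => (h2 i j.castSucc).2 ?_⟩ <;>
        · simp only [Fin.val_succ, Fin.val_castSucc] at h ⊢; omega
  ext j
  rw [((key (M + 1)).2 j j).2 rfl, Pi.smul_apply, smul_eq_mul]

/-- The Alexander polynomial of a torus knot vanishes at `t` if and only if the Burau matrix fixes
a vector that is not constant. -/
theorem alexander_torus_eq_zero_iff_exists {M : ℕ} {t : ℂ} (ht : t ≠ 0) (n : ℤ) :
    alexander (M + 1) (BraidWord.torus (M + 1) n) t = 0 ↔
      ∃ x : Fin (M + 1) → ℂ, x ≠ 0 ∧ x 0 = 0 ∧ (cyclicBurau M t ^ n).mulVec x = x := by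
  have he : (BraidWord.torus (M + 1) n).eval (burauGen (M + 1) t) = cyclicBurau M t ^ n :=
    BraidWord.eval_torus _ n
  have hB := isUnit_det_cyclicBurau M ht
  have hsum : ∀ (f x : Fin (M + 1) → ℂ), x 0 = 0 →
      ∑ s : {s : Fin (M + 1) // (s : ℕ) ≠ 0}, f s * x s = ∑ s, f s * x s := by
    intro f x hx
    rw [← Finset.sum_subtype (Finset.univ.filter fun s : Fin (M + 1) => (s : ℕ) ≠ 0) (by simp)
      (fun s => f s * x s)]
    refine Finset.sum_filter_of_ne fun s _ hs h0 => hs ?_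
    rw [show s = 0 from Fin.ext h0, hx, mul_zero]
  rw [alexander, he, ← Matrix.exists_mulVec_eq_zero_iff]
  constructor
  · rintro ⟨v, hv, h⟩
    -- Deleting the column 0 amounts to considering vectors whose entry 0 vanishes.
    set x : Fin (M + 1) → ℂ := fun s => if hs : (s : ℕ) ≠ 0 then v ⟨s, hs⟩ else 0 with hxdef
    have hx0 : x 0 = 0 := by simp [hxdef]
    have hxv : ∀ s : {s : Fin (M + 1) // (s : ℕ) ≠ 0}, x s = v s := fun s => by
      simp only [hxdef, dif_pos s.2]
    have h1 : ∀ s : Fin (M + 1), (s : ℕ) ≠ 0 → (1 - cyclicBurau M t ^ n).mulVec x s = 0 := by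
      intro s hs
      have := congrFun h ⟨s, hs⟩
      simp only [Matrix.mulVec, dotProduct, Matrix.submatrix_apply, ← hxv] at this
      rw [hsum (fun s' => (1 - cyclicBurau M t ^ n) s s') x hx0] at this
      exact this
    -- The equation of the deleted row 0 is recovered from the invariant form, which annihilates the
    -- image of 1 - Bⁿ.
    have h2 : burauForm t ((1 - cyclicBurau M t ^ n).mulVec x) = 0 := by
      have e : (cyclicBurau M t ^ n).vecMul (powVec M t) = powVec M t := by
        rw [← Matrix.mulVec_transpose, Matrix.transpose_zpow]
        refine Matrix.zpow_mulVec_eq_self (by rwa [Matrix.det_transpose]) ?_ n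
        rw [Matrix.mulVec_transpose, cyclicBurau_vecMul_pow]
      rw [burauForm, Matrix.dotProduct_mulVec, Matrix.vecMul_sub, e, Matrix.vecMul_one, sub_self,
        zero_dotProduct]
    have h3 : (1 - cyclicBurau M t ^ n).mulVec x = 0 := by
      rw [burauForm_eq] at h2
      simp only [h1 _ (show ((Fin.succ _ : Fin (M + 1)) : ℕ) ≠ 0 by simp), mul_zero,
        Finset.sum_const_zero, add_zero] at h2
      ext s
      by_cases hs : (s : ℕ) = 0
      · rw [show s = 0 from Fin.ext hs]; exact h2
      · exact h1 s hs
    refine ⟨x, fun hx => hv ?_, hx0, ?_⟩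
    · ext s; rw [← hxv, hx]; rfl
    · rw [Matrix.sub_mulVec, Matrix.one_mulVec, sub_eq_zero] at h3
      exact h3.symm
  · rintro ⟨x, hx, hx0, h⟩
    refine ⟨fun s => x s, fun h0 => hx ?_, ?_⟩
    · ext s
      by_cases hs : (s : ℕ) = 0
      · rw [show s = 0 from Fin.ext hs]; exact hx0
      · exact congrFun h0 ⟨s, hs⟩
    · ext s
      simp only [Matrix.mulVec, dotProduct, Matrix.submatrix_apply]
      rw [hsum (fun s' => (1 - cyclicBurau M t ^ n) s s') x hx0]
      change (1 - cyclicBurau M t ^ n).mulVec x s = 0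
      rw [Matrix.sub_mulVec, Matrix.one_mulVec, h, sub_self]
      rfl

/-- With m = M + 1, a nonconstant vector fixed by Bⁿ produces a vector in the kernel of the form
that is fixed by Bⁿ and multiplied by t^m under B^m. Coprimality of m and n then decides which t are
possible. -/
theorem alexander_torus_eq_zero_iff {M : ℕ} {t : ℂ} (ht : t ≠ 0) {n : ℤ} (hn : n ≠ 0)
    (hmn : IsCoprime ((M + 1 : ℕ) : ℤ) n) :
    alexander (M + 1) (BraidWord.torus (M + 1) n) t = 0 ↔
      t ^ ((M + 1 : ℕ) * n) = 1 ∧ t ^ (M + 1) ≠ 1 ∧ t ^ n ≠ 1 := by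
  rw [alexander_torus_eq_zero_iff_exists ht]
  have hB := isUnit_det_cyclicBurau M ht
  have hcomm : ∀ x : Fin (M + 1) → ℂ, (cyclicBurau M t ^ n).mulVec ((cyclicBurau M t).mulVec x) =
      (cyclicBurau M t).mulVec ((cyclicBurau M t ^ n).mulVec x) := fun x => by
    rw [Matrix.mulVec_mulVec, Matrix.mulVec_mulVec,
      (Matrix.Commute.zpow_self (cyclicBurau M t) n).eq]
  constructor
  · rintro ⟨x, hx, hx0, h⟩
    -- Vectors fixed by B are constant, so y ≠ 0; by invariance the form vanishes on y. Hence B^m y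
    -- = t^m y, while Bⁿ y = y, which gives t^{mn} = 1.
    set y := (cyclicBurau M t).mulVec x - x with hy
    have hyl : burauForm t y = 0 := by
      have := burauForm_mulVec t x
      rw [burauForm] at *
      rw [hy, dotProduct_sub, this]; simp [burauForm]
    have hyn : (cyclicBurau M t ^ n).mulVec y = y := by
      rw [hy, Matrix.mulVec_sub, hcomm, h]
    have hym := cyclicBurau_pow_mulVec t y hyl
    have hBx : (cyclicBurau M t).mulVec x ≠ x := fun hBx => hx (funext fun j => by
      rw [eq_const_of_cyclicBurau_mulVec_eq_self hBx, hx0]; rfl)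
    have hy0 : y ≠ 0 := fun h0 => hBx (sub_eq_zero.mp h0)
    have hone : ∀ {c : ℂ}, c • y = y → c = 1 := fun {c} hc => by
      have : (c - 1) • y = 0 := by rw [sub_smul, hc, one_smul, sub_self]
      exact sub_eq_zero.mp ((smul_eq_zero.mp this).resolve_right hy0)
    have hm' : (cyclicBurau M t ^ ((M + 1 : ℕ) : ℤ)).mulVec y = t ^ (M + 1) • y := by
      rw [zpow_natCast, hym]
    refine ⟨hone ?_, fun h1 => ?_, fun h1 => ?_⟩
    · have e1 := Matrix.zpow_mulVec_of_mulVec_eq_smul (hB.det_zpow _) (pow_ne_zero _ ht) hm' n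
      have e2 := Matrix.zpow_mulVec_eq_self (hB.det_zpow n) hyn ((M + 1 : ℕ) : ℤ)
      rw [← Matrix.zpow_mul _ hB] at e1 e2
      rw [mul_comm n, e1] at e2
      rw [zpow_mul, zpow_natCast, e2]
    -- If t^m = 1, then B fixes y, so B^k x = x + k y, contradicting Bⁿ x = x since n ≠ 0.
    · have hBy : (cyclicBurau M t).mulVec y = (1 : ℂ) • y :=
        Matrix.mulVec_eq_smul_of_isCoprime hB one_ne_zero hmn (by rw [hm', h1, one_zpow])
          (by rw [hyn, one_zpow, one_smul])
      rw [one_smul] at hBy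
      have hk : ∀ k : ℕ, (cyclicBurau M t ^ k).mulVec x = x + (k : ℂ) • y := by
        intro k
        induction k with
        | zero => simp
        | succ k ih =>
          rw [pow_succ', ← Matrix.mulVec_mulVec, ih, Matrix.mulVec_add, Matrix.mulVec_smul, hBy,
            show (cyclicBurau M t).mulVec x = x + y by rw [hy]; abel]
          push_cast
          rw [add_smul, one_smul]; abel
      have hx' := Matrix.zpow_mulVec_eq_self (hB.det_zpow n) h n.sign
      rw [← Matrix.zpow_mul _ hB, mul_comm, Int.sign_mul_self_eq_natAbs, zpow_natCast, hk] at hx'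
      have := add_eq_left.mp hx'
      rw [smul_eq_zero] at this
      rcases this with h0 | h0
      · exact hn (by simpa using h0)
      · exact hy0 h0
    -- If tⁿ = 1, then B y = t y, so t^j y_j does not depend on j and the form takes the value m y_0
    -- on y. It vanishes there, so y = 0.
    · have hBy : (cyclicBurau M t).mulVec y = t • y :=
        Matrix.mulVec_eq_smul_of_isCoprime hB ht hmn (by rw [hm', zpow_natCast])
          (by rw [hyn, h1, one_smul])
      have h2 := ((cyclicBurau_mulVec_eq_iff t _ _).mp hBy).1
      have h3 : ∀ j : Fin (M + 1), t ^ (j : ℕ) * y j = y 0 := by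
        intro j
        induction j using Fin.induction with
        | zero => simp
        | succ j ih =>
          rw [← ih, h2, Pi.smul_apply, smul_eq_mul, Fin.val_succ, Fin.val_castSucc]; ring
      have h4 : ((M + 1 : ℕ) : ℂ) * y 0 = 0 := by
        rw [← hyl, burauForm, dotProduct]
        simp only [powVec, h3]
        simp
      have h5 : y 0 = 0 := (mul_eq_zero.mp h4).resolve_left (Nat.cast_ne_zero.mpr (by omega))
      refine hy0 (funext fun j => ?_)
      have := h3 j
      rw [h5] at this
      exact (mul_eq_zero.mp this).resolve_left (pow_ne_zero _ ht)
  · rintro ⟨h1, h2, h3⟩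
    obtain ⟨u, v, huv⟩ := hmn
    -- The Bézout coefficients provide an m-th root of unity s with sⁿ = tⁿ. Then c = t/s is an n-th
    -- root of unity, and the powers of c⁻¹ form an eigenvector of B for c; its difference from the
    -- constant vector is fixed by Bⁿ and has entry 0 equal to zero.
    set s := t ^ (n * v) with hs
    have hs0 : s ≠ 0 := zpow_ne_zero _ ht
    have hsm : s ^ (M + 1) = 1 := by
      rw [hs, ← zpow_natCast, ← zpow_mul, show n * v * ((M + 1 : ℕ) : ℤ) =
        ((M + 1 : ℕ) : ℤ) * n * v by ring, zpow_mul, h1, one_zpow]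
    have hsn : s ^ n = t ^ n := by
      rw [hs, ← zpow_mul, show n * v * n = n - ((M + 1 : ℕ) : ℤ) * n * u by
        linear_combination n * huv, zpow_sub₀ ht, zpow_mul t (_ * n), h1, one_zpow, div_one]
    have hs1 : s ≠ 1 := fun h => h3 (by rw [← hsn, h, one_zpow])
    set c := t / s with hc
    have hc0 : c ≠ 0 := div_ne_zero ht hs0
    have hcn : c ^ n = 1 := by rw [hc, div_zpow, hsn, div_self (zpow_ne_zero _ ht)]
    have hc1 : c ≠ 1 := fun h => h2 (by rw [(div_eq_one_iff_eq hs0).mp h, hsm])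
    set y : Fin (M + 1) → ℂ := fun j => (c ^ (j : ℕ))⁻¹ with hy
    have hyl : burauForm t y = 0 := by
      have e : ∀ j : Fin (M + 1), powVec M t j * y j = s ^ (j : ℕ) := by
        intro j
        simp only [powVec, hy, hc]
        rw [← div_eq_mul_inv, ← div_pow]
        congr 1
        field_simp
      rw [burauForm, dotProduct, Finset.sum_congr rfl fun j _ => e j,
        Fin.sum_univ_eq_sum_range (fun j => s ^ j)]
      have := geom_sum_mul s (M + 1)
      rw [hsm, sub_self] at this
      exact (mul_eq_zero.mp this).resolve_right (sub_ne_zero.mpr hs1)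
    have hBy : (cyclicBurau M t).mulVec y = c • y := by
      rw [cyclicBurau_mulVec_eq_iff]
      refine ⟨fun j => ?_, ?_⟩
      · simp only [hy, Pi.smul_apply, smul_eq_mul, Fin.val_succ, Fin.val_castSucc, pow_succ]
        field_simp
      · rw [hyl, burauForm, dotProduct_smul, ← burauForm, hyl, smul_zero]
    have hyn := Matrix.zpow_mulVec_of_mulVec_eq_smul hB hc0 hBy n
    rw [hcn, one_smul] at hyn
    refine ⟨y - fun _ => 1, fun h0 => hc1 ?_, by simp [hy], ?_⟩
    · have := congrFun hBy 0
      rw [sub_eq_zero.mp h0, cyclicBurau_mulVec_one] at this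
      simpa using this.symm
    · rw [Matrix.mulVec_sub, hyn, Matrix.zpow_mulVec_eq_self hB (cyclicBurau_mulVec_one M t)]

open MeasureTheory

/-! ### Shifting lines of integration -/

theorem abs_mul_sub_sq_le {c : ℝ} (hc : 0 < c) (B x : ℝ) :
    B * |x| - c * x ^ 2 ≤ B ^ 2 / (2 * c) - c / 2 * x ^ 2 := by
  have h : 0 ≤ c / 2 * (|x| - B / c) ^ 2 := by positivity
  have e : c / 2 * (|x| - B / c) ^ 2 = c / 2 * x ^ 2 - B * |x| + B ^ 2 / (2 * c) := by
    rw [sub_sq, sq_abs]; field_simp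
  linarith

theorem integrable_exp_abs_sub_sq {c : ℝ} (hc : 0 < c) (B : ℝ) :
    Integrable fun x : ℝ => Real.exp (B * |x| - c * x ^ 2) := by
  refine ((integrable_exp_neg_mul_sq (half_pos hc)).const_mul (Real.exp (B ^ 2 / (2 * c)))).mono'
    (by fun_prop) (ae_of_all _ fun x => ?_)
  rw [Real.norm_of_nonneg (Real.exp_nonneg _), ← Real.exp_add]
  exact Real.exp_le_exp.mpr (by linarith [abs_mul_sub_sq_le hc B x])

theorem integrable_abs_pow_mul_exp {c : ℝ} (hc : 0 < c) (B : ℝ) (k : ℕ) :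
    Integrable fun x : ℝ => |x| ^ k * Real.exp (B * |x| - c * x ^ 2) := by
  refine ((integrable_exp_abs_sub_sq hc (B + 1)).const_mul (k.factorial : ℝ)).mono'
    (by fun_prop) (ae_of_all _ fun x => ?_)
  rw [Real.norm_of_nonneg (by positivity)]
  have h1 := Real.pow_div_factorial_le_exp |x| (abs_nonneg x) k
  rw [div_le_iff₀ (by positivity)] at h1
  rw [show (B + 1) * |x| - c * x ^ 2 = |x| + (B * |x| - c * x ^ 2) by ring, Real.exp_add |x|,
    ← mul_assoc, mul_comm (k.factorial : ℝ)]
  exact mul_le_mul_of_nonneg_right h1 (Real.exp_nonneg _)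

/-- Cauchy's theorem for rectangles of half-width T; the Gaussian bound makes the vertical sides
vanish as T tends to infinity. -/
theorem integral_horizontal_eq {f : ℂ → ℂ} {s₁ s₂ B C c : ℝ} (hc : 0 < c)
    (hf : ∀ z : ℂ, z.im ∈ Set.uIcc s₁ s₂ → DifferentiableAt ℂ f z)
    (hb : ∀ z : ℂ, z.im ∈ Set.uIcc s₁ s₂ → ‖f z‖ ≤ C * Real.exp (B * |z.re| - c * z.re ^ 2)) :
    ∫ x : ℝ, f (x + s₁ * Complex.I) = ∫ x : ℝ, f (x + s₂ * Complex.I) := by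
  have hint : ∀ s ∈ Set.uIcc s₁ s₂, Integrable fun x : ℝ => f (x + s * Complex.I) := by
    intro s hs
    have him : ∀ x : ℝ, ((x : ℂ) + s * Complex.I).im = s := fun x => by simp
    have hre : ∀ x : ℝ, ((x : ℂ) + s * Complex.I).re = x := fun x => by simp
    refine ((integrable_exp_abs_sub_sq hc B).const_mul C).mono' ?_ (ae_of_all _ fun x => ?_)
    · refine Continuous.aestronglyMeasurable (continuous_iff_continuousAt.mpr fun x => ?_)
      exact ContinuousAt.comp (g := f) (f := fun x : ℝ => (x : ℂ) + s * Complex.I)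
        (hf _ (by rwa [him])).continuousAt (by fun_prop)
    · simpa [hre] using hb (x + s * Complex.I) (by rwa [him])
  have hrect : ∀ T : ℝ, (∫ x : ℝ in (-T)..T, f (x + s₁ * Complex.I)) -
      ∫ x : ℝ in (-T)..T, f (x + s₂ * Complex.I) =
      Complex.I • (∫ y : ℝ in s₁..s₂, f ((-T : ℝ) + y * Complex.I)) -
        Complex.I • ∫ y : ℝ in s₁..s₂, f (T + y * Complex.I) := by
    intro T
    have := Complex.integral_boundary_rect_eq_zero_of_differentiableOn f
      ((-T : ℝ) + s₁ * Complex.I) (T + s₂ * Complex.I) (fun z hz => ?_)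
    · simp only [Complex.add_re, Complex.ofReal_re, Complex.mul_re, Complex.I_re, mul_zero,
        Complex.ofReal_im, Complex.I_im, mul_one, sub_self, add_zero, Complex.add_im,
        Complex.mul_im, zero_add] at this
      linear_combination this
    · refine (hf z ?_).differentiableWithinAt
      have := hz.2
      simpa using this
  have hvert : ∀ ε : ℝ, |ε| = 1 → Tendsto (fun T : ℝ =>
      ∫ y : ℝ in s₁..s₂, f ((ε * T : ℝ) + y * Complex.I)) atTop (𝓝 0) := by
    intro ε hε
    have hlim : Tendsto (fun T : ℝ =>
        C * Real.exp (B ^ 2 / (2 * c)) * |s₂ - s₁| * Real.exp (-(c / 2 * T ^ 2))) atTop (𝓝 0) := by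
      rw [← mul_zero (C * Real.exp (B ^ 2 / (2 * c)) * |s₂ - s₁|)]
      refine Tendsto.const_mul _ (Real.tendsto_exp_neg_atTop_nhds_zero.comp ?_)
      exact Tendsto.const_mul_atTop (half_pos hc) (tendsto_pow_atTop two_ne_zero)
    refine squeeze_zero_norm (fun T => ?_) hlim
    have hC : 0 ≤ C := by
      have := hb (0 + s₁ * Complex.I) (by simp)
      exact nonneg_of_mul_nonneg_left (le_trans (norm_nonneg _) this) (Real.exp_pos _)
    have := intervalIntegral.norm_integral_le_of_norm_le_const (a := s₁) (b := s₂)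
      (f := fun y : ℝ => f ((ε * T : ℝ) + y * Complex.I))
      (C := C * Real.exp (B ^ 2 / (2 * c)) * Real.exp (-(c / 2 * T ^ 2))) fun y hy => ?_
    · linarith
    · have h1 := hb ((ε * T : ℝ) + y * Complex.I) (by
        simpa using Set.uIoc_subset_uIcc hy)
      refine h1.trans ?_
      rw [mul_assoc, ← Real.exp_add]
      refine mul_le_mul_of_nonneg_left (Real.exp_le_exp.mpr ?_) hC
      have h2 := abs_mul_sub_sq_le hc B (ε * T)
      have h3 : (ε * T) ^ 2 = T ^ 2 := by rw [mul_pow, ← sq_abs ε, hε, one_pow, one_mul]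
      simp only [Complex.add_re, Complex.ofReal_re, Complex.mul_re, Complex.I_re, mul_zero,
        Complex.ofReal_im, Complex.I_im, mul_one, sub_self, add_zero]
      rw [h3] at h2 ⊢
      linarith
  have hT : ∀ s ∈ Set.uIcc s₁ s₂, Tendsto (fun T : ℝ => ∫ x : ℝ in (-T)..T, f (x + s * Complex.I))
      atTop (𝓝 (∫ x : ℝ, f (x + s * Complex.I))) := fun s hs =>
    intervalIntegral_tendsto_integral (hint s hs) tendsto_neg_atTop_atBot tendsto_id
  have h0 := ((hT s₁ Set.left_mem_uIcc).sub (hT s₂ Set.right_mem_uIcc))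
  simp only [hrect] at h0
  have h1 := ((hvert (-1) (by simp)).const_smul Complex.I).sub
    ((hvert 1 (by simp)).const_smul Complex.I)
  simp only [neg_mul, one_mul, smul_zero, sub_zero] at h1
  exact sub_eq_zero.mp (tendsto_nhds_unique h0 h1)

/-- The direction of the lines of integration, `exp(iπσ/4)` with `σ = ±1`. -/
def tilt (σ : ℝ) : ℂ := Complex.exp (Complex.I * π / 4 * σ)

theorem tilt_ne_zero (σ : ℝ) : tilt σ ≠ 0 := Complex.exp_ne_zero _

theorem norm_tilt (σ : ℝ) : ‖tilt σ‖ = 1 := by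
  rw [tilt, show Complex.I * π / 4 * σ = ((π / 4 * σ : ℝ) : ℂ) * Complex.I by push_cast; ring,
    Complex.norm_exp_ofReal_mul_I]

theorem tilt_eq {σ : ℝ} (hσ : σ = 1 ∨ σ = -1) :
    tilt σ = ((√2 / 2 : ℝ) : ℂ) * (1 + Complex.I * σ) := by
  rw [tilt, show Complex.I * π / 4 * σ = ((π / 4 * σ : ℝ) : ℂ) * Complex.I by push_cast; ring,
    Complex.exp_mul_I, ← Complex.ofReal_cos, ← Complex.ofReal_sin]
  rcases hσ with rfl | rfl
  · rw [mul_one, Real.cos_pi_div_four, Real.sin_pi_div_four]; push_cast; ring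
  · rw [mul_neg_one, Real.cos_neg, Real.sin_neg, Real.cos_pi_div_four, Real.sin_pi_div_four]
    push_cast; ring

theorem sqrt_two_div_two_sq : ((√2 / 2 : ℝ) : ℂ) * ((√2 / 2 : ℝ) : ℂ) = 1 / 2 := by
  rw [← Complex.ofReal_mul, div_mul_div_comm, Real.mul_self_sqrt (by norm_num)]; norm_num

theorem tilt_sq {σ : ℝ} (hσ : σ = 1 ∨ σ = -1) : tilt σ ^ 2 = Complex.I * σ := by
  rw [tilt_eq hσ, mul_pow, pow_two, sqrt_two_div_two_sq]
  rcases hσ with rfl | rfl <;> push_cast <;> ring_nf <;> rw [Complex.I_sq] <;> ring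

theorem tilt_mul_eq {σ : ℝ} (hσ : σ = 1 ∨ σ = -1) :
    tilt σ * (((√2 / 2 : ℝ) : ℂ) * (σ + Complex.I)) = Complex.I := by
  have hs : (σ : ℂ) ^ 2 = 1 := by rcases hσ with rfl | rfl <;> norm_num
  rw [tilt_eq hσ]
  linear_combination (1 + Complex.I * σ) * (σ + Complex.I) * sqrt_two_div_two_sq +
    (σ / 2 : ℂ) * Complex.I_sq + (Complex.I / 2) * hs

/-- The point with parameter `r` of the tilted line through `iθ`. -/
def linePt (σ θ r : ℝ) : ℂ := Complex.I * θ + tilt σ * r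

theorem linePt_eq {σ : ℝ} (hσ : σ = 1 ∨ σ = -1) (θ x : ℝ) :
    tilt σ * (x + ((√2 / 2 * θ : ℝ) : ℂ) * Complex.I) = linePt σ θ (x - √2 / 2 * σ * θ) := by
  rw [linePt]
  push_cast
  have := tilt_mul_eq hσ
  push_cast at this
  linear_combination θ * this

theorem linePt_re {σ : ℝ} (hσ : σ = 1 ∨ σ = -1) (θ r : ℝ) : (linePt σ θ r).re = √2 / 2 * r := by
  rw [linePt, tilt_eq hσ]; simp

theorem linePt_im {σ : ℝ} (hσ : σ = 1 ∨ σ = -1) (θ r : ℝ) :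
    (linePt σ θ r).im = θ + √2 / 2 * r * σ := by
  rw [linePt, tilt_eq hσ]; simp; ring

/-- The height at which the tilted line through a point meets the imaginary axis. -/
def height (σ : ℝ) (y : ℂ) : ℝ := y.im - σ * y.re

theorem height_linePt {σ : ℝ} (hσ : σ = 1 ∨ σ = -1) (θ r : ℝ) : height σ (linePt σ θ r) = θ := by
  rw [height, linePt_re hσ, linePt_im hσ]; ring

theorem continuous_height (σ : ℝ) : Continuous (height σ) := by
  unfold height; fun_prop

/-- The integral over a tilted line does not change when the line is moved through a region of
holomorphy. -/
theorem integral_linePt_eq {f : ℂ → ℂ} {σ θ₁ θ₂ B C c : ℝ} (hσ : σ = 1 ∨ σ = -1) (hc : 0 < c)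
    (hf : ∀ y : ℂ, height σ y ∈ Set.uIcc θ₁ θ₂ → DifferentiableAt ℂ f y)
    (hB : 0 ≤ B)
    (hb : ∀ θ ∈ Set.uIcc θ₁ θ₂, ∀ r : ℝ, ‖f (linePt σ θ r)‖ ≤
      C * Real.exp (B * |r| - c * r ^ 2)) :
    ∫ r : ℝ, f (linePt σ θ₁ r) = ∫ r : ℝ, f (linePt σ θ₂ r) := by
  have h2 : 0 < √2 / 2 := by positivity
  have hcoe : ∀ θ : ℝ, ∫ r : ℝ, f (linePt σ θ r) =
      ∫ x : ℝ, f (tilt σ * (x + ((√2 / 2 * θ : ℝ) : ℂ) * Complex.I)) := by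
    intro θ
    simp only [linePt_eq hσ]
    exact (integral_sub_right_eq_self (fun r => f (linePt σ θ r)) (√2 / 2 * σ * θ)).symm
  rw [hcoe, hcoe]
  have hmem : ∀ z : ℂ, z.im ∈ Set.uIcc (√2 / 2 * θ₁) (√2 / 2 * θ₂) →
      ∃ θ ∈ Set.uIcc θ₁ θ₂, tilt σ * z = linePt σ θ (z.re - √2 / 2 * σ * θ) := by
    intro z hz
    refine ⟨z.im / (√2 / 2), ?_, ?_⟩
    · rw [Set.mem_uIcc] at hz ⊢
      simp only [le_div_iff₀ h2, div_le_iff₀ h2]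
      simpa only [mul_comm] using hz
    · rw [← linePt_eq hσ, mul_div_cancel₀ _ h2.ne', Complex.re_add_im]
  set S := max |θ₁| |θ₂| with hS
  -- After rotation, the natural parameter of the line at height θ is displaced by d with |d| ≤ S.
  -- Expanding B|x - d| - c(x - d)² costs the additional rate 2cS and the factor exp(BS).
  refine integral_horizontal_eq (f := fun z => f (tilt σ * z)) (c := c) (B := B + 2 * c * S)
    (C := C * Real.exp (B * S)) hc (fun z hz => ?_) fun z hz => ?_
  · obtain ⟨θ, hθ, he⟩ := hmem z hz
    have h := hf (tilt σ * z) (by rw [he, height_linePt hσ]; exact hθ)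
    exact DifferentiableAt.comp z h (by fun_prop)
  · obtain ⟨θ, hθ, he⟩ := hmem z hz
    have hC : 0 ≤ C := nonneg_of_mul_nonneg_left (le_trans (norm_nonneg _) (hb θ hθ 0))
      (Real.exp_pos _)
    rw [he, mul_assoc C, ← Real.exp_add]
    refine (hb θ hθ _).trans (mul_le_mul_of_nonneg_left (Real.exp_le_exp.mpr ?_) hC)
    have hθS : |θ| ≤ S := by
      rcases Set.mem_uIcc.mp hθ with ⟨h1, h2⟩ | ⟨h1, h2⟩
      · exact (abs_le_max_abs_abs h1 h2)
      · rw [hS, max_comm]; exact (abs_le_max_abs_abs h1 h2)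
    set d := √2 / 2 * σ * θ with hd
    have hσ1 : |σ| = 1 := by rcases hσ with rfl | rfl <;> simp
    have hdS : |d| ≤ S := by
      rw [hd, abs_mul, abs_mul, hσ1, mul_one, abs_of_pos h2]
      have : √2 ≤ 2 := by rw [Real.sqrt_le_left (by norm_num)]; norm_num
      calc √2 / 2 * |θ| ≤ 1 * |θ| := by gcongr; linarith
        _ ≤ S := by linarith
    have h3 : |z.re - d| ≤ |z.re| + S := (abs_sub _ _).trans (by linarith)
    have h4 : z.re * d ≤ |z.re| * S := (le_abs_self _).trans (by
      rw [abs_mul]; exact mul_le_mul_of_nonneg_left hdS (abs_nonneg _))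
    nlinarith [mul_le_mul_of_nonneg_left h3 hB, mul_le_mul_of_nonneg_left h4 hc.le,
      mul_nonneg hc.le (sq_nonneg d)]

/-! ### Gaussian averages -/

/-- The Gaussian `exp(-z²/4b)`. -/
def gauss (b : ℝ) (z : ℂ) : ℂ := Complex.exp (-z ^ 2 / (4 * b))

/-- The average of a function on the line with respect to the Gaussian of variance `2b`. -/
def gavg (b : ℝ) (F : ℝ → ℂ) : ℂ := ((√(4 * π * b) : ℝ) : ℂ)⁻¹ * ∫ r : ℝ, gauss b r * F r

theorem gauss_ofReal (b r : ℝ) : gauss b r = (Real.exp (-(4 * b)⁻¹ * r ^ 2) : ℝ) := by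
  rw [gauss]; push_cast; congr 1; rw [neg_mul, neg_div, div_eq_inv_mul]

theorem norm_gauss_ofReal (b r : ℝ) : ‖gauss b r‖ = Real.exp (-(4 * b)⁻¹ * r ^ 2) := by
  rw [gauss_ofReal, Complex.norm_real, Real.norm_of_nonneg (Real.exp_nonneg _)]

theorem continuous_gauss (b : ℝ) : Continuous (gauss b) := by unfold gauss; fun_prop

theorem differentiable_gauss (b : ℝ) : Differentiable ℂ (gauss b) := by unfold gauss; fun_prop

theorem gauss_neg (b : ℝ) (z : ℂ) : gauss b (-z) = gauss b z := by simp [gauss]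

theorem integrable_gauss_mul {b : ℝ} (hb : 0 < b) {F : ℝ → ℂ} (hF : Continuous F) {M B : ℝ} {k : ℕ}
    (h : ∀ r, ‖F r‖ ≤ M * |r| ^ k * Real.exp (B * |r|)) :
    Integrable fun r : ℝ => gauss b r * F r := by
  refine ((integrable_abs_pow_mul_exp (c := (4 * b)⁻¹) (by positivity) B k).const_mul M).mono'
    (((continuous_gauss b).comp Complex.continuous_ofReal).mul hF).aestronglyMeasurable
    (ae_of_all _ fun r => ?_)
  rw [norm_mul, norm_gauss_ofReal, sub_eq_neg_add, Real.exp_add, ← neg_mul]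
  nlinarith [mul_le_mul_of_nonneg_left (h r) (Real.exp_nonneg (-(4 * b)⁻¹ * r ^ 2))]

theorem integrable_gauss_pow {b : ℝ} (hb : 0 < b) (k : ℕ) :
    Integrable fun r : ℝ => gauss b r * (r : ℂ) ^ k :=
  integrable_gauss_mul hb (by fun_prop) (M := 1) (B := 0) (k := k) fun r => by simp

theorem gavg_const_mul (b : ℝ) (c : ℂ) (F : ℝ → ℂ) :
    gavg b (fun r => c * F r) = c * gavg b F := by
  simp only [gavg, mul_left_comm _ c, integral_const_mul]

theorem gavg_add {b : ℝ} {F G : ℝ → ℂ} (hF : Integrable fun r : ℝ => gauss b r * F r)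
    (hG : Integrable fun r : ℝ => gauss b r * G r) :
    gavg b (fun r => F r + G r) = gavg b F + gavg b G := by
  simp only [gavg, mul_add, integral_add hF hG]

theorem gavg_neg_comp (b : ℝ) (F : ℝ → ℂ) : gavg b (fun r => F (-r)) = gavg b F := by
  rw [gavg, gavg, ← integral_neg_eq_self fun r : ℝ => gauss b r * F r]
  simp [gauss_neg]

theorem gavg_sum {b : ℝ} {ι : Type*} (s : Finset ι) {F : ι → ℝ → ℂ}
    (hF : ∀ i ∈ s, Integrable fun r : ℝ => gauss b r * F i r) :
    gavg b (fun r => ∑ i ∈ s, F i r) = ∑ i ∈ s, gavg b (F i) := by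
  simp only [gavg, Finset.mul_sum, integral_finsetSum s hF]

/-- The substitution r = √b x extracts √b^k. Since the exponential rate becomes B√b ≤ β, the
remaining integral is a constant independent of b. -/
theorem norm_gavg_le {b : ℝ} (hb : 0 < b) {F : ℝ → ℂ} {M B β : ℝ} {k : ℕ} (hM : 0 ≤ M)
    (hB : B * √b ≤ β) (h : ∀ r, ‖F r‖ ≤ M * |r| ^ k * Real.exp (B * |r|)) :
    ‖gavg b F‖ ≤ M * √b ^ k *
      ((√(4 * π))⁻¹ * ∫ x : ℝ, |x| ^ k * Real.exp (β * |x| - 4⁻¹ * x ^ 2)) := by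
  have hs : 0 < √b := Real.sqrt_pos.mpr hb
  have h1 : ‖∫ r : ℝ, gauss b r * F r‖ ≤
      ∫ r : ℝ, M * (|r| ^ k * Real.exp (B * |r| - (4 * b)⁻¹ * r ^ 2)) := by
    refine norm_integral_le_of_norm_le
      ((integrable_abs_pow_mul_exp (by positivity) B k).const_mul M) (ae_of_all _ fun r => ?_)
    rw [norm_mul, norm_gauss_ofReal, sub_eq_neg_add, Real.exp_add, ← neg_mul]
    nlinarith [mul_le_mul_of_nonneg_left (h r) (Real.exp_nonneg (-(4 * b)⁻¹ * r ^ 2))]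
  have h2 : ∫ r : ℝ, M * (|r| ^ k * Real.exp (B * |r| - (4 * b)⁻¹ * r ^ 2)) =
      √b * ∫ x : ℝ, M * (|√b * x| ^ k *
        Real.exp (B * |√b * x| - (4 * b)⁻¹ * (√b * x) ^ 2)) := by
    rw [Measure.integral_comp_mul_left
      (fun r => M * (|r| ^ k * Real.exp (B * |r| - (4 * b)⁻¹ * r ^ 2))) (√b), smul_eq_mul,
      abs_of_pos (inv_pos.mpr hs), mul_inv_cancel_left₀ hs.ne']
  have h3 : ∫ x : ℝ, M * (|√b * x| ^ k * Real.exp (B * |√b * x| - (4 * b)⁻¹ * (√b * x) ^ 2)) ≤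
      ∫ x : ℝ, M * √b ^ k * (|x| ^ k * Real.exp (β * |x| - 4⁻¹ * x ^ 2)) := by
    refine integral_mono_of_nonneg (ae_of_all _ fun x => by positivity)
      ((integrable_abs_pow_mul_exp (by norm_num) β k).const_mul _) (ae_of_all _ fun x => ?_)
    have e : (4 * b)⁻¹ * (√b * x) ^ 2 = 4⁻¹ * x ^ 2 := by
      rw [mul_pow, Real.sq_sqrt hb.le]; field_simp
    simp only [e]
    simp only [abs_mul, abs_of_pos hs, mul_pow _ |x|, mul_assoc]
    gcongr M * (√b ^ k * (|x| ^ k * Real.exp (?_ - _)))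
    rw [← mul_assoc]
    exact mul_le_mul_of_nonneg_right hB (abs_nonneg x)
  rw [integral_const_mul (M * √b ^ k)] at h3
  have e4 : √(4 * π * b) = √(4 * π) * √b := Real.sqrt_mul (by positivity) b
  rw [gavg, norm_mul, norm_inv, Complex.norm_real, Real.norm_of_nonneg (Real.sqrt_nonneg _), e4]
  calc (√(4 * π) * √b)⁻¹ * ‖∫ r : ℝ, gauss b r * F r‖
      ≤ (√(4 * π) * √b)⁻¹ * (√b *
          (M * √b ^ k * ∫ x : ℝ, |x| ^ k * Real.exp (β * |x| - 4⁻¹ * x ^ 2))) := by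
        gcongr
        exact h1.trans (h2.le.trans (mul_le_mul_of_nonneg_left h3 hs.le))
    _ = _ := by rw [mul_inv]; field_simp

/-- Integration by parts, with -2b times the Gaussian as a primitive of r times the Gaussian. -/
theorem gavg_pow_add_two {b : ℝ} (hb : 0 < b) (k : ℕ) :
    gavg b (fun r => (r : ℂ) ^ (k + 2)) = 2 * b * (k + 1) * gavg b fun r => (r : ℂ) ^ k := by
  have hb' : (b : ℂ) ≠ 0 := by exact_mod_cast hb.ne'
  have hu : ∀ r : ℝ, HasDerivAt (fun r : ℝ => (r : ℂ) ^ (k + 1)) ((k + 1) * (r : ℂ) ^ k) r := by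
    intro r
    simpa using (hasDerivAt_pow (k + 1) (r : ℂ)).comp_ofReal
  have hv : ∀ r : ℝ, HasDerivAt (fun r : ℝ => -2 * b * gauss b r) (r * gauss b r) r := by
    intro r
    have h : HasDerivAt (fun z : ℂ => -2 * b * Complex.exp (-z ^ 2 / (4 * b)))
        (-2 * b * (Complex.exp (-(r : ℂ) ^ 2 / (4 * b)) * (-(2 * r) / (4 * b)))) (r : ℂ) := by
      have := ((((hasDerivAt_pow 2 (r : ℂ)).neg).div_const (4 * (b : ℂ))).cexp).const_mul
        (-2 * (b : ℂ))
      simpa using this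
    have h' := h.comp_ofReal
    refine h'.congr_deriv ?_
    rw [gauss]; field_simp; ring
  have key := integral_mul_deriv_eq_deriv_mul_of_integrable (u := fun r : ℝ => (r : ℂ) ^ (k + 1))
    (v := fun r : ℝ => -2 * b * gauss b r) (fun r _ => hu r) (fun r _ => hv r) ?_ ?_ ?_
  · rw [gavg, gavg]
    have e1 : ∀ r : ℝ, gauss b r * (r : ℂ) ^ (k + 2) = (r : ℂ) ^ (k + 1) * (r * gauss b r) :=
      fun r => by ring
    have e2 : ∀ r : ℝ, ((k : ℂ) + 1) * (r : ℂ) ^ k * (-2 * b * gauss b r) =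
      (-2 * b * (k + 1)) * (gauss b r * (r : ℂ) ^ k) := fun r => by ring
    simp only [e1, key, e2]
    rw [integral_const_mul]; ring
  · refine (integrable_gauss_pow hb (k + 2)).congr (ae_of_all _ fun r => ?_)
    simp only [Pi.mul_apply]; ring
  · refine ((integrable_gauss_pow hb k).const_mul (-2 * b * (k + 1))).congr
      (ae_of_all _ fun r => ?_)
    simp only [Pi.mul_apply]; ring
  · refine ((integrable_gauss_pow hb (k + 1)).const_mul (-2 * b)).congr (ae_of_all _ fun r => ?_)
    simp only [Pi.mul_apply]; ring

theorem gavg_cexp {b : ℝ} (hb : 0 < b) (c : ℂ) :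
    gavg b (fun r => Complex.exp (c * r)) = Complex.exp (b * c ^ 2) := by
  have hb' : (b : ℂ) ≠ 0 := by exact_mod_cast hb.ne'
  have h := integral_cexp_quadratic (b := ((-(4 * b)⁻¹ : ℝ) : ℂ))
    (by rw [Complex.ofReal_re]; simpa using hb) c 0
  have e : ∀ r : ℝ, gauss b r * Complex.exp (c * r) =
      Complex.exp (((-(4 * b)⁻¹ : ℝ) : ℂ) * r ^ 2 + c * r + 0) := by
    intro r
    rw [gauss, ← Complex.exp_add]; congr 1; push_cast; field_simp; ring
  rw [gavg]
  simp only [e, h]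
  have e2 : ((π : ℂ) / -((-(4 * b)⁻¹ : ℝ) : ℂ)) ^ (1 / 2 : ℂ) = ((√(4 * π * b) : ℝ) : ℂ) := by
    have : (π : ℂ) / -((-(4 * b)⁻¹ : ℝ) : ℂ) = ((4 * π * b : ℝ) : ℂ) := by
      push_cast; field_simp
    rw [this, Real.sqrt_eq_rpow, Complex.ofReal_cpow (by positivity)]; norm_num
  rw [e2, ← mul_assoc, inv_mul_cancel₀, one_mul]
  · congr 1; push_cast; field_simp; ring
  · exact_mod_cast (Real.sqrt_pos.mpr (by positivity)).ne'

theorem gavg_one {b : ℝ} (hb : 0 < b) : gavg b (fun r => (r : ℂ) ^ 0) = 1 := by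
  simpa using gavg_cexp hb 0

theorem gavg_even {b : ℝ} (hb : 0 < b) (j : ℕ) :
    gavg b (fun r => (r : ℂ) ^ (2 * j)) = b ^ j * (2 * j).factorial / j.factorial := by
  induction j with
  | zero => simpa using gavg_one hb
  | succ j ih =>
    have hj : (j.factorial : ℂ) ≠ 0 := by exact_mod_cast j.factorial_ne_zero
    have hj1 : (j : ℂ) + 1 ≠ 0 := by exact_mod_cast j.succ_ne_zero
    rw [mul_add, mul_one, gavg_pow_add_two hb, ih, Nat.factorial_succ, Nat.factorial_succ,
      Nat.factorial_succ]
    push_cast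
    field_simp
    ring

theorem gavg_odd (b : ℝ) (j : ℕ) : gavg b (fun r => (r : ℂ) ^ (2 * j + 1)) = 0 := by
  have h := gavg_neg_comp b fun r => (r : ℂ) ^ (2 * j + 1)
  have e : ∀ r : ℝ, ((-r : ℝ) : ℂ) ^ (2 * j + 1) = -1 * (r : ℂ) ^ (2 * j + 1) := fun r => by
    push_cast; rw [Odd.neg_pow ⟨j, rfl⟩]; ring
  simp only [e, gavg_const_mul] at h
  have : (2 : ℂ) * gavg b (fun r => (r : ℂ) ^ (2 * j + 1)) = 0 := by linear_combination -h
  simpa using this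

theorem sum_range_two_mul {M : Type*} [AddCommMonoid M] (f : ℕ → M) (n : ℕ) :
    ∑ k ∈ Finset.range (2 * n), f k =
      (∑ j ∈ Finset.range n, f (2 * j)) + ∑ j ∈ Finset.range n, f (2 * j + 1) := by
  induction n with
  | zero => simp
  | succ n ih =>
    rw [mul_add, mul_one, Finset.sum_range_succ, Finset.sum_range_succ, ih,
      Finset.sum_range_succ, Finset.sum_range_succ]
    abel

/-- The Gaussian average of a Taylor polynomial. -/
theorem gavg_taylor {b : ℝ} (hb : 0 < b) (ω : ℂ) (d : ℕ → ℂ) (J : ℕ) :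
    gavg b (fun r => ∑ k ∈ Finset.range (2 * (J + 1)), d k / k.factorial * (ω * r) ^ k) =
      ∑ j ∈ Finset.range (J + 1), (b * ω ^ 2) ^ j / j.factorial * d (2 * j) := by
  have e : ∀ k : ℕ, (fun r : ℝ => d k / k.factorial * (ω * r) ^ k) =
      fun r : ℝ => (d k / k.factorial * ω ^ k) * (r : ℂ) ^ k := fun k => by
    funext r; rw [mul_pow]; ring
  rw [gavg_sum _ fun k _ => ?_, sum_range_two_mul]
  · have h0 : ∀ j : ℕ, gavg b (fun r : ℝ => d (2 * j + 1) / (2 * j + 1).factorial *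
        (ω * r) ^ (2 * j + 1)) = 0 := fun j => by rw [e, gavg_const_mul, gavg_odd, mul_zero]
    simp only [h0, Finset.sum_const_zero, add_zero]
    refine Finset.sum_congr rfl fun j _ => ?_
    have h2 : ((2 * j).factorial : ℂ) ≠ 0 := by exact_mod_cast (2 * j).factorial_ne_zero
    rw [e, gavg_const_mul, gavg_even hb, mul_pow, ← pow_mul]
    field_simp
  · have := (integrable_gauss_pow hb k).const_mul (d k / k.factorial * ω ^ k)
    refine this.congr (ae_of_all _ fun r => ?_)
    simp only [mul_pow]; ring

/-! ### The integral across a pole -/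

/-- Above the real axis 1/z is a half-line integral of exponentials exp(izp). After Fubini the
x-integral is explicit, and half of a Gaussian integral in p remains, so the value depends neither
on b nor on s. By symmetry it is half of the jump across the pole. -/
theorem integral_gauss_div {b s : ℝ} (hb : 0 < b) (hs : 0 < s) :
    ∫ x : ℝ, gauss b (x + s * Complex.I) / (x + s * Complex.I) = -(Complex.I * π) := by
  have hb' : (b : ℂ) ≠ 0 := by exact_mod_cast hb.ne'
  have hinv : ∀ x : ℝ, ((x : ℂ) + s * Complex.I)⁻¹ =
      -Complex.I * ∫ p in Set.Ioi (0 : ℝ), Complex.exp (Complex.I * (x + s * Complex.I) * p) := by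
    intro x
    have hne : (x : ℂ) + s * Complex.I ≠ 0 := fun h => by
      have := congrArg Complex.im h
      simp at this; exact hs.ne' this
    rw [integral_exp_mul_complex_Ioi (by simpa using hs) 0]
    simp; field_simp
  have hintg : Integrable (Function.uncurry fun (x p : ℝ) => gauss b (x + s * Complex.I) *
      Complex.exp (Complex.I * (x + s * Complex.I) * p))
      (volume.prod (volume.restrict (Set.Ioi 0))) := by
    have h1 : Integrable fun x : ℝ => Real.exp (s ^ 2 / (4 * b)) * Real.exp (-(4 * b)⁻¹ * x ^ 2) :=
      (integrable_exp_neg_mul_sq (by positivity)).const_mul _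
    have h2 : Integrable (fun p : ℝ => Real.exp (-s * p)) (volume.restrict (Set.Ioi 0)) :=
      integrableOn_exp_mul_Ioi (by linarith) 0
    refine (h1.mul_prod h2).mono' ?_ (ae_of_all _ fun z => ?_)
    · refine Continuous.aestronglyMeasurable ?_
      unfold gauss Function.uncurry; fun_prop
    · simp only [Function.uncurry, gauss, norm_mul, Complex.norm_exp]
      refine le_of_eq (congrArg₂ (· * ·) ?_ ?_)
      · rw [← Real.exp_add]
        congr 1
        rw [show -((z.1 : ℂ) + s * Complex.I) ^ 2 / (4 * b) =
          ((-(z.1 ^ 2 - s ^ 2) / (4 * b) : ℝ) : ℂ) +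
            ((-(2 * z.1 * s) / (4 * b) : ℝ) : ℂ) * Complex.I by
          push_cast; field_simp; ring_nf; rw [Complex.I_sq]; ring]
        rw [Complex.add_re, Complex.ofReal_re, Complex.re_ofReal_mul, Complex.I_re]
        field_simp; ring
      · simp
  have hswap := integral_integral_swap hintg
  have h3 : ∀ p : ℝ, ∫ x : ℝ, gauss b (x + s * Complex.I) *
      Complex.exp (Complex.I * (x + s * Complex.I) * p) =
      ((√(4 * π * b) : ℝ) : ℂ) * (Real.exp (-b * p ^ 2) : ℝ) := by
    intro p
    have h4 := gavg_cexp hb (-(2 * s * Complex.I) / (4 * b) + Complex.I * p)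
    rw [gavg, inv_mul_eq_iff_eq_mul₀ (by
      exact_mod_cast (Real.sqrt_pos.mpr (by positivity)).ne')] at h4
    have e : ∀ x : ℝ, gauss b (x + s * Complex.I) * Complex.exp (Complex.I * (x + s * Complex.I) * p)
        = Complex.exp (s ^ 2 / (4 * b) - s * p) * (gauss b x *
          Complex.exp ((-(2 * s * Complex.I) / (4 * b) + Complex.I * p) * x)) := by
      intro x
      simp only [gauss, ← Complex.exp_add]
      congr 1; field_simp; ring_nf; rw [Complex.I_sq]; ring
    simp only [e, integral_const_mul, h4]
    rw [mul_left_comm, ← Complex.exp_add]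
    push_cast
    congr 2; field_simp; ring_nf; rw [Complex.I_sq]; ring
  have e5 : ∀ x : ℝ, gauss b (x + s * Complex.I) / (x + s * Complex.I) =
      -Complex.I * ∫ p in Set.Ioi (0 : ℝ), gauss b (x + s * Complex.I) *
        Complex.exp (Complex.I * (x + s * Complex.I) * p) := by
    intro x
    rw [div_eq_mul_inv, hinv, integral_const_mul]; ring
  simp only [e5]
  rw [integral_const_mul, hswap]
  simp only [h3]
  rw [integral_const_mul, integral_complex_ofReal, integral_gaussian_Ioi, ← Complex.ofReal_mul]
  have e6 : √(4 * π * b) * (√(π / b) / 2) = π := by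
    rw [← mul_div_assoc, ← Real.sqrt_mul (by positivity),
      show 4 * π * b * (π / b) = (2 * π) ^ 2 by field_simp; ring, Real.sqrt_sq (by positivity)]
    ring
  rw [e6]; ring

theorem integral_linePt_gauss_div_of_pos {σ b δ : ℝ} (hσ : σ = 1 ∨ σ = -1) (hb : 0 < b)
    (hδ : 0 < δ) :
    ∫ r : ℝ, gauss b (linePt σ δ r / tilt σ) / linePt σ δ r = -(Complex.I * π) / tilt σ := by
  have h := integral_gauss_div (s := √2 / 2 * δ) hb (by positivity)
  rw [← integral_sub_right_eq_self (fun r : ℝ => gauss b (linePt σ δ r / tilt σ) / linePt σ δ r)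
    (√2 / 2 * σ * δ), ← h, ← integral_div]
  refine integral_congr_ae (ae_of_all _ fun x => ?_)
  simp only [← linePt_eq hσ]
  rw [mul_div_cancel_left₀ _ (tilt_ne_zero σ), div_div, mul_comm (tilt σ)]

theorem integral_linePt_gauss_div_of_neg {σ b δ : ℝ} (hσ : σ = 1 ∨ σ = -1) (hb : 0 < b)
    (hδ : δ < 0) :
    ∫ r : ℝ, gauss b (linePt σ δ r / tilt σ) / linePt σ δ r = Complex.I * π / tilt σ := by
  have h := integral_linePt_gauss_div_of_pos hσ hb (neg_pos.mpr hδ)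
  have e : ∀ r : ℝ, linePt σ (-δ) r = -linePt σ δ (-r) := fun r => by
    simp [linePt]; ring
  rw [← integral_neg_eq_self]
  simp only [e, neg_div, div_neg, gauss_neg] at h
  rw [integral_neg] at h
  exact neg_injective h

/-! ### Taylor remainders under a Gaussian average -/

theorem norm_taylor_coeff_le {h : ℂ → ℂ} {y₀ : ℂ} {ρ M : ℝ} (hρ : 0 < ρ)
    (hd : DifferentiableOn ℂ h (Metric.ball y₀ ρ)) (hM : ∀ y ∈ Metric.ball y₀ ρ, ‖h y‖ ≤ M) (k : ℕ) :
    ‖iteratedDeriv k h y₀ / k.factorial‖ ≤ M * (2 / ρ) ^ k := by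
  have hsub : Metric.closedBall y₀ (ρ / 2) ⊆ Metric.ball y₀ ρ :=
    Metric.closedBall_subset_ball (by linarith)
  have h1 := Complex.norm_iteratedDeriv_le_of_forall_mem_sphere_norm_le (f := h) k (half_pos hρ)
    (DifferentiableOn.diffContOnCl (by
      rw [closure_ball _ (half_pos hρ).ne']; exact hd.mono hsub))
    fun y hy => hM y (hsub (Metric.sphere_subset_closedBall hy))
  rw [norm_div, Complex.norm_natCast, div_le_iff₀ (by exact_mod_cast k.factorial_pos)]
  refine h1.trans (le_of_eq ?_)
  rw [div_pow, div_pow]; field_simp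

/-- One bound for all z, as needed under an integral over a whole line. For ‖z‖ < ρ/4 the tail of
the Taylor series is geometric by Cauchy's estimates; for larger z the function and each Taylor term
are separately at most M (4‖z‖/ρ)ⁿ E. Here E is the admitted growth along the line. -/
theorem norm_sub_taylor_le {h : ℂ → ℂ} {y₀ z : ℂ} {ρ M E : ℝ} (hρ : 0 < ρ)
    (hd : DifferentiableOn ℂ h (Metric.ball y₀ ρ)) (hM : ∀ y ∈ Metric.ball y₀ ρ, ‖h y‖ ≤ M)
    (hE : 1 ≤ E) (hz : ‖h (y₀ + z)‖ ≤ M * E) (n : ℕ) :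
    ‖h (y₀ + z) - ∑ k ∈ Finset.range n, iteratedDeriv k h y₀ / k.factorial * z ^ k‖ ≤
      (n + 2) * (4 / ρ) ^ n * M * ‖z‖ ^ n * E := by
  have hM0 : 0 ≤ M := (norm_nonneg _).trans (hM y₀ (Metric.mem_ball_self hρ))
  set x := 4 / ρ * ‖z‖ with hx
  have hx0 : 0 ≤ x := by positivity
  have hcoef : ∀ k, ‖iteratedDeriv k h y₀ / k.factorial * z ^ k‖ ≤ M * (x / 2) ^ k := by
    intro k
    rw [norm_mul, norm_pow, hx, show 4 / ρ * ‖z‖ / 2 = 2 / ρ * ‖z‖ by ring, mul_pow, ← mul_assoc]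
    exact mul_le_mul_of_nonneg_right (norm_taylor_coeff_le hρ hd hM k) (by positivity)
  have hgoal : (n + 2) * (4 / ρ) ^ n * M * ‖z‖ ^ n * E = (n + 2) * (M * x ^ n * E) := by
    rw [hx, mul_pow]; ring
  rw [hgoal]
  have hME : M * x ^ n ≤ M * x ^ n * E := le_mul_of_one_le_right (by positivity) hE
  rcases lt_or_ge x 1 with hlt | hge
  · have hzb : y₀ + z ∈ Metric.ball y₀ ρ := by
      rw [mem_ball_iff_norm, add_sub_cancel_left]
      rw [hx, div_mul_eq_mul_div, div_lt_one hρ] at hlt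
      linarith [norm_nonneg z]
    have hs := Complex.hasSum_taylorSeries_on_ball hd hzb
    simp only [add_sub_cancel_left, smul_eq_mul] at hs
    have hs' : HasSum (fun k : ℕ => iteratedDeriv k h y₀ / k.factorial * z ^ k) (h (y₀ + z)) := by
      refine hs.congr_fun fun k => ?_
      ring
    have htail := (hasSum_nat_add_iff' n).mpr hs'
    rw [← htail.tsum_eq]
    have hgeo : HasSum (fun k : ℕ => M * (x / 2) ^ n * (x / 2) ^ k)
        (M * (x / 2) ^ n * (1 - x / 2)⁻¹) :=
      (hasSum_geometric_of_lt_one (by positivity) (by linarith)).mul_left _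
    refine (tsum_of_norm_bounded hgeo fun k => (hcoef (k + n)).trans (le_of_eq ?_)).trans ?_
    · rw [pow_add]; ring
    · have h20 : 0 ≤ (1 - x / 2)⁻¹ := inv_nonneg.mpr (by linarith)
      have h2 : (1 - x / 2)⁻¹ ≤ 2 := by
        rw [inv_le_comm₀ (by linarith) (by norm_num)]; linarith
      have h3 : (x / 2) ^ n ≤ x ^ n := pow_le_pow_left₀ (by positivity) (by linarith) n
      calc M * (x / 2) ^ n * (1 - x / 2)⁻¹ ≤ M * x ^ n * 2 := by gcongr
        _ ≤ (n + 2) * (M * x ^ n * E) := by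
          nlinarith [mul_nonneg (Nat.cast_nonneg (α := ℝ) n)
            (mul_nonneg (mul_nonneg hM0 (pow_nonneg hx0 n)) (zero_le_one.trans hE))]
  · have h1 : ‖h (y₀ + z)‖ ≤ M * x ^ n * E :=
      hz.trans (mul_le_mul_of_nonneg_right
        (le_mul_of_one_le_right hM0 (one_le_pow₀ hge)) (zero_le_one.trans hE))
    have h2 : ‖∑ k ∈ Finset.range n, iteratedDeriv k h y₀ / k.factorial * z ^ k‖ ≤
        n * (M * x ^ n * E) := by
      refine (norm_sum_le_of_le _ fun k hk => ?_ : _ ≤ ∑ k ∈ Finset.range n, M * x ^ n * E).trans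
        (by simp)
      refine (hcoef k).trans (le_trans ?_ hME)
      refine mul_le_mul_of_nonneg_left ?_ hM0
      exact (pow_le_pow_left₀ (by positivity) (by linarith) k).trans
        (pow_le_pow_right₀ hge (Finset.mem_range.mp hk).le)
    refine (norm_sub_le _ _).trans ?_
    nlinarith [mul_nonneg (mul_nonneg hM0 (pow_nonneg hx0 n)) (zero_le_one.trans hE)]

/-- The moment that bounds the remainders. -/
def gaussMoment (k : ℕ) (β : ℝ) : ℝ :=
  (√(4 * π))⁻¹ * ∫ x : ℝ, |x| ^ k * Real.exp (β * |x| - 4⁻¹ * x ^ 2)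

theorem gaussMoment_nonneg (k : ℕ) (β : ℝ) : 0 ≤ gaussMoment k β :=
  mul_nonneg (by positivity) (integral_nonneg fun x => by positivity)

/-- The Gaussian average of a function is given by its even derivatives at the center. -/
theorem norm_gavg_sub_le {h : ℂ → ℂ} {y₀ ω : ℂ} {ρ M B b β : ℝ} (hb : 0 < b) (hω : ‖ω‖ = 1)
    (hρ : 0 < ρ) (hd : DifferentiableOn ℂ h (Metric.ball y₀ ρ))
    (hM : ∀ y ∈ Metric.ball y₀ ρ, ‖h y‖ ≤ M) (hB : 0 ≤ B) (hβ : B * √b ≤ β)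
    (hc : Continuous fun r : ℝ => h (y₀ + ω * r))
    (hline : ∀ r : ℝ, ‖h (y₀ + ω * r)‖ ≤ M * Real.exp (B * |r|)) (J : ℕ) :
    ‖gavg b (fun r => h (y₀ + ω * r)) - ∑ j ∈ Finset.range (J + 1),
        (b * ω ^ 2) ^ j / j.factorial * iteratedDeriv (2 * j) h y₀‖ ≤
      (2 * J + 4) * (4 / ρ) ^ (2 * J + 2) * M * b ^ (J + 1) * gaussMoment (2 * J + 2) β := by
  have hM0 : 0 ≤ M := (norm_nonneg _).trans (hM y₀ (Metric.mem_ball_self hρ))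
  set P : ℝ → ℂ := fun r => ∑ k ∈ Finset.range (2 * (J + 1)),
    iteratedDeriv k h y₀ / k.factorial * (ω * r) ^ k with hP
  have hnorm : ∀ r : ℝ, ‖ω * r‖ = |r| := fun r => by
    rw [norm_mul, hω, one_mul, Complex.norm_real, Real.norm_eq_abs]
  have hbound : ∀ r : ℝ, ‖h (y₀ + ω * r) - P r‖ ≤
      ((2 * J + 4) * (4 / ρ) ^ (2 * J + 2) * M) * |r| ^ (2 * J + 2) * Real.exp (B * |r|) := by
    intro r
    have := norm_sub_taylor_le hρ hd hM (E := Real.exp (B * |r|))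
      (Real.one_le_exp (by positivity)) (hline r) (2 * (J + 1))
    rw [hnorm] at this
    refine this.trans (le_of_eq ?_)
    push_cast
    rw [mul_add 2 J 1, mul_one]
    ring
  have hPc : Continuous P := by
    rw [hP]; fun_prop
  have hsplit : gavg b (fun r => h (y₀ + ω * r)) =
      gavg b P + gavg b (fun r => h (y₀ + ω * r) - P r) := by
    rw [← gavg_add]
    · simp
    · have : ∀ r : ℝ, gauss b r * P r = gauss b r * h (y₀ + ω * r) -
        gauss b r * (h (y₀ + ω * r) - P r) := fun r => by ring
      simp only [this]
      exact (integrable_gauss_mul hb hc (k := 0) (M := M) (B := B)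
        fun r => by simpa using hline r).sub (integrable_gauss_mul hb (hc.sub hPc) hbound)
    · exact integrable_gauss_mul hb (hc.sub hPc) hbound
  rw [hsplit, hP, gavg_taylor hb ω (fun k => iteratedDeriv k h y₀) J, add_sub_cancel_left]
  refine (norm_gavg_le hb (by positivity) hβ hbound).trans (le_of_eq ?_)
  rw [show 2 * J + 2 = 2 * (J + 1) by ring, pow_mul √b, Real.sq_sqrt hb.le, gaussMoment]

/-! ### The kernel and its expansions around the poles -/

theorem norm_sinh_le (z : ℂ) : ‖Complex.sinh z‖ ≤ Real.exp |z.re| := by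
  rw [Complex.sinh, norm_div, Complex.norm_ofNat, div_le_iff₀ two_pos]
  have h1 : Real.exp z.re ≤ Real.exp |z.re| := Real.exp_le_exp.mpr (le_abs_self _)
  have h2 : Real.exp (-z.re) ≤ Real.exp |z.re| := Real.exp_le_exp.mpr (neg_le_abs _)
  calc ‖Complex.exp z - Complex.exp (-z)‖ ≤ ‖Complex.exp z‖ + ‖Complex.exp (-z)‖ := norm_sub_le _ _
    _ ≤ _ := by rw [Complex.norm_exp, Complex.norm_exp, Complex.neg_re]; linarith

theorem sinh_abs_re_le_norm_sinh (z : ℂ) : Real.sinh |z.re| ≤ ‖Complex.sinh z‖ := by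
  have h := abs_norm_sub_norm_le (Complex.exp z) (Complex.exp (-z))
  rw [Complex.norm_exp, Complex.norm_exp, Complex.neg_re] at h
  rw [Complex.sinh, norm_div, Complex.norm_ofNat, ← Real.abs_sinh, Real.sinh_eq, abs_div, abs_two]
  linarith

theorem sinh_add_int_mul_pi (l : ℤ) (u : ℂ) :
    Complex.sinh (Complex.I * π * l + u) = (-1) ^ l * Complex.sinh u := by
  rw [Complex.sinh, Complex.sinh, Complex.exp_add, neg_add, Complex.exp_add, Complex.exp_neg]
  have h : Complex.exp (Complex.I * π * l) = (-1) ^ l := by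
    rw [← Complex.exp_pi_mul_I, ← Complex.exp_int_mul]; congr 1; ring
  rw [h, ← inv_zpow, inv_neg_one]; ring

theorem exists_eq_of_sinh_eq_zero {z : ℂ} (h : Complex.sinh z = 0) :
    ∃ k : ℤ, z = Complex.I * π * k := by
  have h1 : Complex.sin (z * Complex.I) = 0 := by rw [Complex.sin_mul_I, h, zero_mul]
  obtain ⟨k, hk⟩ := Complex.sin_eq_zero_iff.mp h1
  refine ⟨-k, ?_⟩
  push_cast
  linear_combination (-Complex.I) * hk + z * Complex.I_sq

theorem height_I_mul (σ x : ℝ) : height σ (Complex.I * x) = x := by simp [height]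

theorem eq_zero_of_sinh_eq_zero {σ : ℝ} {z : ℂ} (h : Complex.sinh z = 0) (hz : |height σ z| < π) :
    z = 0 := by
  obtain ⟨k, rfl⟩ := exists_eq_of_sinh_eq_zero h
  rw [show Complex.I * π * k = Complex.I * ((π * k : ℝ) : ℂ) by push_cast; ring, height_I_mul,
    abs_mul, abs_of_pos Real.pi_pos] at hz
  have hk : |(k : ℝ)| < 1 := by
    by_contra! hc
    nlinarith [Real.pi_pos]
  have : k = 0 := by
    have : |k| < 1 := by exact_mod_cast hk
    rwa [Int.abs_lt_one_iff] at this
  simp [this]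

/-- The kernel `sinh(y/m) sinh(y/p) / sinh y` of the contour integral. -/
def kern (m p : ℕ) (y : ℂ) : ℂ := Complex.sinh (y / m) * Complex.sinh (y / p) / Complex.sinh y

/-- The numerator of the kernel around the point `iπl`. -/
def kernNum (m p : ℕ) (l : ℤ) (u : ℂ) : ℂ :=
  Complex.sinh ((Complex.I * π * l + u) / m) * Complex.sinh ((Complex.I * π * l + u) / p)

theorem kern_eq (m p : ℕ) (l : ℤ) (u : ℂ) :
    kern m p (Complex.I * π * l + u) = (-1) ^ l * (kernNum m p l u / Complex.sinh u) := by
  rw [kern, kernNum, sinh_add_int_mul_pi, div_mul_eq_div_div, mul_div_assoc, mul_div_assoc]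
  rcases Int.even_or_odd l with h | h
  · rw [h.neg_one_zpow, div_one]; ring
  · rw [h.neg_one_zpow]; ring

theorem kernNum_zero_zero (m p : ℕ) : kernNum m p 0 0 = 0 := by simp [kernNum]

theorem differentiable_kernNum (m p : ℕ) (l : ℤ) : Differentiable ℂ (kernNum m p l) := by
  unfold kernNum; fun_prop

theorem norm_kernNum_le {m p : ℕ} (hm : 0 < m) (hp : 0 < p) (l : ℤ) (u : ℂ) :
    ‖kernNum m p l u‖ ≤ Real.exp (2 * |u.re|) := by
  have h : ∀ k : ℕ, 0 < k →
      ‖Complex.sinh ((Complex.I * π * l + u) / k)‖ ≤ Real.exp |u.re| := by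
    intro k hk
    refine (norm_sinh_le _).trans (Real.exp_le_exp.mpr ?_)
    have hre : ((Complex.I * π * l + u) / (k : ℂ)).re = u.re / k := by
      rw [← Complex.ofReal_natCast, Complex.div_ofReal_re]
      simp
    rw [hre, abs_div, Nat.abs_cast]
    exact div_le_self (abs_nonneg _) (by exact_mod_cast hk)
  rw [kernNum, norm_mul, two_mul, Real.exp_add]
  exact mul_le_mul (h m hm) (h p hp) (norm_nonneg _) (Real.exp_nonneg _)

/-- The entire function `sinh u / u`. -/
def sinhc (u : ℂ) : ℂ := dslope Complex.sinh 0 u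

theorem mul_sinhc (u : ℂ) : u * sinhc u = Complex.sinh u := by
  simpa [sinhc] using sub_smul_dslope Complex.sinh 0 u

theorem sinhc_zero : sinhc 0 = 1 := by simp [sinhc]

theorem differentiable_sinhc : Differentiable ℂ sinhc := by
  rw [← differentiableOn_univ]
  exact (Complex.differentiableOn_dslope univ_mem).mpr Complex.differentiable_sinh.differentiableOn

theorem sinhc_ne_zero {σ : ℝ} {u : ℂ} (hu : |height σ u| < π) : sinhc u ≠ 0 := by
  intro h
  have h1 : Complex.sinh u = 0 := by rw [← mul_sinhc, h, mul_zero]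
  rw [eq_zero_of_sinh_eq_zero h1 hu, sinhc_zero] at h
  exact one_ne_zero h

/-- The kernel minus its pole at `iπl`, up to a sign. -/
def kernReg (m p : ℕ) (l : ℤ) (u : ℂ) : ℂ := dslope (fun u => kernNum m p l u / sinhc u) 0 u

theorem kernReg_eq (m p : ℕ) (l : ℤ) {u : ℂ} (hu : u ≠ 0) :
    kernReg m p l u = kernNum m p l u / Complex.sinh u - kernNum m p l 0 / u := by
  rw [kernReg, dslope_of_ne _ hu, slope_def_field, sinhc_zero, div_one, sub_zero, sub_div,
    div_div, mul_comm (sinhc u), mul_sinhc]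

theorem isOpen_strip (σ η : ℝ) : IsOpen {u : ℂ | |height σ u| < η} :=
  isOpen_lt (continuous_abs.comp (continuous_height σ)) continuous_const

theorem differentiableOn_kernReg (m p : ℕ) (l : ℤ) (σ : ℝ) :
    DifferentiableOn ℂ (kernReg m p l) {u | |height σ u| < π} := by
  refine (Complex.differentiableOn_dslope ((isOpen_strip σ π).mem_nhds ?_)).mpr fun u hu => ?_
  · simp [height, Real.pi_pos]
  · exact ((differentiable_kernNum m p l u).div (differentiable_sinhc u)
      (sinhc_ne_zero hu)).differentiableWithinAt

theorem differentiableAt_kernReg (m p : ℕ) (l : ℤ) {σ : ℝ} {u : ℂ} (hu : |height σ u| < π) :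
    DifferentiableAt ℂ (kernReg m p l) u :=
  (differentiableOn_kernReg m p l σ).differentiableAt ((isOpen_strip σ π).mem_nhds hu)

/-- A continuous function on a closed tilted strip that grows at most exponentially. -/
theorem exists_norm_le_exp {F : ℂ → ℂ} {σ θ₁ θ₂ C B : ℝ} (hσ : σ = 1 ∨ σ = -1) (hB : 0 ≤ B)
    (hF : ContinuousOn F {u | height σ u ∈ Set.Icc θ₁ θ₂})
    (h : ∀ u, 1 ≤ |u.re| → height σ u ∈ Set.Icc θ₁ θ₂ → ‖F u‖ ≤ C * Real.exp (B * |u.re|)) :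
    ∃ C', 0 ≤ C' ∧ ∀ u, height σ u ∈ Set.Icc θ₁ θ₂ → ‖F u‖ ≤ C' * Real.exp (B * |u.re|) := by
  set S : Set ℂ := {u | height σ u ∈ Set.Icc θ₁ θ₂} ∩ {u | |u.re| ≤ 1}
  have hS : IsCompact S := by
    refine (Metric.isCompact_iff_isClosed_bounded).mpr ⟨?_, ?_⟩
    · exact (isClosed_Icc.preimage (continuous_height σ)).inter
        (isClosed_le (continuous_abs.comp Complex.continuous_re) continuous_const)
    · refine (Metric.isBounded_closedBall (x := (0 : ℂ))
        (r := 1 + (|θ₁| + |θ₂| + 1))).subset fun u hu => ?_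
      rw [mem_closedBall_zero_iff]
      have hre : |u.re| ≤ 1 := hu.2
      have hh := hu.1
      rw [Set.mem_ofPred_eq, height, Set.mem_Icc] at hh
      refine (Complex.norm_le_abs_re_add_abs_im u).trans (add_le_add hre ?_)
      rw [abs_le] at hre ⊢
      have h1 := neg_abs_le θ₁
      have h2 := le_abs_self θ₂
      have h3 := abs_nonneg θ₁
      have h4 := abs_nonneg θ₂
      rcases hσ with rfl | rfl <;> constructor <;> linarith [hh.1, hh.2, hre.1, hre.2]
  obtain ⟨C₀, hC₀⟩ := hS.exists_bound_of_continuousOn (hF.mono Set.inter_subset_left)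
  refine ⟨max |C| |C₀|, by positivity, fun u hu => ?_⟩
  rcases le_total |u.re| 1 with h1 | h1
  · refine (hC₀ u ⟨hu, h1⟩).trans ?_
    have : 1 ≤ Real.exp (B * |u.re|) := Real.one_le_exp (by positivity)
    nlinarith [le_abs_self C₀, le_max_right |C| |C₀|, abs_nonneg C₀]
  · refine (h u h1 hu).trans (mul_le_mul_of_nonneg_right ?_ (Real.exp_nonneg _))
    exact (le_abs_self C).trans (le_max_left _ _)

theorem norm_kernNum_div_sinh_le {m p : ℕ} (hm : 0 < m) (hp : 0 < p) (l : ℤ) {u : ℂ}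
    (hu : 1 ≤ |u.re|) : ‖kernNum m p l u / Complex.sinh u‖ ≤ Real.exp (2 * |u.re|) := by
  have h1 : 1 ≤ ‖Complex.sinh u‖ := by
    refine le_trans ?_ (sinh_abs_re_le_norm_sinh u)
    exact hu.trans (Real.self_le_sinh_iff.mpr (abs_nonneg _))
  rw [norm_div]
  exact (div_le_self (norm_nonneg _) h1).trans (norm_kernNum_le hm hp l u)

/-- Away from the imaginary axis the denominator is at least 1 in modulus and the two factors of the
numerator give the exponential. The rest of the strip is compact, and η < π keeps the neighbouring
poles out. -/
theorem exists_norm_kernReg_le {m p : ℕ} (hm : 0 < m) (hp : 0 < p) (l : ℤ) {σ η : ℝ}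
    (hσ : σ = 1 ∨ σ = -1) (hη : η < π) :
    ∃ C, 0 ≤ C ∧ ∀ u, |height σ u| ≤ η → ‖kernReg m p l u‖ ≤ C * Real.exp (2 * |u.re|) := by
  have hd : ∀ u : ℂ, height σ u ∈ Set.Icc (-η) η → |height σ u| < π := fun u hu =>
    (abs_le.mpr hu).trans_lt hη
  have hfar : ∀ u : ℂ, 1 ≤ |u.re| → height σ u ∈ Set.Icc (-η) η →
      ‖kernReg m p l u‖ ≤ (1 + ‖kernNum m p l 0‖) * Real.exp (2 * |u.re|) := by
    intro u hu _
    have hu1 : 1 ≤ ‖u‖ := hu.trans (Complex.abs_re_le_norm u)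
    have hu0 : u ≠ 0 := fun h => by rw [h, norm_zero] at hu1; linarith
    rw [kernReg_eq _ _ _ hu0]
    have h2 : ‖kernNum m p l 0 / u‖ ≤ ‖kernNum m p l 0‖ := by
      rw [norm_div]; exact div_le_self (norm_nonneg _) hu1
    have h3 : 1 ≤ Real.exp (2 * |u.re|) := Real.one_le_exp (by positivity)
    refine (norm_sub_le _ _).trans ?_
    nlinarith [norm_kernNum_div_sinh_le hm hp l hu, norm_nonneg (kernNum m p l 0)]
  obtain ⟨C, hC, h⟩ := exists_norm_le_exp hσ zero_le_two
    (fun u hu => (differentiableAt_kernReg m p l (hd u hu)).continuousAt.continuousWithinAt) hfar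
  exact ⟨C, hC, fun u hu => h u (abs_le.mp hu)⟩

/-- The entire function `(1 - exp(-z))/z`. -/
def expc (z : ℂ) : ℂ := -dslope (fun z => Complex.exp (-z)) 0 z

theorem mul_expc (z : ℂ) : z * expc z = 1 - Complex.exp (-z) := by
  have h := sub_smul_dslope (fun z => Complex.exp (-z)) 0 z
  simp only [sub_zero, smul_eq_mul, neg_zero, Complex.exp_zero] at h
  rw [expc]; linear_combination -h

theorem differentiable_expc : Differentiable ℂ expc := by
  refine Differentiable.neg ?_
  rw [← differentiableOn_univ]
  exact (Complex.differentiableOn_dslope univ_mem).mpr (by fun_prop)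

theorem norm_expc_le (z : ℂ) : ‖expc z‖ ≤ Real.exp ‖z‖ := by
  rcases eq_or_ne z 0 with rfl | hz
  · have : deriv (fun z : ℂ => Complex.exp (-z)) 0 = -1 := by
      have := ((hasDerivAt_id (0 : ℂ)).neg).cexp
      simpa using this.deriv
    simp [expc, this]
  · have h := Complex.norm_exp_sub_sum_le_norm_mul_exp (-z) 1
    simp only [Finset.range_one, Finset.sum_singleton, pow_zero, Nat.factorial_zero, Nat.cast_one,
      div_one, norm_neg, pow_one] at h
    rw [norm_sub_rev, ← mul_expc, norm_mul] at h
    exact le_of_mul_le_mul_left h (norm_pos_iff.mpr hz)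

/-- The kernel around `iπl`, up to a sign, minus the multiple `exp(-νu)/u` of its polar part. -/
def kernFull (m p : ℕ) (l : ℤ) (ν : ℝ) (u : ℂ) : ℂ :=
  kernReg m p l u + kernNum m p l 0 * (ν * expc (ν * u))

theorem kernNum_div_sinh_eq (m p : ℕ) (l : ℤ) (ν : ℝ) {u : ℂ} (hu : u ≠ 0) :
    kernNum m p l u / Complex.sinh u =
      kernFull m p l ν u + kernNum m p l 0 * (Complex.exp (-(ν * u)) / u) := by
  have h : ν * expc (ν * u) = (1 - Complex.exp (-(ν * u))) / u := by
    rw [eq_div_iff hu, ← mul_expc]; ring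
  rw [kernFull, kernReg_eq _ _ _ hu, h]; ring

theorem differentiableAt_kernFull (m p : ℕ) (l : ℤ) (ν : ℝ) {σ : ℝ} {u : ℂ}
    (hu : |height σ u| < π) : DifferentiableAt ℂ (kernFull m p l ν) u := by
  have h1 := differentiableAt_kernReg m p l hu
  have h2 : DifferentiableAt ℂ (fun u : ℂ => expc (ν * u)) u :=
    (differentiable_expc _).comp u (by fun_prop)
  unfold kernFull
  fun_prop

/-! ### Contour integrals of the kernel -/

/-- The integral of a function over the tilted line through `iδ`, with the Gaussian centered
at `iδ₀`. -/
def lineAvg (b σ δ₀ : ℝ) (F : ℂ → ℂ) (δ : ℝ) : ℂ :=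
  ((√(4 * π * b) : ℝ) : ℂ)⁻¹ *
    ∫ r : ℝ, gauss b ((linePt σ δ r - Complex.I * δ₀) / tilt σ) * F (linePt σ δ r)

theorem lineAvg_self (b σ δ₀ : ℝ) (F : ℂ → ℂ) :
    lineAvg b σ δ₀ F δ₀ = gavg b fun r => F (Complex.I * δ₀ + tilt σ * r) := by
  simp only [lineAvg, gavg, linePt, add_sub_cancel_left, mul_div_cancel_left₀ _ (tilt_ne_zero σ)]

theorem lineAvg_congr {b σ δ₀ δ : ℝ} {F G : ℂ → ℂ}
    (h : ∀ r : ℝ, F (linePt σ δ r) = G (linePt σ δ r)) :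
    lineAvg b σ δ₀ F δ = lineAvg b σ δ₀ G δ := by
  simp only [lineAvg, h]

theorem lineAvg_const_mul (b σ δ₀ δ : ℝ) (c : ℂ) (F : ℂ → ℂ) :
    lineAvg b σ δ₀ (fun u => c * F u) δ = c * lineAvg b σ δ₀ F δ := by
  simp only [lineAvg, mul_left_comm _ c, integral_const_mul]

theorem lineAvg_translate (b σ θ₀ θ c : ℝ) (F : ℂ → ℂ) :
    lineAvg b σ θ₀ F θ =
      lineAvg b σ (θ₀ - c) (fun u => F (Complex.I * c + u)) (θ - c) := by
  have h : ∀ r : ℝ, Complex.I * c + linePt σ (θ - c) r = linePt σ θ r := fun r => by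
    simp only [linePt]; push_cast; ring
  have h' : ∀ r : ℝ, linePt σ (θ - c) r - Complex.I * ((θ₀ - c : ℝ) : ℂ) =
      linePt σ θ r - Complex.I * θ₀ := fun r => by
    simp only [linePt]; push_cast; ring
  simp only [lineAvg, h, h']

theorem norm_gauss_linePt_le {b σ δ₀ δ S : ℝ} (hσ : σ = 1 ∨ σ = -1) (hb : 0 < b)
    (hS : |δ - δ₀| ≤ S) (r : ℝ) :
    ‖gauss b ((linePt σ δ r - Complex.I * δ₀) / tilt σ)‖ ≤
      Real.exp (S / (2 * b) * |r| - (4 * b)⁻¹ * r ^ 2) := by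
  set s := √2 / 2 * (δ - δ₀) with hs
  have e : (linePt σ δ r - Complex.I * δ₀) / tilt σ = (r + s * σ : ℝ) + (s : ℝ) * Complex.I := by
    rw [div_eq_iff (tilt_ne_zero σ), linePt, hs]
    have := tilt_mul_eq hσ
    push_cast at this ⊢
    linear_combination (-(δ - δ₀) : ℂ) * this
  have hσ2 : σ ^ 2 = 1 := by rcases hσ with rfl | rfl <;> norm_num
  rw [e, gauss, Complex.norm_exp]
  refine Real.exp_le_exp.mpr ?_
  have hre : (-(((r + s * σ : ℝ) : ℂ) + (s : ℝ) * Complex.I) ^ 2 / (4 * b)).re =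
      -((r + s * σ) ^ 2 - s ^ 2) / (4 * b) := by
    rw [show -(((r + s * σ : ℝ) : ℂ) + (s : ℝ) * Complex.I) ^ 2 / (4 * b) =
      ((-((r + s * σ) ^ 2 - s ^ 2) / (4 * b) : ℝ) : ℂ) +
        ((-(2 * (r + s * σ) * s) / (4 * b) : ℝ) : ℂ) * Complex.I by
      have hb' : (b : ℂ) ≠ 0 := by exact_mod_cast hb.ne'
      push_cast; field_simp; ring_nf; rw [Complex.I_sq]; ring]
    rw [Complex.add_re, Complex.ofReal_re, Complex.re_ofReal_mul, Complex.I_re, mul_zero, add_zero]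
  rw [hre]
  have h1 : -(r * (s * σ)) ≤ |r| * S := by
    refine (neg_le_abs _).trans ?_
    rw [abs_mul]
    refine mul_le_mul_of_nonneg_left ?_ (abs_nonneg r)
    have hσ1 : |σ| = 1 := by rcases hσ with rfl | rfl <;> simp
    rw [hs, abs_mul, hσ1, mul_one, abs_mul, abs_of_pos (by positivity)]
    have : √2 ≤ 2 := by rw [Real.sqrt_le_left (by norm_num)]; norm_num
    nlinarith [abs_nonneg (δ - δ₀)]
  have e2 : -((r + s * σ) ^ 2 - s ^ 2) / (4 * b) =
      (-(r * (s * σ))) / (2 * b) - (4 * b)⁻¹ * r ^ 2 := by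
    have : (r + s * σ) ^ 2 - s ^ 2 = r ^ 2 + 2 * r * (s * σ) := by
      linear_combination s ^ 2 * hσ2
    rw [this]; field_simp; ring
  rw [e2, div_mul_eq_mul_div, mul_comm S]
  gcongr

theorem abs_re_linePt_le {σ : ℝ} (hσ : σ = 1 ∨ σ = -1) (δ r : ℝ) : |(linePt σ δ r).re| ≤ |r| := by
  rw [linePt_re hσ, abs_mul, abs_of_pos (by positivity)]
  have : √2 ≤ 2 := by rw [Real.sqrt_le_left (by norm_num)]; norm_num
  nlinarith [abs_nonneg r]

theorem norm_gauss_mul_linePt_le {b σ δ₀ δ S C B : ℝ} {F : ℂ → ℂ} (hσ : σ = 1 ∨ σ = -1)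
    (hb : 0 < b) (hS : |δ - δ₀| ≤ S) (hC : 0 ≤ C) (hB : 0 ≤ B) (r : ℝ)
    (hF : ‖F (linePt σ δ r)‖ ≤ C * Real.exp (B * |(linePt σ δ r).re|)) :
    ‖gauss b ((linePt σ δ r - Complex.I * δ₀) / tilt σ) * F (linePt σ δ r)‖ ≤
      C * Real.exp ((S / (2 * b) + B) * |r| - (4 * b)⁻¹ * r ^ 2) := by
  rw [norm_mul, show (S / (2 * b) + B) * |r| - (4 * b)⁻¹ * r ^ 2 =
    (S / (2 * b) * |r| - (4 * b)⁻¹ * r ^ 2) + B * |r| by ring, Real.exp_add, mul_left_comm]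
  refine mul_le_mul (norm_gauss_linePt_le hσ hb hS r) (hF.trans ?_) (norm_nonneg _)
    (Real.exp_nonneg _)
  have := abs_re_linePt_le hσ δ r
  gcongr

theorem continuous_linePt (σ δ : ℝ) : Continuous (linePt σ δ) := by
  unfold linePt; fun_prop

theorem continuous_gauss_linePt (b σ δ₀ δ : ℝ) :
    Continuous fun r : ℝ => gauss b ((linePt σ δ r - Complex.I * δ₀) / tilt σ) := by
  unfold gauss linePt; fun_prop

theorem integrable_gauss_mul_linePt {b σ δ₀ δ C B : ℝ} {F : ℂ → ℂ} (hσ : σ = 1 ∨ σ = -1)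
    (hb : 0 < b) (hC : 0 ≤ C) (hB : 0 ≤ B) (hc : Continuous fun r => F (linePt σ δ r))
    (hF : ∀ r, ‖F (linePt σ δ r)‖ ≤ C * Real.exp (B * |(linePt σ δ r).re|)) :
    Integrable fun r : ℝ =>
      gauss b ((linePt σ δ r - Complex.I * δ₀) / tilt σ) * F (linePt σ δ r) :=
  ((integrable_exp_abs_sub_sq (by positivity) _).const_mul C).mono'
    ((continuous_gauss_linePt b σ δ₀ δ).mul hc).aestronglyMeasurable
    (ae_of_all _ fun r => norm_gauss_mul_linePt_le hσ hb le_rfl hC hB r (hF r))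

theorem lineAvg_add {b σ δ₀ δ : ℝ} {F G : ℂ → ℂ}
    (hF : Integrable fun r : ℝ =>
      gauss b ((linePt σ δ r - Complex.I * δ₀) / tilt σ) * F (linePt σ δ r))
    (hG : Integrable fun r : ℝ =>
      gauss b ((linePt σ δ r - Complex.I * δ₀) / tilt σ) * G (linePt σ δ r)) :
    lineAvg b σ δ₀ (fun u => F u + G u) δ = lineAvg b σ δ₀ F δ + lineAvg b σ δ₀ G δ := by
  simp only [lineAvg, mul_add, integral_add hF hG]

theorem lineAvg_eq_lineAvg {b σ δ₀ δ₁ δ₂ C B : ℝ} {F : ℂ → ℂ} (hσ : σ = 1 ∨ σ = -1)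
    (hb : 0 < b) (hC : 0 ≤ C) (hB : 0 ≤ B)
    (hd : ∀ u, height σ u ∈ Set.uIcc δ₁ δ₂ → DifferentiableAt ℂ F u)
    (hF : ∀ u, height σ u ∈ Set.uIcc δ₁ δ₂ → ‖F u‖ ≤ C * Real.exp (B * |u.re|)) :
    lineAvg b σ δ₀ F δ₁ = lineAvg b σ δ₀ F δ₂ := by
  rw [lineAvg, lineAvg]
  congr 1
  set S := max |δ₁ - δ₀| |δ₂ - δ₀|
  refine integral_linePt_eq
    (f := fun u => gauss b ((u - Complex.I * δ₀) / tilt σ) * F u) (B := S / (2 * b) + B) (C := C)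
    (c := (4 * b)⁻¹) hσ (by positivity) (fun u hu => ?_) (by positivity) fun δ hδ r => ?_
  · have h1 : DifferentiableAt ℂ (fun u => gauss b ((u - Complex.I * δ₀) / tilt σ)) u :=
      (differentiable_gauss b _).comp u (by fun_prop)
    exact h1.mul (hd u hu)
  · refine norm_gauss_mul_linePt_le hσ hb ?_ hC hB r (hF _ (by rwa [height_linePt hσ]))
    rcases Set.mem_uIcc.mp hδ with ⟨h1, h2⟩ | ⟨h1, h2⟩
    · exact abs_le_max_abs_abs (by linarith) (by linarith)
    · rw [show S = max |δ₂ - δ₀| |δ₁ - δ₀| from max_comm _ _]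
      exact abs_le_max_abs_abs (by linarith) (by linarith)

theorem exists_norm_kernFull_le {m p : ℕ} (hm : 0 < m) (hp : 0 < p) (l : ℤ) (ν : ℝ) {σ η : ℝ}
    (hσ : σ = 1 ∨ σ = -1) (hη : η < π) :
    ∃ C, 0 ≤ C ∧ ∀ u, |height σ u| ≤ η →
      ‖kernFull m p l ν u‖ ≤ C * Real.exp ((2 + 2 * |ν|) * |u.re|) := by
  obtain ⟨C, hC, h⟩ := exists_norm_kernReg_le hm hp l hσ hη
  refine ⟨C + ‖kernNum m p l 0‖ * (|ν| * Real.exp (|ν| * η)), by positivity, fun u hu => ?_⟩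
  have h1 : ‖kernReg m p l u‖ ≤ C * Real.exp ((2 + 2 * |ν|) * |u.re|) := by
    refine (h u hu).trans ?_
    gcongr
    nlinarith [abs_nonneg ν]
  have hn : ‖(ν : ℂ) * u‖ ≤ |ν| * η + (2 + 2 * |ν|) * |u.re| := by
    rw [norm_mul, Complex.norm_real, Real.norm_eq_abs]
    have him : |u.im| ≤ η + |u.re| := by
      have h2 : u.im = height σ u + σ * u.re := by rw [height]; ring
      have h3 : |σ * u.re| = |u.re| := by
        rw [abs_mul]; rcases hσ with rfl | rfl <;> simp
      rw [h2]
      exact (abs_add_le _ _).trans (by rw [h3]; linarith)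
    have := Complex.norm_le_abs_re_add_abs_im u
    nlinarith [abs_nonneg ν, abs_nonneg u.re]
  have h2 : ‖expc (ν * u)‖ ≤ Real.exp (|ν| * η) * Real.exp ((2 + 2 * |ν|) * |u.re|) := by
    rw [← Real.exp_add]
    exact (norm_expc_le _).trans (Real.exp_le_exp.mpr hn)
  rw [kernFull]
  refine (norm_add_le _ _).trans ?_
  rw [norm_mul, norm_mul, Complex.norm_real, Real.norm_eq_abs, add_mul]
  refine add_le_add h1 ?_
  rw [mul_assoc, mul_assoc]
  gcongr

theorem lineAvg_kernFull_eq {m p : ℕ} (hm : 0 < m) (hp : 0 < p) (l : ℤ) (ν : ℝ) {b σ δ₀ δ₁ δ₂ : ℝ}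
    (hσ : σ = 1 ∨ σ = -1) (hb : 0 < b) (h₁ : |δ₁| < π) (h₂ : |δ₂| < π) :
    lineAvg b σ δ₀ (kernFull m p l ν) δ₁ = lineAvg b σ δ₀ (kernFull m p l ν) δ₂ := by
  have hmax : ∀ u, height σ u ∈ Set.uIcc δ₁ δ₂ → |height σ u| ≤ max |δ₁| |δ₂| := by
    intro u hu
    rcases Set.mem_uIcc.mp hu with ⟨h1, h2⟩ | ⟨h1, h2⟩
    · exact abs_le_max_abs_abs h1 h2
    · rw [max_comm]; exact abs_le_max_abs_abs h1 h2
  obtain ⟨C, hC, h⟩ := exists_norm_kernFull_le hm hp l ν hσ (max_lt h₁ h₂)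
  exact lineAvg_eq_lineAvg hσ hb hC (by positivity)
    (fun u hu => differentiableAt_kernFull m p l ν ((hmax u hu).trans_lt (max_lt h₁ h₂)))
    fun u hu => h u (hmax u hu)

/-- Half of the jump of the contour integral at a pole with the residue `1`, where `δ₀` is the
height of the center of the Gaussian above the pole. -/
def halfJump (b σ δ₀ : ℝ) : ℂ :=
  ((√(4 * π * b) : ℝ) : ℂ)⁻¹ * (Complex.exp (δ₀ ^ 2 / (4 * b * tilt σ ^ 2)) *
    (Complex.I * π / tilt σ))

/-- The exponent ν = σδ₀/(2b) is the one for which completing the square moves the centre of the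
Gaussian from iδ₀ to the pole u = 0. The integral of the polar part exp(-νu)/u is then exact for
every distance δ₀. -/
theorem gauss_mul_exp {b σ : ℝ} (hσ : σ = 1 ∨ σ = -1) (hb : 0 < b) (δ₀ : ℝ) (u : ℂ) :
    gauss b ((u - Complex.I * δ₀) / tilt σ) *
      Complex.exp (-(((σ * δ₀ / (2 * b) : ℝ) : ℂ) * u)) =
      Complex.exp (δ₀ ^ 2 / (4 * b * tilt σ ^ 2)) * gauss b (u / tilt σ) := by
  have hb' : (b : ℂ) ≠ 0 := by exact_mod_cast hb.ne'
  rw [gauss, gauss, ← Complex.exp_add, ← Complex.exp_add, div_pow, div_pow, tilt_sq hσ]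
  congr 1
  rcases hσ with rfl | rfl
  · push_cast; field_simp; ring_nf; simp only [Complex.I_sq]; ring
  · push_cast; field_simp; ring_nf; simp only [Complex.I_sq]; ring

theorem linePt_ne_zero {σ δ : ℝ} (hσ : σ = 1 ∨ σ = -1) (hδ : δ ≠ 0) (r : ℝ) :
    linePt σ δ r ≠ 0 := fun h => by
  have := height_linePt hσ δ r
  rw [h, height] at this
  simp at this
  exact hδ this.symm

/-- The kernel is split into `kernFull`, holomorphic in the strip, and the polar part, whose
integral is known and changes sign with the side of the pole on which the line runs. -/
theorem lineAvg_kernNum_div_sinh {m p : ℕ} (hm : 0 < m) (hp : 0 < p) (l : ℤ) {b σ δ : ℝ}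
    (hσ : σ = 1 ∨ σ = -1) (hb : 0 < b) (δ₀ : ℝ) (hδ : |δ| < π) (hδ0 : δ ≠ 0) :
    lineAvg b σ δ₀ (fun u => kernNum m p l u / Complex.sinh u) δ =
      lineAvg b σ δ₀ (kernFull m p l (σ * δ₀ / (2 * b))) δ - SignType.sign δ *
        (kernNum m p l 0 * halfJump b σ δ₀) := by
  set ν := σ * δ₀ / (2 * b) with hν
  have hne := linePt_ne_zero hσ hδ0
  rw [lineAvg_congr (G := fun u => kernFull m p l ν u +
    kernNum m p l 0 * (Complex.exp (-(ν * u)) / u)) fun r =>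
      kernNum_div_sinh_eq m p l ν (hne r)]
  have hpole : lineAvg b σ δ₀ (fun u => Complex.exp (-(ν * u)) / u) δ =
      -(SignType.sign δ * halfJump b σ δ₀) := by
    have e : ∀ r : ℝ, gauss b ((linePt σ δ r - Complex.I * δ₀) / tilt σ) *
        (Complex.exp (-(ν * linePt σ δ r)) / linePt σ δ r) =
        Complex.exp (δ₀ ^ 2 / (4 * b * tilt σ ^ 2)) *
          (gauss b (linePt σ δ r / tilt σ) / linePt σ δ r) := fun r => by
      rw [← mul_div_assoc, hν, gauss_mul_exp hσ hb, mul_div_assoc]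
    simp only [lineAvg, e]
    rw [integral_const_mul, halfJump]
    rcases lt_or_gt_of_ne hδ0 with h | h
    · rw [integral_linePt_gauss_div_of_neg hσ hb h, sign_neg h]; simp
    · rw [integral_linePt_gauss_div_of_pos hσ hb h, sign_pos h]; simp [neg_div]
  rw [lineAvg_add, lineAvg_const_mul, hpole]
  · ring
  · obtain ⟨C, hC, h⟩ := exists_norm_kernFull_le hm hp l ν hσ hδ
    refine integrable_gauss_mul_linePt hσ hb hC (by positivity) ?_ fun r =>
      h _ (by rw [height_linePt hσ])
    refine continuous_iff_continuousAt.mpr fun r => ?_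
    have h : ContinuousAt (kernFull m p l ν) (linePt σ δ r) :=
      (differentiableAt_kernFull m p l ν (σ := σ) (by rwa [height_linePt hσ])).continuousAt
    exact h.comp (continuous_linePt σ δ).continuousAt
  · refine integrable_gauss_mul_linePt
      (F := fun u => kernNum m p l 0 * (Complex.exp (-(ν * u)) / u))
      (C := ‖kernNum m p l 0‖ * (2 / |δ|)) (B := |ν|) hσ hb (by positivity) (abs_nonneg ν) ?_ fun r => ?_
    · have := continuous_linePt σ δ
      fun_prop (disch := exact hne)
    · have h1 : |δ| ≤ 2 * ‖linePt σ δ r‖ := by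
        conv_lhs => rw [← height_linePt hσ δ r, height]
        have h2 := Complex.abs_re_le_norm (linePt σ δ r)
        have h3 := Complex.abs_im_le_norm (linePt σ δ r)
        refine (abs_sub _ _).trans ?_
        rw [abs_mul]
        rcases hσ with rfl | rfl <;> norm_num <;> linarith
      have hpos := norm_pos_iff.mpr (hne r)
      have h2 : ‖Complex.exp (-(ν * linePt σ δ r))‖ ≤ Real.exp (|ν| * |(linePt σ δ r).re|) := by
        rw [Complex.norm_exp, ← abs_mul]
        refine Real.exp_le_exp.mpr ?_
        rw [Complex.neg_re, Complex.re_ofReal_mul]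
        exact neg_le_abs _
      rw [norm_mul, norm_div, mul_assoc]
      gcongr
      rw [div_le_iff₀ hpos, div_mul_eq_mul_div, div_mul_eq_mul_div, le_div_iff₀ (abs_pos.mpr hδ0)]
      nlinarith [Real.exp_pos (|ν| * |(linePt σ δ r).re|), abs_nonneg δ]

/-- The integral of the kernel over the tilted line through `iθ`. -/
theorem lineAvg_kern {m p : ℕ} (hm : 0 < m) (hp : 0 < p) (l : ℤ) {b σ δ : ℝ}
    (hσ : σ = 1 ∨ σ = -1) (hb : 0 < b) (θ₀ : ℝ) (hδ : |δ| < π) (hδ0 : δ ≠ 0) :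
    lineAvg b σ θ₀ (kern m p) (π * l + δ) = (-1) ^ l *
      (lineAvg b σ (θ₀ - π * l) (kernFull m p l (σ * (θ₀ - π * l) / (2 * b))) 0 -
        SignType.sign δ * (kernNum m p l 0 * halfJump b σ (θ₀ - π * l))) := by
  rw [lineAvg_translate b σ θ₀ _ (π * l), add_sub_cancel_left, lineAvg_congr
    (G := fun u => (-1) ^ l * (kernNum m p l u / Complex.sinh u)) fun r => ?_,
    lineAvg_const_mul, lineAvg_kernNum_div_sinh hm hp l hσ hb _ hδ hδ0,
    lineAvg_kernFull_eq hm hp l _ hσ hb hδ (δ₂ := 0) (by simpa using Real.pi_pos)]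
  rw [← kern_eq]; push_cast; ring_nf

/-- For l = 0 the numerator has a double zero, so there is no pole and ν plays no part. At u = 0 the
convention 0/0 = 0 happens to give the value of the continuous extension. -/
theorem kern_eq_kernFull {m p : ℕ} {ν σ : ℝ} {u : ℂ} (hu : |height σ u| < π) :
    kern m p u = kernFull m p 0 ν u := by
  have h := kern_eq m p 0 u
  simp only [Int.cast_zero, mul_zero, zero_add, zpow_zero, one_mul] at h
  rcases eq_or_ne u 0 with rfl | hu0
  · have hd : kernReg m p 0 0 = 0 := by
      have hk : HasDerivAt (fun u => kernNum m p 0 u / sinhc u) 0 0 := by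
        have h1 : HasDerivAt (kernNum m p 0) 0 0 := by
          have hs : ∀ k : ℕ, HasDerivAt (fun u : ℂ => Complex.sinh ((Complex.I * π * (0 : ℤ) + u) / k))
              (1 / k) 0 := fun k => by
            have := (((hasDerivAt_id (0 : ℂ)).const_add (Complex.I * π * (0 : ℤ))).div_const
              (k : ℂ)).csinh
            simpa using this
          have := (hs m).fun_mul (hs p)
          refine this.congr_deriv ?_
          simp
        have := h1.fun_div (differentiable_sinhc 0).hasDerivAt (by rw [sinhc_zero]; exact one_ne_zero)
        simpa [kernNum_zero_zero, sinhc_zero] using this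
      rw [kernReg, dslope_same, hk.deriv]
    simp [kernFull, hd, kernNum_zero_zero, kern]
  · rw [h, kernNum_div_sinh_eq m p 0 ν hu0, kernNum_zero_zero]; ring

/-- The jump of the contour integral at the pole `iπj`. -/
def jump (m p : ℕ) (b σ θ₀ : ℝ) (j : ℕ) : ℂ :=
  2 * ((-1) ^ j * (kernNum m p j 0 * halfJump b σ (θ₀ - π * j)))

theorem lineAvg_kern_eq_sum_jump {m p : ℕ} (hm : 0 < m) (hp : 0 < p) {b σ : ℝ}
    (hσ : σ = 1 ∨ σ = -1) (hb : 0 < b) (θ₀ : ℝ) (l : ℕ) {δ : ℝ} (h0 : 0 < δ) (hδ : δ < π) :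
    lineAvg b σ θ₀ (kern m p) 0 =
      ∑ j ∈ Finset.range l, jump m p b σ θ₀ (j + 1) + lineAvg b σ θ₀ (kern m p) (π * l + δ) := by
  have hk : ∀ (l : ℕ) (δ : ℝ), |δ| < π → δ ≠ 0 → _ := fun l δ h h' =>
    lineAvg_kern hm hp (l : ℤ) hσ hb θ₀ (δ := δ) h h'
  induction l with
  | zero =>
    rw [Finset.range_zero, Finset.sum_empty, zero_add]
    have h := hk 0 δ (by rwa [abs_of_pos h0]) h0.ne'
    simp only [Nat.cast_zero, Int.cast_zero, kernNum_zero_zero, zero_mul, mul_zero, sub_zero,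
      zpow_zero, one_mul] at h
    rw [Nat.cast_zero, mul_zero, h]
    exact lineAvg_congr fun r => kern_eq_kernFull (σ := σ)
      (by rw [height_linePt hσ, abs_zero]; exact Real.pi_pos)
  | succ l ih =>
    rw [ih, Finset.sum_range_succ, add_assoc]
    congr 1
    have h1 := hk l δ (by rwa [abs_of_pos h0]) h0.ne'
    have h1' := hk l (π / 2) (by rw [abs_of_pos (by positivity)]; linarith) (by positivity)
    have h2 := hk (l + 1) δ (by rwa [abs_of_pos h0]) h0.ne'
    have h3 := hk (l + 1) (-(π / 2))
      (by rw [abs_neg, abs_of_pos (by positivity)]; linarith)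
      (by have := Real.pi_pos; linarith)
    rw [sign_pos h0] at h1 h2
    rw [sign_pos (by positivity)] at h1'
    rw [sign_neg (by have := Real.pi_pos; linarith)] at h3
    -- One and the same line is described from the pole below it and from the pole above it; this
    -- passes from the expansion at l to the one at l + 1.
    have e : π * ((l + 1 : ℕ) : ℤ) + -(π / 2) = π * (l : ℤ) + π / 2 := by push_cast; ring
    rw [e, h1', ← h1] at h3
    simp only [Int.cast_natCast] at h2 h3
    rw [h3, h2, jump]
    simp only [zpow_natCast, SignType.coe_neg, SignType.coe_one]
    ring

/-- The contour integral when the center of the Gaussian is not too far from the pole `iπl`. -/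
theorem lineAvg_kern_eq_add_halfJump {m p : ℕ} (hm : 0 < m) (hp : 0 < p) {b σ : ℝ}
    (hσ : σ = 1 ∨ σ = -1) (hb : 0 < b) {θ₀ : ℝ} (l : ℕ) (hθ : |θ₀ - π * (l + 1 : ℕ)| < π) :
    lineAvg b σ θ₀ (kern m p) 0 =
      ∑ j ∈ Finset.range l, jump m p b σ θ₀ (j + 1) + jump m p b σ θ₀ (l + 1) / 2 +
      (-1) ^ (l + 1) * gavg b (fun r => kernFull m p (l + 1 : ℕ)
        (σ * (θ₀ - π * (l + 1 : ℕ)) / (2 * b))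
        (Complex.I * (θ₀ - π * (l + 1 : ℕ) : ℝ) + tilt σ * r)) := by
  have hpi := Real.pi_pos
  rw [lineAvg_kern_eq_sum_jump hm hp hσ hb θ₀ l (δ := π / 2) (by positivity) (by linarith),
    add_assoc]
  congr 1
  -- The line half-way below the pole π(l + 1) sees half of its jump; the holomorphic rest may then
  -- be moved to the centre, on whichever side of the pole the centre lies.
  have h3 := lineAvg_kern hm hp ((l + 1 : ℕ) : ℤ) hσ hb θ₀ (δ := -(π / 2))
      (by rw [abs_neg, abs_of_pos (by positivity)]; linarith) (by linarith)
  rw [sign_neg (by linarith), show π * ((l + 1 : ℕ) : ℤ) + -(π / 2) = π * (l : ℝ) + π / 2 by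
    push_cast; ring] at h3
  simp only [Int.cast_natCast] at h3
  rw [h3, jump, ← lineAvg_self, lineAvg_kernFull_eq hm hp _ _ hσ hb hθ (δ₂ := 0) (by simpa)]
  simp only [zpow_natCast, SignType.coe_neg, SignType.coe_one]
  ring

/-! ### The Jones polynomial as a contour integral -/

theorem sum_exp_slWeight_mul_sinh (N : ℕ) (y : ℂ) :
    (∑ i : Fin N, Complex.exp (slWeight N i * y)) * Complex.sinh y = Complex.sinh (N * y) := by
  have h : ∀ i : Fin N, Complex.exp (slWeight N i * y) * (2 * Complex.sinh y) =
      (fun i : ℕ => Complex.exp ((N - 2 * i) * y) - Complex.exp ((N - 2 * (i + 1 : ℕ)) * y))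
        (i : ℕ) := fun i => by
    simp only [slWeight, Complex.sinh]
    rw [mul_div_cancel₀ _ two_ne_zero, mul_sub, ← Complex.exp_add, ← Complex.exp_add]
    congr 2 <;> push_cast <;> ring
  have h2 := Fin.sum_univ_eq_sum_range
    (fun i : ℕ => Complex.exp ((N - 2 * i) * y) - Complex.exp ((N - 2 * (i + 1 : ℕ)) * y)) N
  rw [Finset.sum_range_sub' (fun i : ℕ => Complex.exp ((N - 2 * i) * y))] at h2
  have h3 : (∑ i : Fin N, Complex.exp (slWeight N i * y)) * (2 * Complex.sinh y) =
      Complex.exp (N * y) - Complex.exp (-(N * y)) := by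
    rw [Finset.sum_mul, Finset.sum_congr rfl fun i _ => h i, h2]
    push_cast
    congr 2 <;> ring
  rw [Complex.sinh.eq_1 (N * y)]
  linear_combination h3 / 2

theorem slWeight_rev {N : ℕ} (i : Fin N) : slWeight N i.rev = -slWeight N i := by
  rw [slWeight, slWeight, Fin.val_rev]
  have := i.isLt
  omega

theorem sum_exp_slWeight_neg (N : ℕ) (y : ℂ) :
    ∑ i : Fin N, Complex.exp (slWeight N i * -y) = ∑ i : Fin N, Complex.exp (slWeight N i * y) := by
  rw [← Equiv.sum_comp Fin.revPerm]
  refine Finset.sum_congr rfl fun i _ => ?_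
  rw [Fin.revPerm_apply, slWeight_rev]; push_cast; ring_nf

theorem kern_neg (m p : ℕ) (y : ℂ) : kern m p (-y) = -kern m p y := by
  simp only [kern, neg_div, Complex.sinh_neg]; ring

theorem tilt_mul_eq_linePt (σ r : ℝ) : tilt σ * r = linePt σ 0 r := by simp [linePt]

/-- The geometric sum is sinh(Ny)/sinh y. On the tilted line through 0 the denominator vanishes only
at y = 0, where both sides are zero. -/
theorem sinh_mul_sinh_mul_sum {m p : ℕ} {σ : ℝ} (hσ : σ = 1 ∨ σ = -1) (N : ℕ) (r : ℝ) :
    Complex.sinh (tilt σ * r / m) * Complex.sinh (tilt σ * r / p) *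
      ∑ i : Fin N, Complex.exp (slWeight N i * (tilt σ * r)) =
      kern m p (tilt σ * r) * Complex.sinh (N * (tilt σ * r)) := by
  by_cases h : Complex.sinh (tilt σ * r) = 0
  · have h0 : tilt σ * r = 0 := eq_zero_of_sinh_eq_zero (σ := σ) h (by
      rw [tilt_mul_eq_linePt, height_linePt hσ, abs_zero]; exact Real.pi_pos)
    rw [h0]; simp
  · rw [kern, ← sum_exp_slWeight_mul_sinh]; field_simp

theorem integrable_gauss_mul_kern {m p : ℕ} (hm : 0 < m) (hp : 0 < p) {b σ : ℝ}
    (hσ : σ = 1 ∨ σ = -1) (hb : 0 < b) (θ₀ : ℝ) :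
    Integrable fun r : ℝ => gauss b ((linePt σ 0 r - Complex.I * θ₀) / tilt σ) *
      kern m p (linePt σ 0 r) := by
  have hh : ∀ r, |height σ (linePt σ 0 r)| < π := fun r => by
    rw [height_linePt hσ, abs_zero]; exact Real.pi_pos
  obtain ⟨C, hC, h⟩ := exists_norm_kernFull_le hm hp 0 0 hσ (η := 0) Real.pi_pos
  simp only [kern_eq_kernFull (hh _) (ν := 0)]
  refine integrable_gauss_mul_linePt hσ hb hC (by positivity) ?_ fun r =>
    h _ (by rw [height_linePt hσ, abs_zero])
  refine continuous_iff_continuousAt.mpr fun r => ?_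
  have h : ContinuousAt (kernFull m p 0 0) (linePt σ 0 r) :=
    (differentiableAt_kernFull m p 0 0 (hh r)).continuousAt
  exact h.comp (continuous_linePt σ 0).continuousAt

theorem gauss_linePt_zero {b σ : ℝ} (hσ : σ = 1 ∨ σ = -1) (hb : 0 < b) (N : ℕ) (r : ℝ) :
    gauss b ((linePt σ 0 r - Complex.I * ((2 * b * N : ℝ) : ℂ)) / tilt σ) =
      Complex.exp (-(b * tilt σ ^ 2 * N ^ 2)) *
        (gauss b r * Complex.exp (σ * N * (tilt σ * r))) := by
  have h := gauss_mul_exp hσ hb (2 * b * N) (linePt σ 0 r)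
  have hb' : (b : ℂ) ≠ 0 := by exact_mod_cast hb.ne'
  have e1 : ((2 * b * N : ℝ) : ℂ) ^ 2 / (4 * b * tilt σ ^ 2) = -(b * tilt σ ^ 2 * N ^ 2) := by
    have h4 : tilt σ ^ 2 * tilt σ ^ 2 = -1 := by
      rw [tilt_sq hσ]
      rcases hσ with rfl | rfl <;> push_cast <;> ring_nf <;> exact Complex.I_sq
    rw [div_eq_iff (by simp [hb', tilt_ne_zero])]
    push_cast
    linear_combination (4 * b ^ 2 * (N : ℂ) ^ 2) * h4
  have e2 : σ * (2 * b * N) / (2 * b) = σ * N := by field_simp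
  rw [e1, e2, ← tilt_mul_eq_linePt, mul_div_cancel_left₀ _ (tilt_ne_zero σ)] at h
  rw [← tilt_mul_eq_linePt, ← mul_assoc, ← h, mul_assoc (gauss _ _), ← Complex.exp_add]
  push_cast
  simp

theorem integrable_gauss_mul_cexp {b : ℝ} (hb : 0 < b) (c : ℂ) :
    Integrable fun r : ℝ => gauss b r * Complex.exp (c * r) :=
  integrable_gauss_mul hb (by fun_prop) (M := 1) (B := ‖c‖) (k := 0) fun r => by
    rw [pow_zero, one_mul, one_mul]
    refine (Complex.norm_exp_le_exp_norm _).trans (le_of_eq ?_)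
    rw [norm_mul, Complex.norm_real, Real.norm_eq_abs]

/-- A centred Gaussian sees only the even part of a function. -/
theorem gavg_eq_of_add_neg_eq {b : ℝ} {F G : ℝ → ℂ} (hF : Integrable fun r : ℝ => gauss b r * F r)
    (hG : Integrable fun r : ℝ => gauss b r * G r) (h : ∀ r, F r + F (-r) = G r + G (-r)) :
    gavg b F = gavg b G := by
  have key : ∀ {F : ℝ → ℂ}, (Integrable fun r : ℝ => gauss b r * F r) →
      gavg b (fun r => F r + F (-r)) = 2 * gavg b F := by
    intro F hF
    have hF' : Integrable fun r : ℝ => gauss b r * F (-r) := by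
      have := hF.comp_neg
      simpa [gauss_neg] using this
    rw [gavg_add hF hF', gavg_neg_comp]; ring
  have h2 := key hF
  simp only [h, key hG] at h2
  exact (mul_left_cancel₀ two_ne_zero h2).symm

/-- The sum of Gaussian exponentials in the trace formula is a contour integral of the kernel. -/
theorem sum_exp_sq_eq_lineAvg {m p : ℕ} (hm : 0 < m) (hp : 0 < p) {b σ : ℝ}
    (hσ : σ = 1 ∨ σ = -1) (hb : 0 < b) (N : ℕ) :
    Complex.exp (-(b * tilt σ ^ 2 * N ^ 2)) * ∑ i : Fin N,
        (Complex.exp (b * tilt σ ^ 2 * (slWeight N i + σ / p + 1 / m) ^ 2) -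
          Complex.exp (b * tilt σ ^ 2 * (slWeight N i + σ / p - 1 / m) ^ 2)) =
      2 * lineAvg b σ (2 * b * N) (kern m p) 0 := by
  -- Each exp(bτ²c²), with τ = `tilt σ`, is the average of exp(τcr) by `gavg_cexp`, so F averages to
  -- the given sum. The function H is the kernel with the factor that shifts the Gaussian to the
  -- centre 2bN.
  set F : ℝ → ℂ := fun r => ∑ i : Fin N,
    (Complex.exp ((tilt σ * (slWeight N i + σ / p + 1 / m)) * r) -
      Complex.exp ((tilt σ * (slWeight N i + σ / p - 1 / m)) * r)) with hFdef
  set H : ℝ → ℂ := fun r => 2 * (kern m p (tilt σ * r) * Complex.exp (σ * N * (tilt σ * r)))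
    with hHdef
  have hterm : ∀ i : Fin N, Integrable fun r : ℝ => gauss b r *
      (Complex.exp ((tilt σ * (slWeight N i + σ / p + 1 / m)) * r) -
      Complex.exp ((tilt σ * (slWeight N i + σ / p - 1 / m)) * r)) := fun i => by
    simp only [mul_sub]
    exact (integrable_gauss_mul_cexp hb _).sub (integrable_gauss_mul_cexp hb _)
  have hF : Integrable fun r : ℝ => gauss b r * F r := by
    simp only [hFdef, Finset.mul_sum]
    exact integrable_finsetSum _ fun i _ => hterm i
  have hH : Integrable fun r : ℝ => gauss b r * H r := by
    refine ((integrable_gauss_mul_kern hm hp hσ hb (2 * b * N)).const_mul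
      (2 * Complex.exp (b * tilt σ ^ 2 * N ^ 2))).congr (ae_of_all _ fun r => ?_)
    simp only [gauss_linePt_zero hσ hb]
    simp only [hHdef, ← tilt_mul_eq_linePt]
    have : Complex.exp (b * tilt σ ^ 2 * N ^ 2) * Complex.exp (-(b * tilt σ ^ 2 * N ^ 2)) = 1 := by
      rw [← Complex.exp_add, add_neg_cancel, Complex.exp_zero]
    linear_combination (2 * gauss b r * kern m p (tilt σ * r) *
      Complex.exp (σ * N * (tilt σ * r))) * this
  have hFr : ∀ r : ℝ, F r = 2 * Complex.sinh (tilt σ * r / m) * Complex.exp (σ / p * (tilt σ * r)) *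
      ∑ i : Fin N, Complex.exp (slWeight N i * (tilt σ * r)) := by
    intro r
    rw [hFdef, Finset.mul_sum]
    refine Finset.sum_congr rfl fun i _ => ?_
    rw [Complex.sinh, mul_div_cancel₀ _ two_ne_zero, sub_mul, sub_mul, ← Complex.exp_add,
      ← Complex.exp_add, ← Complex.exp_add, ← Complex.exp_add]
    congr 2 <;> ring
  -- F and H differ, but F(r) + F(-r) and H(r) + H(-r) are both 4σ kern(y) sinh(Ny) at y = τr.
  have hFH : gavg b F = gavg b H := by
    refine gavg_eq_of_add_neg_eq hF hH fun r => ?_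
    have h1 := sinh_mul_sinh_mul_sum (m := m) (p := p) hσ N r
    have hs : ∀ (z : ℂ), Complex.exp (σ * z) - Complex.exp (-(σ * z)) = 2 * σ * Complex.sinh z := by
      intro z
      rw [Complex.sinh]
      rcases hσ with rfl | rfl <;> simp <;> ring
    rw [hFr, hFr, hHdef]
    simp only [Complex.ofReal_neg, mul_neg, neg_div, Complex.sinh_neg, kern_neg]
    have h2 := sum_exp_slWeight_neg N (tilt σ * r)
    simp only [mul_neg] at h2
    rw [h2]
    have h3 := hs (tilt σ * r / p)
    have h4 := hs (N * (tilt σ * r))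
    rw [show (σ : ℂ) * (tilt σ * r / p) = σ / p * (tilt σ * r) by ring] at h3
    rw [show (σ : ℂ) * (N * (tilt σ * r)) = σ * N * (tilt σ * r) by ring] at h4
    linear_combination (2 * Complex.sinh (tilt σ * r / m) *
      ∑ i : Fin N, Complex.exp (slWeight N i * (tilt σ * r))) * h3 + 4 * σ * h1 -
      2 * kern m p (tilt σ * r) * h4
  have hgF : gavg b F = ∑ i : Fin N,
      (Complex.exp (b * tilt σ ^ 2 * (slWeight N i + σ / p + 1 / m) ^ 2) -
        Complex.exp (b * tilt σ ^ 2 * (slWeight N i + σ / p - 1 / m) ^ 2)) := by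
    rw [hFdef, gavg_sum _ fun i _ => hterm i]
    refine Finset.sum_congr rfl fun i _ => ?_
    have h5 := gavg_cexp hb (tilt σ * (slWeight N i + σ / p + 1 / m))
    have h6 := gavg_cexp hb (tilt σ * (slWeight N i + σ / p - 1 / m))
    rw [mul_pow, ← mul_assoc] at h5 h6
    rw [← h5, ← h6]
    simp only [gavg, mul_sub]
    rw [integral_sub (integrable_gauss_mul_cexp hb _) (integrable_gauss_mul_cexp hb _), mul_sub]
  rw [← hgF, hFH, hHdef, gavg_const_mul, lineAvg, gavg]
  simp only [gauss_linePt_zero hσ hb]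
  have e : ∀ r : ℝ, Complex.exp (-(b * tilt σ ^ 2 * N ^ 2)) *
      (gauss b r * Complex.exp (σ * N * (tilt σ * r))) * kern m p (linePt σ 0 r) =
      Complex.exp (-(b * tilt σ ^ 2 * N ^ 2)) *
        (gauss b r * (kern m p (tilt σ * r) * Complex.exp (σ * N * (tilt σ * r)))) := fun r => by
    rw [← tilt_mul_eq_linePt]; ring
  simp only [e]
  rw [integral_const_mul]
  ring

/-- The exponents of the trace formula are mn(w + 1/n ± 1/m)² - mnα² plus mn - m/n - n/m, and the
last expression is the two-loop phase. The condition α < K makes the quantum integers below α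
nonzero at this root of unity. -/
theorem jonesTorus_eq_lineAvg {m : ℕ} (hm : 0 < m) {n : ℤ} (hn : n ≠ 0)
    (hmn : IsCoprime (m : ℤ) n) {K α : ℕ} (hα : 0 < α) (hαK : α < K) :
    jonesTorus m n K α = (√(2 / (K : ℝ)) : ℝ) / Complex.I * twoLoopPhase m n K *
      lineAvg (π * m * n.natAbs / (2 * K)) n.sign (2 * (π * m * n.natAbs / (2 * K)) * α)
        (kern m n.natAbs) 0 := by
  obtain ⟨M, rfl⟩ := Nat.exists_eq_succ_of_ne_zero hm.ne'
  have hK : 0 < K := hα.trans hαK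
  have hK0 : (K : ℂ) ≠ 0 := by exact_mod_cast hK.ne'
  have hp : 0 < n.natAbs := Int.natAbs_pos.mpr hn
  set σ : ℝ := (n.sign : ℝ) with hσdef
  have hσ : σ = 1 ∨ σ = -1 := by
    rcases lt_or_gt_of_ne hn with h | h
    · right; rw [hσdef, Int.sign_eq_neg_one_of_neg h]; norm_num
    · left; rw [hσdef, Int.sign_eq_one_of_pos h]; norm_num
  have hσn : (σ : ℂ) * n.natAbs = n := by
    have := Int.sign_mul_natAbs n
    rw [hσdef, Complex.ofReal_intCast, ← Int.cast_natCast n.natAbs, ← Int.cast_mul, this]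
  have hσ2 : (σ : ℂ) * σ = 1 := by rcases hσ with h | h <;> rw [h] <;> norm_num
  set b := π * (M.succ : ℕ) * n.natAbs / (2 * K) with hbdef
  have hb : 0 < b := by
    have := Real.pi_pos
    have h1 : (0 : ℝ) < (M.succ : ℕ) := by positivity
    have h2 : (0 : ℝ) < n.natAbs := by exact_mod_cast hp
    have h3 : (0 : ℝ) < K := by exact_mod_cast hK
    positivity
  set t := Complex.exp (Complex.I * π / (2 * K)) with ht
  have hpow : ∀ e : ℤ, t ^ e = Complex.exp (e * (Complex.I * π / (2 * K))) := fun e => by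
    rw [ht, Complex.exp_int_mul]
  have hsin : ∀ k : ℕ, 0 < k → k < K → Real.sin (π / K * k) ≠ 0 := by
    intro k hk hkK
    have h3 : (0 : ℝ) < K := by exact_mod_cast hK
    have h4 : (0 : ℝ) < k := by exact_mod_cast hk
    have h5 : (k : ℝ) < K := by exact_mod_cast hkK
    refine (Real.sin_pos_of_pos_of_lt_pi (by positivity) ?_).ne'
    rw [div_mul_eq_mul_div, div_lt_iff₀ h3]
    exact mul_lt_mul_of_pos_left h5 Real.pi_pos
  have hdiff : ∀ k : ℕ, t ^ (2 * k : ℤ) - t ^ (-(2 * k) : ℤ) =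
      2 * Complex.I * (Real.sin (π / K * k) : ℝ) := by
    intro k
    rw [hpow, hpow, Complex.ofReal_sin, Complex.sin]
    have e1 : ((2 * k : ℤ) : ℂ) * (Complex.I * π / (2 * K)) = ((π / K * k : ℝ) : ℂ) * Complex.I := by
      push_cast; field_simp
    have e2 : ((-(2 * k) : ℤ) : ℂ) * (Complex.I * π / (2 * K)) =
        -((π / K * k : ℝ) : ℂ) * Complex.I := by
      push_cast; field_simp
    rw [e1, e2]
    linear_combination (Complex.exp (-((π / K * k : ℝ) : ℂ) * Complex.I) -
      Complex.exp (((π / K * k : ℝ) : ℂ) * Complex.I)) * (-Complex.I_sq)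
  have hq : ∀ k : ℕ, 0 < k → k < α → qdiff (t ^ 2) k ≠ 0 := by
    intro k hk hkα
    have h := hdiff k
    rw [qdiff, ← zpow_natCast t 2, ← zpow_mul, ← zpow_mul]
    push_cast
    rw [mul_neg, h]
    have := hsin k hk (hkα.trans hαK)
    exact mul_ne_zero (mul_ne_zero two_ne_zero Complex.I_ne_zero) (Complex.ofReal_ne_zero.mpr this)
  have htr := colouredJones_torus (Complex.exp_ne_zero _) hq hmn
  have h2 := hdiff 1
  simp only [Nat.cast_one, mul_one] at h2
  rw [h2] at htr
  have hm0 : ((M.succ : ℕ) : ℂ) ≠ 0 := by exact_mod_cast hm.ne'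
  have hn0 : (n : ℂ) ≠ 0 := by exact_mod_cast hn
  have hp0 : (n.natAbs : ℂ) ≠ 0 := by exact_mod_cast hp.ne'
  have hbt : (b : ℂ) * tilt σ ^ 2 = Complex.I * π / (2 * K) * ((M.succ : ℕ) * n) := by
    rw [tilt_sq hσ, hbdef, ← hσn]; push_cast; field_simp
  have hinv : (σ : ℂ) / n.natAbs = 1 / n := by
    rw [div_eq_div_iff hp0 hn0, ← hσn, ← mul_assoc, hσ2]
  have hterm : ∀ (w e : ℤ) (ε : ℂ), (ε = 1 ∨ ε = -1) →
      (e : ℂ) = (M.succ : ℕ) * n * (w ^ 2 - (α ^ 2 - 1)) + 2 * (M.succ : ℕ) * w + ε * (2 * n * w)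
        + ε * 2 →
      t ^ e = twoLoopPhase M.succ n K * (Complex.exp (-(b * tilt σ ^ 2 * α ^ 2)) *
        Complex.exp (b * tilt σ ^ 2 * (w + σ / n.natAbs + ε * (1 / (M.succ : ℕ))) ^ 2)) := by
    intro w e ε hε he
    rw [hpow, twoLoopPhase, ← Complex.exp_add, ← Complex.exp_add, hbt, hinv, he]
    congr 1
    field_simp
    rcases hε with rfl | rfl <;> ring
  have hsum := sum_exp_sq_eq_lineAvg (m := M.succ) hm hp hσ hb α
  have hrhs : 2 * Complex.I * (Real.sin (π / K) : ℝ) *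
      colouredJones (M + 1) α t (BraidWord.torus (M + 1) n) = twoLoopPhase M.succ n K *
        (2 * lineAvg b σ (2 * b * α) (kern M.succ n.natAbs) 0) := by
    rw [htr, ← hsum, Finset.mul_sum, Finset.mul_sum]
    refine Finset.sum_congr rfl fun i _ => ?_
    rw [hterm (slWeight α i) _ 1 (Or.inl rfl) (by push_cast; ring),
      hterm (slWeight α i) _ (-1) (Or.inr rfl) (by push_cast; ring), one_mul, neg_one_mul,
      ← sub_eq_add_neg]
    ring
  rw [jonesTorus]
  change _ * colouredJones (M + 1) α t (BraidWord.torus (M + 1) n) = _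
  rw [Complex.ofReal_mul, mul_assoc, div_mul_eq_mul_div, div_mul_eq_mul_div,
    eq_div_iff Complex.I_ne_zero]
  linear_combination ((√(2 / (K : ℝ)) : ℝ) / 2 : ℂ) * hrhs

/-! ### The contributions of the irreducible connections -/

/-- Half the variance of the Gaussian in the contour integral. -/
def width (m : ℕ) (n : ℤ) (K : ℕ) : ℝ := π * m * n.natAbs / (2 * K)

/-- The sign of an integer as a real number. -/
def rsign (n : ℤ) : ℝ := n.sign

theorem rsign_eq {n : ℤ} (hn : n ≠ 0) : rsign n = 1 ∨ rsign n = -1 := by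
  rcases lt_or_gt_of_ne hn with h | h
  · right; rw [rsign, Int.sign_eq_neg_one_of_neg h]; norm_num
  · left; rw [rsign, Int.sign_eq_one_of_pos h]; norm_num

theorem rsign_mul_natAbs (n : ℤ) : rsign n * n.natAbs = n := by
  rw [rsign, ← Int.cast_natCast n.natAbs, ← Int.cast_mul, Int.sign_mul_natAbs]

theorem rsign_mul_self {n : ℤ} (hn : n ≠ 0) : rsign n * rsign n = 1 := by
  rcases rsign_eq hn with h | h <;> rw [h] <;> norm_num

theorem width_pos {m : ℕ} (hm : 0 < m) {n : ℤ} (hn : n ≠ 0) {K : ℕ} (hK : 0 < K) :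
    0 < width m n K := by
  have h1 : (0 : ℝ) < m := by exact_mod_cast hm
  have h2 : (0 : ℝ) < n.natAbs := by exact_mod_cast Int.natAbs_pos.mpr hn
  have h3 : (0 : ℝ) < K := by exact_mod_cast hK
  unfold width
  have := Real.pi_pos
  positivity

theorem sqrt_mul_width {m : ℕ} {n : ℤ} {K : ℕ} :
    √(4 * π * width m n K) = π * √(2 / K) * √(m * n.natAbs) := by
  rw [width,
    show 4 * π * (π * m * n.natAbs / (2 * K)) = π ^ 2 * (2 / K * (m * n.natAbs)) by ring,
    Real.sqrt_mul (by positivity), Real.sqrt_sq Real.pi_pos.le, Real.sqrt_mul (by positivity),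
    mul_assoc]

theorem sqrt_abs_mul (m : ℕ) (n : ℤ) : √|(m * n : ℝ)| = √(m * n.natAbs) := by
  rw [abs_mul, Nat.abs_cast, Nat.cast_natAbs, Int.cast_abs]

theorem exp_sign_mul {m : ℕ} (hm : 0 < m) (n : ℤ) (z : ℂ) :
    Complex.exp (Complex.I * π / 4 * ((m * n : ℤ).sign : ℂ) + z) =
      tilt (rsign n) * Complex.exp z := by
  rw [Complex.exp_add, tilt, rsign, Int.sign_mul, Int.sign_natCast_of_ne_zero hm.ne', one_mul,
    Complex.ofReal_intCast]

theorem exp_pi_mul_sign_mul {n : ℤ} (hn : n ≠ 0) (j : ℕ) :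
    Complex.exp (Complex.I * π * ((n.sign * j : ℤ) : ℂ)) = (-1) ^ j := by
  have h : Complex.exp (Complex.I * π * ((n.sign * j : ℤ) : ℂ)) = (-1) ^ (n.sign * j) := by
    rw [← Complex.exp_pi_mul_I, ← Complex.exp_int_mul]; congr 1; ring
  rw [h]
  rcases lt_or_gt_of_ne hn with h | h
  · rw [Int.sign_eq_neg_one_of_neg h, neg_one_mul, zpow_neg, zpow_natCast, ← inv_pow, inv_neg_one]
  · rw [Int.sign_eq_one_of_pos h, one_mul, zpow_natCast]

theorem kernNum_zero_eq (m : ℕ) {n : ℤ} (hn : n ≠ 0) (j : ℕ) :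
    kernNum m n.natAbs j 0 = -(rsign n * (Real.sin (π * (n.sign * j : ℤ) / m) *
      Real.sin (π * (n.sign * j : ℤ) / n) : ℝ) : ℂ) := by
  have h1 : ∀ x : ℝ, Complex.sinh (Complex.I * x) = Complex.I * (Real.sin x : ℝ) := fun x => by
    rw [mul_comm, Complex.sinh_mul_I, Complex.ofReal_sin, mul_comm]
  have e1 : (Complex.I * π * (j : ℤ) + 0) / (m : ℂ) = Complex.I * ((π * j / m : ℝ) : ℂ) := by
    push_cast; ring
  have e2 : (Complex.I * π * (j : ℤ) + 0) / (n.natAbs : ℂ) =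
      Complex.I * ((π * j / n.natAbs : ℝ) : ℂ) := by
    push_cast; ring
  have hp0 : (n.natAbs : ℝ) ≠ 0 := by exact_mod_cast (Int.natAbs_pos.mpr hn).ne'
  have hn0 : (n : ℝ) ≠ 0 := by exact_mod_cast hn
  have e3 : π * (n.sign * j : ℤ) / n = π * j / n.natAbs := by
    rw [div_eq_div_iff hn0 hp0, ← rsign_mul_natAbs n, rsign]; push_cast; ring
  have e4 : rsign n * Real.sin (π * (n.sign * j : ℤ) / m) = Real.sin (π * j / m) := by
    have : (n.sign * j : ℤ) = (rsign n * j : ℝ) := by rw [rsign]; push_cast; ring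
    rw [this]
    rcases rsign_eq hn with h | h
    · rw [h]; ring_nf
    · rw [h, show π * (-1 * (j : ℝ)) / m = -(π * j / m) by ring, Real.sin_neg]; ring
  rw [kernNum, e1, e2, h1, h1, e3, ← e4]
  push_cast
  linear_combination (rsign n * Complex.sin (π * (n.sign * j) / m) *
    Complex.sin (π * j / n.natAbs)) * Complex.I_sq

theorem sqrt_div_I_mul_halfJump {m : ℕ} (hm : 0 < m) {n : ℤ} (hn : n ≠ 0) {K : ℕ} (hK : 0 < K)
    (δ₀ : ℝ) :
    ((√(2 / (K : ℝ)) : ℝ) : ℂ) / Complex.I * halfJump (width m n K) (rsign n) δ₀ =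
      -(Complex.I * rsign n * tilt (rsign n)) / (√|(m * n : ℝ)| : ℝ) *
        Complex.exp (-(Complex.I * (rsign n * δ₀ ^ 2 / (4 * width m n K) : ℝ))) := by
  have hσ := rsign_eq hn
  have hb := width_pos hm hn hK
  have hs1 : ((√(2 / (K : ℝ)) : ℝ) : ℂ) ≠ 0 := by
    have h3 : (0 : ℝ) < K := by exact_mod_cast hK
    exact_mod_cast (Real.sqrt_pos.mpr (by positivity)).ne'
  have hs2 : ((√(m * n.natAbs : ℝ) : ℝ) : ℂ) ≠ 0 := by
    have h1 : (0 : ℝ) < m := by exact_mod_cast hm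
    have h2 : (0 : ℝ) < n.natAbs := by exact_mod_cast Int.natAbs_pos.mpr hn
    exact_mod_cast (Real.sqrt_pos.mpr (by positivity)).ne'
  have hpi : (π : ℂ) ≠ 0 := by exact_mod_cast Real.pi_ne_zero
  have hb' : (width m n K : ℂ) ≠ 0 := by exact_mod_cast hb.ne'
  have hσ2 : (rsign n : ℂ) * rsign n = 1 := by exact_mod_cast rsign_mul_self hn
  have e : (δ₀ : ℂ) ^ 2 / (4 * width m n K * tilt (rsign n) ^ 2) =
      -(Complex.I * (rsign n * δ₀ ^ 2 / (4 * width m n K) : ℝ)) := by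
    rw [tilt_sq hσ, div_eq_iff (by
      refine mul_ne_zero (mul_ne_zero (by norm_num) hb') (mul_ne_zero Complex.I_ne_zero ?_)
      exact left_ne_zero_of_mul_eq_one hσ2)]
    push_cast
    field_simp
    linear_combination ((δ₀ : ℂ) ^ 2 * (rsign n : ℂ) ^ 2) * Complex.I_sq - (δ₀ : ℂ) ^ 2 * hσ2
  have ht : Complex.I * π / tilt (rsign n) = π * (rsign n * tilt (rsign n)) := by
    rw [div_eq_iff (tilt_ne_zero _)]
    linear_combination (-(π * rsign n : ℂ)) * tilt_sq hσ - (π * Complex.I) * hσ2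
  rw [halfJump, e, ht, sqrt_mul_width, sqrt_abs_mul]
  push_cast
  field_simp
  rw [Complex.I_sq]; ring

/-- The pole iπj carries the connection with label sign(n) j. Its oscillating exponential is the
weight exp(δ₀²/(4bτ²)) of `halfJump`, τ = `tilt (rsign n)`, at the distance δ₀ = 2bx - πj between
centre and pole, and the product of sines is the residue. -/
theorem sqrt_div_I_mul_jump {m : ℕ} (hm : 0 < m) {n : ℤ} (hn : n ≠ 0) {K : ℕ} (hK : 0 < K)
    (x : ℝ) (j : ℕ) :
    ((√(2 / (K : ℝ)) : ℝ) : ℂ) / Complex.I * twoLoopPhase m n K *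
      jump m n.natAbs (width m n K) (rsign n) (2 * width m n K * x) j =
      irreducible m n K (n.sign * j) x := by
  have hσ2 : (rsign n : ℂ) * rsign n = 1 := by exact_mod_cast rsign_mul_self hn
  have hm0 : (m : ℝ) ≠ 0 := by exact_mod_cast hm.ne'
  have hK0 : (K : ℝ) ≠ 0 := by exact_mod_cast hK.ne'
  have hp0 : (n.natAbs : ℝ) ≠ 0 := by exact_mod_cast (Int.natAbs_pos.mpr hn).ne'
  have hr0 : rsign n ≠ 0 := left_ne_zero_of_mul_eq_one (rsign_mul_self hn)
  have e : rsign n * (2 * width m n K * x - π * j) ^ 2 / (4 * width m n K) =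
      π * K * ((m * n : ℝ) / 2 * (x / K - (n.sign * j : ℤ) / (m * n)) ^ 2) := by
    have : ((n.sign * j : ℤ) : ℝ) = rsign n * j := by rw [rsign]; push_cast; ring
    rw [this, width, ← rsign_mul_natAbs n]
    have := Real.pi_ne_zero
    field_simp
    ring
  have h := sqrt_div_I_mul_halfJump hm hn hK (2 * width m n K * x - π * j)
  rw [e] at h
  rw [jump, kernNum_zero_eq m hn, irreducible, exp_sign_mul hm, exp_pi_mul_sign_mul hn]
  have e5 : Complex.I * ((π * K * ((m * n : ℝ) / 2 * (x / K - (n.sign * j : ℤ) / (m * n)) ^ 2) : ℝ)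
      : ℂ) = Complex.I * π * K * (((m * n : ℝ) / 2 * (x / K - (n.sign * j : ℤ) / (m * n)) ^ 2 : ℝ)
      : ℂ) := by push_cast; ring
  rw [e5] at h
  set E := Complex.exp (-(Complex.I * π * K *
    (((m * n : ℝ) / 2 * (x / K - (n.sign * j : ℤ) / (m * n)) ^ 2 : ℝ) : ℂ))) with hE
  set A := Real.sin (π * (n.sign * j : ℤ) / m) * Real.sin (π * (n.sign * j : ℤ) / n) with hA
  rw [show 4 * Real.sin (π * (n.sign * j : ℤ) / m) * Real.sin (π * (n.sign * j : ℤ) / n) /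
    √|(m * n : ℝ)| = 4 * A / √|(m * n : ℝ)| by rw [hA]; ring]
  push_cast
  linear_combination (twoLoopPhase m n K * 2 * (-1) ^ j * (-(rsign n * (A : ℂ)))) * h +
    (2 * twoLoopPhase m n K * (-1) ^ j * A * Complex.I * tilt (rsign n) /
      (√|(m * n : ℝ)| : ℝ) * E) * hσ2

/-- The labels are the sign(n)(j + 1) with j < L, where `hL` makes L the number of positive integers
strictly below m|n|a. The bound a ≤ 1 keeps them inside the finite interval from which the labels
are filtered. -/
theorem sum_irreducibleLabels {m : ℕ} (hm : 0 < m) {n : ℤ} (hn : n ≠ 0) {a : ℝ} (ha : a ≤ 1)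
    (L : ℕ) (hL : ∀ j : ℕ, j < L ↔ (j + 1 : ℝ) < m * n.natAbs * a) (f : ℤ → ℂ) :
    ∑ l ∈ irreducibleLabels m n a, f l = ∑ j ∈ Finset.range L, f (n.sign * (j + 1 : ℕ)) := by
  have hm0 : (0 : ℝ) < m := by exact_mod_cast hm
  have hp0 : (0 : ℝ) < n.natAbs := by exact_mod_cast Int.natAbs_pos.mpr hn
  have hs : n.sign * n.sign = 1 := by
    rcases lt_or_gt_of_ne hn with h | h
    · rw [Int.sign_eq_neg_one_of_neg h]; norm_num
    · rw [Int.sign_eq_one_of_pos h]; norm_num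
  have hr0 : rsign n ≠ 0 := left_ne_zero_of_mul_eq_one (rsign_mul_self hn)
  have hdiv : ∀ j : ℤ, ((n.sign * j : ℤ) : ℝ) / (m * n) = j / (m * n.natAbs) := by
    intro j
    have : ((n.sign * j : ℤ) : ℝ) = rsign n * j := by rw [rsign]; push_cast; ring
    rw [this, ← rsign_mul_natAbs n, mul_left_comm, mul_div_mul_left _ _ hr0]
  have habs : |(m * n : ℤ)| = m * n.natAbs := by
    rw [abs_mul, Nat.abs_cast, Int.abs_eq_natAbs]
  symm
  refine Finset.sum_nbij' (fun j => n.sign * (j + 1 : ℕ)) (fun l => (n.sign * l).toNat - 1)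
    ?_ ?_ ?_ ?_ (fun _ _ => rfl)
  · intro j hj
    have hj' := (hL j).mp (Finset.mem_range.mp hj)
    rw [irreducibleLabels, Finset.mem_filter, Finset.mem_Icc, habs]
    have hle : ((j + 1 : ℕ) : ℤ) ≤ m * n.natAbs := by
      have : (j + 1 : ℝ) ≤ m * n.natAbs := by nlinarith [mul_pos hm0 hp0]
      exact_mod_cast this
    refine ⟨?_, ?_, ?_⟩
    · rcases lt_or_gt_of_ne hn with h | h
      · rw [Int.sign_eq_neg_one_of_neg h]; constructor <;> linarith [Int.natCast_nonneg (j + 1)]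
      · rw [Int.sign_eq_one_of_pos h]; constructor <;> linarith [Int.natCast_nonneg (j + 1)]
    · rw [hdiv]; push_cast; positivity
    · rw [hdiv, div_lt_iff₀ (by positivity)]; push_cast; linarith
  · intro l hl
    rw [irreducibleLabels, Finset.mem_filter] at hl
    have hl' : n.sign * (n.sign * l) = l := by rw [← mul_assoc, hs, one_mul]
    obtain ⟨-, h1, h2⟩ := hl
    rw [← hl', hdiv] at h1 h2
    have hpos : 0 < n.sign * l := by
      by_contra! hc
      have : ((n.sign * l : ℤ) : ℝ) ≤ 0 := by exact_mod_cast hc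
      exact absurd h1 (not_lt.mpr (div_nonpos_of_nonpos_of_nonneg this (by positivity)))
    rw [div_lt_iff₀ (by positivity)] at h2
    rw [Finset.mem_range, hL]
    have h3 : (((n.sign * l).toNat - 1 : ℕ) : ℤ) + 1 = n.sign * l := by omega
    have h4 : (((n.sign * l).toNat - 1 : ℕ) : ℝ) + 1 = ((n.sign * l : ℤ) : ℝ) := by
      exact_mod_cast h3
    rw [h4]; linarith
  · intro j _
    rw [← mul_assoc, hs, one_mul]; simp
  · intro l hl
    rw [irreducibleLabels, Finset.mem_filter] at hl
    have hl' : n.sign * (n.sign * l) = l := by rw [← mul_assoc, hs, one_mul]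
    obtain ⟨-, h1, h2⟩ := hl
    rw [← hl', hdiv] at h1
    have hpos : 0 < n.sign * l := by
      by_contra! hc
      have : ((n.sign * l : ℤ) : ℝ) ≤ 0 := by exact_mod_cast hc
      exact absurd h1 (not_lt.mpr (div_nonpos_of_nonpos_of_nonneg this (by positivity)))
    have h3 : (((n.sign * l).toNat - 1 + 1 : ℕ) : ℤ) = n.sign * l := by omega
    rw [h3, hl']

/-! ### Derivatives of the kernels of the asymptotic series -/

theorem deriv_ofReal_comp (f : ℝ → ℝ) (x : ℝ) :
    deriv (fun y => (f y : ℂ)) x = (deriv f x : ℝ) := by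
  by_cases h : DifferentiableAt ℝ f x
  · exact h.hasDerivAt.ofReal_comp.deriv
  · rw [deriv_zero_of_not_differentiableAt h, deriv_zero_of_not_differentiableAt,
      Complex.ofReal_zero]
    intro hc
    have h1 : DifferentiableAt ℝ (Complex.reCLM ∘ fun y => (f y : ℂ)) x :=
      Complex.reCLM.differentiableAt.comp x hc
    exact h h1

theorem iteratedDeriv_ofReal_comp (f : ℝ → ℝ) (n : ℕ) :
    iteratedDeriv n (fun y => (f y : ℂ)) = fun x => ((iteratedDeriv n f x : ℝ) : ℂ) := by
  induction n with
  | zero => simp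
  | succ n ih =>
    rw [iteratedDeriv_succ, ih]
    funext x
    rw [deriv_ofReal_comp, iteratedDeriv_succ]

theorem DifferentiableOn.differentiableAt_iteratedDeriv {G : ℂ → ℂ} {U : Set ℂ} (hU : IsOpen U)
    (hG : DifferentiableOn ℂ G U) (n : ℕ) {z : ℂ} (hz : z ∈ U) :
    DifferentiableAt ℂ (iteratedDeriv n G) z := by
  rw [iteratedDeriv_eq_iterate]
  exact ((hG.analyticAt (hU.mem_nhds hz)).iterated_deriv n).differentiableAt

/-- The chain rule that passes from real derivatives in x to complex derivatives of the kernel. The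
conclusion concerns a neighbourhood, so that it can be differentiated again in the induction. -/
theorem iteratedDeriv_comp_line {G : ℂ → ℂ} {U : Set ℂ} (hU : IsOpen U)
    (hG : DifferentiableOn ℂ G U) {a c : ℂ} {F : ℝ → ℂ} {x₀ : ℝ} (hx₀ : c * x₀ ∈ U)
    (hF : ∀ᶠ x : ℝ in 𝓝 x₀, F x = a * G (c * x)) (n : ℕ) :
    ∀ᶠ x : ℝ in 𝓝 x₀, iteratedDeriv n F x = a * (c ^ n * iteratedDeriv n G (c * x)) := by
  have hmem : ∀ᶠ x : ℝ in 𝓝 x₀, c * x ∈ U :=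
    ((by fun_prop : Continuous fun x : ℝ => c * (x : ℂ)).continuousAt).eventually
      (hU.mem_nhds hx₀)
  induction n with
  | zero => simpa using hF
  | succ n ih =>
    filter_upwards [ih.eventually_nhds, hmem] with x hx hxU
    rw [iteratedDeriv_succ, Filter.EventuallyEq.deriv_eq hx]
    have h1 := (hG.differentiableAt_iteratedDeriv hU n hxU).hasDerivAt
    have h2 : HasDerivAt (fun x : ℝ => c * (x : ℂ)) c x := by
      simpa using ((hasDerivAt_id x).ofReal_comp).const_mul c
    have h3 := ((h1.comp x h2).const_mul (c ^ n)).const_mul a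
    refine h3.deriv.trans ?_
    rw [← iteratedDeriv_succ, pow_succ]; ring

theorem contExt_eq {f : ℝ → ℂ} {x : ℝ} {z : ℂ} (h : Tendsto f (𝓝[≠] x) (𝓝 z)) :
    contExt f x = z := h.limUnder_eq

theorem ofReal_contExt_eq {f : ℝ → ℝ} {x : ℝ} {z : ℂ}
    (h : Tendsto (fun y => (f y : ℂ)) (𝓝[≠] x) (𝓝 z)) : ((contExt f x : ℝ) : ℂ) = z := by
  have h1 : Tendsto f (𝓝[≠] x) (𝓝 z.re) := (Complex.continuous_re.tendsto z).comp h
  have h2 : contExt f x = z.re := h1.limUnder_eq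
  rw [h2]
  exact tendsto_nhds_unique ((Complex.continuous_ofReal.tendsto z.re).comp h1) h

theorem two_mul_width {m : ℕ} {n : ℤ} (K : ℕ) :
    2 * width m n K = π / K * (m * n.natAbs) := by
  rw [width]; ring

theorem sinh_I_mul_ofReal (x : ℝ) :
    Complex.sinh (Complex.I * x) = Complex.I * (Real.sin x : ℝ) := by
  rw [mul_comm, Complex.sinh_mul_I, Complex.ofReal_sin, mul_comm]

theorem sin_rsign_mul {n : ℤ} (hn : n ≠ 0) (x : ℝ) :
    Real.sin (rsign n * x) = rsign n * Real.sin x := by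
  rcases rsign_eq hn with h | h <;> rw [h] <;> simp

/-- The real quotient is the kernel on the imaginary axis. No point has to be excluded, since both
quotients are 0 where their denominators vanish. -/
theorem reducibleKernel_quotient_eq {m : ℕ} (hm : 0 < m) {n : ℤ} (hn : n ≠ 0) (K : ℕ) (x : ℝ) :
    ((Real.sin (π / K * n * x) * Real.sin (π / K * m * x) /
      Real.sin (π / K * (m * n) * x) : ℝ) : ℂ) =
      -Complex.I * kern m n.natAbs (2 * Complex.I * width m n K * x) := by
  have hm0 : (m : ℂ) ≠ 0 := by exact_mod_cast hm.ne'
  have hp0 : (n.natAbs : ℂ) ≠ 0 := by exact_mod_cast (Int.natAbs_pos.mpr hn).ne'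
  have hr0 : rsign n ≠ 0 := left_ne_zero_of_mul_eq_one (rsign_mul_self hn)
  have h2 : (2 * Complex.I * width m n K * x : ℂ) =
      Complex.I * ((π / K * (m * n.natAbs) * x : ℝ) : ℂ) := by
    rw [← two_mul_width]; push_cast; ring
  have e1 : (2 * Complex.I * width m n K * x : ℂ) / m =
      Complex.I * ((π / K * n.natAbs * x : ℝ) : ℂ) := by
    rw [h2, div_eq_iff hm0]; push_cast; ring
  have e2 : (2 * Complex.I * width m n K * x : ℂ) / n.natAbs =
      Complex.I * ((π / K * m * x : ℝ) : ℂ) := by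
    rw [h2, div_eq_iff hp0]; push_cast; ring
  have e3 : Real.sin (π / K * n * x) = rsign n * Real.sin (π / K * n.natAbs * x) := by
    rw [← sin_rsign_mul hn, ← rsign_mul_natAbs n]; ring_nf
  have e4 : Real.sin (π / K * (m * n) * x) =
      rsign n * Real.sin (π / K * (m * n.natAbs) * x) := by
    rw [← sin_rsign_mul hn, ← rsign_mul_natAbs n]; ring_nf
  rw [kern, e1, e2, h2, sinh_I_mul_ofReal, sinh_I_mul_ofReal, sinh_I_mul_ofReal, e3, e4,
    mul_assoc (rsign n), mul_div_mul_left _ _ hr0]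
  push_cast
  set s := Complex.sin (π / K * (m * n.natAbs) * x)
  rcases eq_or_ne s 0 with hs | hs
  · simp [hs]
  · have := Complex.I_ne_zero
    field_simp
    rw [Complex.I_sq]; ring

theorem eventually_line_ne {c : ℂ} (hc : c ≠ 0) (y₁ : ℂ) (x : ℝ) :
    ∀ᶠ y : ℝ in 𝓝[≠] x, c * (y : ℂ) ≠ y₁ := by
  rcases eq_or_ne (c * (x : ℂ)) y₁ with h | h
  · filter_upwards [self_mem_nhdsWithin] with y hy h'
    exact hy (by exact_mod_cast mul_left_cancel₀ hc (h'.trans h.symm))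
  · exact nhdsWithin_le_nhds (((by fun_prop : Continuous fun y : ℝ => c * (y : ℂ)).continuousAt).eventually_ne h)

theorem width_ne_zero {m : ℕ} (hm : 0 < m) {n : ℤ} (hn : n ≠ 0) {K : ℕ} (hK : 0 < K) :
    (2 * Complex.I * width m n K : ℂ) ≠ 0 := by
  have : (width m n K : ℂ) ≠ 0 := by exact_mod_cast (width_pos hm hn hK).ne'
  simp [this]

/-- The function h stands for the kernel with a removable singularity at y₁ removed, and extension
by continuity on the real side selects exactly its values. -/
theorem reducibleKernel_eq {m : ℕ} (hm : 0 < m) {n : ℤ} (hn : n ≠ 0) {K : ℕ} (hK : 0 < K)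
    {h : ℂ → ℂ} {x : ℝ} {y₁ : ℂ}
    (hc : ContinuousAt h (2 * Complex.I * width m n K * x))
    (hh : ∀ᶠ y in 𝓝 (2 * Complex.I * width m n K * x : ℂ), y ≠ y₁ → h y = kern m n.natAbs y) :
    ((reducibleKernel m n K x : ℝ) : ℂ) = -Complex.I * h (2 * Complex.I * width m n K * x) := by
  have hcont : Continuous fun y : ℝ => 2 * Complex.I * width m n K * (y : ℂ) := by fun_prop
  refine ofReal_contExt_eq ?_
  have h1 : Tendsto (fun y : ℝ => -Complex.I * h (2 * Complex.I * width m n K * y)) (𝓝[≠] x)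
      (𝓝 (-Complex.I * h (2 * Complex.I * width m n K * x))) :=
    ((hc.comp (f := fun y : ℝ => 2 * Complex.I * width m n K * (y : ℂ))
      hcont.continuousAt).tendsto.const_mul (-Complex.I)).mono_left nhdsWithin_le_nhds
  refine h1.congr' ?_
  filter_upwards [nhdsWithin_le_nhds (hcont.continuousAt.eventually hh),
    eventually_line_ne (width_ne_zero hm hn hK) y₁ x] with y h2 h3
  rw [reducibleKernel_quotient_eq hm hn, h2 h3]

/-- The factor from the chain rule satisfies (2ib)² = (2πi mn/K) · bτ² with b = `width m n K` and τ
= `tilt (rsign n)`, so the coefficients of R_J become the even moments of the Gaussian average. -/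
theorem series_coeff {n : ℤ} (hn : n ≠ 0) {m : ℕ} (hm : 0 < m) {K : ℕ} (hK : 0 < K) (j : ℕ)
    (d : ℂ) :
    (j.factorial : ℂ)⁻¹ * ((2 * π * Complex.I / K * ((m : ℂ) * (n : ℂ))) ^ j)⁻¹ *
      (-Complex.I * ((2 * Complex.I * width m n K) ^ (2 * j) * d)) =
    Complex.I⁻¹ * ((width m n K * tilt (rsign n) ^ 2) ^ j / j.factorial * d) := by
  have hK0 : (K : ℂ) ≠ 0 := by exact_mod_cast hK.ne'
  have hm0 : (m : ℂ) ≠ 0 := by exact_mod_cast hm.ne'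
  have hn0 : (n : ℂ) ≠ 0 := by exact_mod_cast hn
  have hpi : (π : ℂ) ≠ 0 := by exact_mod_cast Real.pi_ne_zero
  have h1 : (width m n K : ℂ) * tilt (rsign n) ^ 2 = Complex.I * π * (m * n) / (2 * K) := by
    have h := congrArg (Complex.ofReal) (rsign_mul_natAbs n)
    push_cast at h
    rw [tilt_sq (rsign_eq hn), width]
    push_cast
    rw [← h]; ring
  have h2 : (2 * Complex.I * width m n K : ℂ) ^ 2 =
      (2 * π * Complex.I / K * ((m : ℂ) * (n : ℂ))) * (width m n K * tilt (rsign n) ^ 2) := by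
    have hsq : (width m n K : ℂ) ^ 2 * 4 = (π * (m * n) / K) ^ 2 := by
      have : (n.natAbs : ℝ) ^ 2 = (n : ℝ) ^ 2 := by rw [Nat.cast_natAbs, Int.cast_abs, sq_abs]
      have h3 := congrArg Complex.ofReal this
      push_cast at h3
      rw [width]; push_cast
      field_simp
      linear_combination 4 * h3
    rw [h1, mul_pow, mul_pow]
    linear_combination Complex.I ^ 2 * hsq
  rw [pow_mul, h2, mul_pow, Complex.inv_I]
  have h3 : (2 * π * Complex.I / K * ((m : ℂ) * (n : ℂ))) ^ j ≠ 0 := by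
    exact pow_ne_zero _ (mul_ne_zero (div_ne_zero (mul_ne_zero (mul_ne_zero two_ne_zero hpi)
      Complex.I_ne_zero) hK0) (mul_ne_zero hm0 hn0))
  set X := (2 * π * Complex.I / K * ((m : ℂ) * (n : ℂ))) ^ j
  linear_combination ((j.factorial : ℂ)⁻¹ * (-Complex.I) *
    (width m n K * tilt (rsign n) ^ 2) ^ j * d) * inv_mul_cancel₀ h3

/-- The partial sum of the asymptotic expansion of the Gaussian average of `h`. -/
def gaussSeries (b σ : ℝ) (h : ℂ → ℂ) (y₀ : ℂ) (J : ℕ) : ℂ :=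
  ∑ j ∈ Finset.range (J + 1), (b * tilt σ ^ 2) ^ j / j.factorial * iteratedDeriv (2 * j) h y₀

theorem reducible_eq_gaussSeries {m : ℕ} (hm : 0 < m) {n : ℤ} (hn : n ≠ 0) {K : ℕ} (hK : 0 < K)
    {h : ℂ → ℂ} {x : ℝ} {y₁ : ℂ} {U : Set ℂ} (hU : IsOpen U) (hd : DifferentiableOn ℂ h U)
    (hx : 2 * Complex.I * width m n K * x ∈ U)
    (hh : ∀ y ∈ U, y ≠ y₁ → h y = kern m n.natAbs y) (J : ℕ) :
    reducible m n K J x = ((√(2 / (K : ℝ)) : ℝ) : ℂ) / Complex.I * twoLoopPhase m n K *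
      gaussSeries (width m n K) (rsign n) h (2 * Complex.I * width m n K * x) J := by
  have hcont : Continuous fun y : ℝ => 2 * Complex.I * width m n K * (y : ℂ) := by fun_prop
  have hF : ∀ᶠ y : ℝ in 𝓝 x, ((reducibleKernel m n K y : ℝ) : ℂ) =
      -Complex.I * h (2 * Complex.I * width m n K * y) := by
    filter_upwards [hcont.continuousAt.eventually (hU.mem_nhds hx)] with y hy
    refine reducibleKernel_eq hm hn hK (hd.differentiableAt (hU.mem_nhds hy)).continuousAt ?_
      (y₁ := y₁)
    filter_upwards [hU.mem_nhds hy] with z hz using hh z hz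
  have hder : ∀ j : ℕ, ((iteratedDeriv (2 * j) (reducibleKernel m n K) x : ℝ) : ℂ) =
      -Complex.I * ((2 * Complex.I * width m n K) ^ (2 * j) *
        iteratedDeriv (2 * j) h (2 * Complex.I * width m n K * x)) := fun j => by
    have h1 := (iteratedDeriv_comp_line hU hd hx hF (2 * j)).self_of_nhds
    rwa [iteratedDeriv_ofReal_comp] at h1
  rw [reducible, gaussSeries]
  simp only [hder, series_coeff hn hm hK]
  rw [← Finset.mul_sum]; ring

/-- The compensating term of T_J is the one used for the contour integral: the centre lies at δ₀ =
2bγ above the pole, so ν = σδ₀/(2b) is sign(n) γ. -/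
theorem criticalKernel_quotient_eq {m : ℕ} (hm : 0 < m) {n : ℤ} (hn : n ≠ 0) {K : ℕ} (hK : 0 < K)
    (l : ℕ) (γ y : ℝ) (hy : y ≠ 0) :
    ((Real.sin (π * ((n.sign * l : ℤ) / m + n / K * y)) *
        Real.sin (π * ((n.sign * l : ℤ) / n + m / K * y)) /
        Real.sin (π / K * (m * n) * y) : ℝ) : ℂ) -
      ((K / π * (Real.sin (π * (n.sign * l : ℤ) / m) * Real.sin (π * (n.sign * l : ℤ) / n)) /
        (m * n * y) : ℝ) : ℂ) *
        Complex.exp (-(Complex.I * (π / K * (m * n) * y * γ : ℝ))) =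
      -Complex.I * kernFull m n.natAbs l (rsign n * γ) (2 * Complex.I * width m n K * y) := by
  have hm0 : (m : ℂ) ≠ 0 := by exact_mod_cast hm.ne'
  have hmr : (m : ℝ) ≠ 0 := by exact_mod_cast hm.ne'
  have hKr : (K : ℝ) ≠ 0 := by exact_mod_cast hK.ne'
  have hp0 : (n.natAbs : ℂ) ≠ 0 := by exact_mod_cast (Int.natAbs_pos.mpr hn).ne'
  have hpr : (n.natAbs : ℝ) ≠ 0 := by exact_mod_cast (Int.natAbs_pos.mpr hn).ne'
  have hr2 := rsign_mul_self hn
  have hr0 : rsign n ≠ 0 := left_ne_zero_of_mul_eq_one hr2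
  have hs : ((n.sign * l : ℤ) : ℝ) = rsign n * l := by rw [rsign]; push_cast; ring
  have hn' : (n : ℝ) = rsign n * n.natAbs := (rsign_mul_natAbs n).symm
  have hu : (2 * Complex.I * width m n K * y : ℂ) ≠ 0 :=
    mul_ne_zero (width_ne_zero hm hn hK) (by exact_mod_cast hy)
  have h := kernNum_div_sinh_eq m n.natAbs l (rsign n * γ) hu
  have h' := eq_sub_of_add_eq h.symm
  set X₁ : ℝ := π * l / m + π / K * n.natAbs * y with hX₁
  set X₂ : ℝ := π * l / n.natAbs + π / K * m * y with hX₂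
  set X₃ : ℝ := π / K * (m * n.natAbs) * y with hX₃
  have hX₃0 : X₃ ≠ 0 := by
    have := Real.pi_ne_zero
    positivity
  have hu3 : (2 * Complex.I * width m n K * y : ℂ) = Complex.I * X₃ := by
    rw [hX₃, ← two_mul_width]; push_cast; ring
  have e1 : (Complex.I * π * (l : ℤ) + Complex.I * X₃) / m = Complex.I * (X₁ : ℝ) := by
    rw [hX₁, hX₃]; push_cast; field_simp
  have e2 : (Complex.I * π * (l : ℤ) + Complex.I * X₃) / n.natAbs = Complex.I * (X₂ : ℝ) := by
    rw [hX₂, hX₃]; push_cast; field_simp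
  have e3 : Real.sin (π * ((n.sign * l : ℤ) / m + n / K * y)) = rsign n * Real.sin X₁ := by
    rw [← sin_rsign_mul hn, hs, hn']; congr 1; rw [hX₁]; ring
  have e4 : Real.sin (π * ((n.sign * l : ℤ) / n + m / K * y)) = Real.sin X₂ := by
    rw [hs, hn', mul_div_mul_left _ _ hr0]; congr 1; rw [hX₂]; ring
  have e5 : Real.sin (π / K * (m * n) * y) = rsign n * Real.sin X₃ := by
    rw [← sin_rsign_mul hn, hn']; congr 1; rw [hX₃]; ring
  have e6 : kernNum m n.natAbs l (2 * Complex.I * width m n K * y) =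
      -((Real.sin X₁ * Real.sin X₂ : ℝ) : ℂ) := by
    rw [kernNum, hu3, e1, e2, sinh_I_mul_ofReal, sinh_I_mul_ofReal]
    push_cast
    linear_combination (Complex.sin X₁ * Complex.sin X₂) * Complex.I_sq
  have e7 : Complex.I * ((π / K * (m * n) * y * γ : ℝ) : ℂ) =
      ((rsign n * γ : ℝ) : ℂ) * (Complex.I * X₃) := by
    have := congrArg Complex.ofReal hn'
    push_cast at this
    rw [hX₃]; push_cast; rw [this]; ring
  set A := Real.sin (π * (n.sign * l : ℤ) / m) * Real.sin (π * (n.sign * l : ℤ) / n) with hA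
  have e8 : K / π * A / (m * n * y) = A * rsign n / X₃ := by
    have := Real.pi_ne_zero
    have h9 : K / π * A / (m * n * y) = A / (rsign n * X₃) := by
      rw [hn', hX₃]; field_simp
    rw [h9, div_eq_div_iff (mul_ne_zero hr0 hX₃0) hX₃0]
    linear_combination (-(A * X₃)) * hr2
  rw [h', e6, kernNum_zero_eq m hn, ← hA, hu3, sinh_I_mul_ofReal, e3, e4, e5, e7, e8,
    mul_assoc (rsign n), mul_div_mul_left _ _ hr0]
  have hXc : (X₃ : ℂ) ≠ 0 := by exact_mod_cast hX₃0
  push_cast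
  have hI := Complex.I_sq
  have h10 : Complex.I * (Complex.sin X₁ * Complex.sin X₂ / (Complex.I * Complex.sin X₃)) =
      Complex.sin X₁ * Complex.sin X₂ / Complex.sin X₃ := by
    rw [← mul_div_assoc, mul_div_mul_left _ _ Complex.I_ne_zero]
  have h11 : Complex.I * (Complex.exp (-(rsign n * γ * (Complex.I * X₃))) / (Complex.I * X₃)) =
      Complex.exp (-(rsign n * γ * (Complex.I * X₃))) / X₃ := by
    rw [← mul_div_assoc, mul_div_mul_left _ _ Complex.I_ne_zero]
  rw [← h10]
  linear_combination (rsign n * A : ℂ) * h11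

theorem abs_height_two_I_width {m : ℕ} {n : ℤ} (K : ℕ) (σ y : ℝ) :
    height σ (2 * Complex.I * width m n K * y) = 2 * width m n K * y := by
  rw [show (2 * Complex.I * width m n K * y : ℂ) =
    Complex.I * ((2 * width m n K * y : ℝ) : ℂ) by push_cast; ring, height_I_mul]

/-- At y = 0 the quotient identity is not available; the value there is a limit, and `kernFull` is
continuous. -/
theorem criticalKernel_eq {m : ℕ} (hm : 0 < m) {n : ℤ} (hn : n ≠ 0) {K : ℕ} (hK : 0 < K)
    (l : ℕ) (γ : ℝ) {y : ℝ} (hy : |2 * width m n K * y| < π) :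
    criticalKernel m n K (n.sign * l) γ y =
      -Complex.I * kernFull m n.natAbs l (rsign n * γ) (2 * Complex.I * width m n K * y) := by
  have hcont : Continuous fun y : ℝ => 2 * Complex.I * width m n K * (y : ℂ) := by fun_prop
  have hc := (differentiableAt_kernFull m n.natAbs l (rsign n * γ) (σ := 1)
    (u := 2 * Complex.I * width m n K * y) (by rwa [abs_height_two_I_width])).continuousAt
  refine contExt_eq ?_
  have h1 := ((hc.comp (f := fun y : ℝ => 2 * Complex.I * width m n K * (y : ℂ))
      hcont.continuousAt).tendsto.const_mul (-Complex.I)).mono_left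
      (nhdsWithin_le_nhds (s := {y}ᶜ))
  refine h1.congr' ?_
  have hne : ∀ᶠ z : ℝ in 𝓝[≠] y, z ≠ 0 := by
    filter_upwards [eventually_line_ne one_ne_zero 0 y] with z hz h0
    exact hz (by simp [h0])
  filter_upwards [hne] with z hz
  exact (criticalKernel_quotient_eq hm hn hK l γ z hz).symm

theorem iteratedDeriv_criticalKernel {m : ℕ} (hm : 0 < m) {n : ℤ} (hn : n ≠ 0) {K : ℕ}
    (hK : 0 < K) (l : ℕ) (γ : ℝ) {y : ℝ} (hy : |2 * width m n K * y| < π) (j : ℕ) :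
    iteratedDeriv j (criticalKernel m n K (n.sign * l) γ) y =
      -Complex.I * ((2 * Complex.I * width m n K) ^ j *
        iteratedDeriv j (kernFull m n.natAbs l (rsign n * γ)) (2 * Complex.I * width m n K * y)) := by
  refine (iteratedDeriv_comp_line (isOpen_strip 1 π) (fun u hu =>
    (differentiableAt_kernFull m n.natAbs l (rsign n * γ) hu).differentiableWithinAt) ?_ ?_
    j).self_of_nhds
  · show |_| < π
    rwa [abs_height_two_I_width]
  · have : ∀ᶠ z : ℝ in 𝓝 y, |2 * width m n K * z| < π :=
      ((by fun_prop : Continuous fun z : ℝ => |2 * width m n K * z|).continuousAt).eventually_lt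
        continuousAt_const hy
    filter_upwards [this] with z hz using criticalKernel_eq hm hn hK l γ hz

theorem critical_eq {m : ℕ} (hm : 0 < m) {n : ℤ} (hn : n ≠ 0) {K : ℕ}
    (hK : 0 < K) (l J : ℕ) (γ : ℝ) (hγ : |2 * width m n K * γ| < π) :
    critical m n K J (n.sign * l) γ = ((√(2 / (K : ℝ)) : ℝ) : ℂ) / Complex.I *
      twoLoopPhase m n K * ((-1) ^ l * (kernNum m n.natAbs l 0 *
        halfJump (width m n K) (rsign n) (2 * width m n K * γ) +
        gaussSeries (width m n K) (rsign n) (kernFull m n.natAbs l (rsign n * γ))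
          (2 * Complex.I * width m n K * γ) J)) := by
  have h := sqrt_div_I_mul_halfJump hm hn hK (2 * width m n K * γ)
  have hσ2 : (rsign n : ℂ) * rsign n = 1 := by exact_mod_cast rsign_mul_self hn
  have hb := (width_pos hm hn hK).ne'
  have e : rsign n * (2 * width m n K * γ) ^ 2 / (4 * width m n K) =
      π / (2 * K) * (m * n) * γ ^ 2 := by
    have : rsign n * (2 * width m n K * γ) ^ 2 / (4 * width m n K) =
      rsign n * width m n K * γ ^ 2 := by field_simp; ring
    rw [this, width, ← rsign_mul_natAbs n]; ring
  rw [e] at h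
  rw [critical, exp_sign_mul hm, exp_pi_mul_sign_mul hn, kernNum_zero_eq m hn]
  simp only [iteratedDeriv_criticalKernel hm hn hK l γ hγ, series_coeff hn hm hK]
  rw [← Finset.mul_sum, ← gaussSeries]
  set E := Complex.exp (-(Complex.I * ((π / (2 * K) * (m * n) * γ ^ 2 : ℝ) : ℂ)))
  set A := Real.sin (π * (n.sign * l : ℤ) / m) * Real.sin (π * (n.sign * l : ℤ) / n)
  push_cast
  linear_combination (twoLoopPhase m n K * (-1) ^ l * (rsign n * (A : ℂ))) * h -
    (twoLoopPhase m n K * (-1) ^ l * A * Complex.I * tilt (rsign n) /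
      (√|(m * n : ℝ)| : ℝ) * E) * hσ2

/-! ### The limit in which the ratio of colour and level is fixed -/

theorem abs_height_le {σ : ℝ} (hσ : σ = 1 ∨ σ = -1) (z : ℂ) : |height σ z| ≤ 2 * ‖z‖ := by
  have h2 := Complex.abs_re_le_norm z
  have h3 := Complex.abs_im_le_norm z
  rw [height]
  refine (abs_sub _ _).trans ?_
  rw [abs_mul]
  rcases hσ with rfl | rfl <;> norm_num <;> linarith

theorem height_sub (σ : ℝ) (y z : ℂ) : height σ (y - z) = height σ y - height σ z := by
  simp [height]; ring

/-- The remainder of the asymptotic expansion of the Gaussian average of a function that is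
holomorphic and grows at most exponentially in a tilted strip. -/
theorem norm_gavg_sub_gaussSeries_le {h : ℂ → ℂ} {σ δ₀ ρ M B b β : ℝ} (hσ : σ = 1 ∨ σ = -1)
    (hb : 0 < b) (hρ : 0 < ρ) (hB : 0 ≤ B) (hM0 : 0 ≤ M)
    (hd : ∀ y, |height σ y - δ₀| ≤ 2 * ρ → DifferentiableAt ℂ h y)
    (hM : ∀ y, |height σ y - δ₀| ≤ 2 * ρ → ‖h y‖ ≤ M * Real.exp (B * |y.re|))
    (hβ : B * √b ≤ β) (J : ℕ) :
    ‖gavg b (fun r => h (Complex.I * δ₀ + tilt σ * r)) -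
        gaussSeries b σ h (Complex.I * δ₀) J‖ ≤
      (2 * J + 4) * (4 / ρ) ^ (2 * J + 2) * (M * Real.exp (B * ρ)) * b ^ (J + 1) *
        gaussMoment (2 * J + 2) β := by
  -- The height can change by twice the distance, which is why the strip has half-width 2ρ for
  -- Taylor discs of radius ρ.
  have hball : ∀ y ∈ Metric.ball (Complex.I * (δ₀ : ℂ)) ρ, |height σ y - δ₀| ≤ 2 * ρ := by
    intro y hy
    rw [mem_ball_iff_norm] at hy
    have := abs_height_le hσ (y - Complex.I * δ₀)
    rw [height_sub, height_I_mul] at this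
    linarith
  have hline : ∀ r : ℝ, |height σ (linePt σ δ₀ r) - δ₀| ≤ 2 * ρ := fun r => by
    rw [height_linePt hσ, sub_self, abs_zero]; positivity
  refine norm_gavg_sub_le hb (norm_tilt σ) hρ
    (fun y hy => (hd y (hball y hy)).differentiableWithinAt) (fun y hy => ?_) hB hβ ?_
    (fun r => ?_) J
  · refine (hM y (hball y hy)).trans (mul_le_mul_of_nonneg_left (Real.exp_le_exp.mpr ?_) hM0)
    refine mul_le_mul_of_nonneg_left ?_ hB
    rw [mem_ball_iff_norm] at hy
    have := Complex.abs_re_le_norm (y - Complex.I * δ₀)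
    simp at this
    linarith
  · refine continuous_iff_continuousAt.mpr fun r => ?_
    have h1 : ContinuousAt h (linePt σ δ₀ r) := (hd _ (hline r)).continuousAt
    exact h1.comp (continuous_linePt σ δ₀).continuousAt
  · refine (hM _ (hline r)).trans ?_
    have h1 := abs_re_linePt_le hσ δ₀ r
    have h2 : 1 ≤ Real.exp (B * ρ) := Real.one_le_exp (by positivity)
    calc M * Real.exp (B * |(linePt σ δ₀ r).re|) ≤ M * Real.exp (B * |r|) := by gcongr
      _ ≤ M * Real.exp (B * ρ) * Real.exp (B * |r|) := by
        gcongr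
        exact le_mul_of_one_le_right hM0 h2

theorem norm_twoLoopPhase (m : ℕ) (n : ℤ) (K : ℕ) : ‖twoLoopPhase m n K‖ = 1 := by
  rw [twoLoopPhase, show Complex.I * π / (2 * K) *
    (((m : ℂ) ^ 2 * (n : ℂ) ^ 2 - (m : ℂ) ^ 2 - (n : ℂ) ^ 2) / ((m : ℂ) * (n : ℂ))) =
    ((π / (2 * K) * (((m : ℝ) ^ 2 * (n : ℝ) ^ 2 - (m : ℝ) ^ 2 - (n : ℝ) ^ 2) /
      ((m : ℝ) * (n : ℝ))) : ℝ) : ℂ) * Complex.I by push_cast; ring,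
    Complex.norm_exp_ofReal_mul_I]

theorem norm_prefactor_mul (m : ℕ) (n : ℤ) (K : ℕ) (z : ℂ) :
    ‖((√(2 / (K : ℝ)) : ℝ) : ℂ) / Complex.I * twoLoopPhase m n K * z‖ = √(2 / K) * ‖z‖ := by
  rw [norm_mul, norm_mul, norm_twoLoopPhase, norm_div, Complex.norm_I, Complex.norm_real,
    Real.norm_of_nonneg (Real.sqrt_nonneg _)]
  ring

theorem sqrt_mul_width_pow (m : ℕ) (n : ℤ) {K : ℕ} (hK : 0 < K) (J : ℕ) :
    √(2 / K) * width m n K ^ (J + 1) =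
      √2 * (π * m * n.natAbs / 2) ^ (J + 1) * (K : ℝ) ^ (-(J : ℝ) - 3 / 2) := by
  have hK0 : (0 : ℝ) < K := by exact_mod_cast hK
  have h1 : width m n K ^ (J + 1) = (π * m * n.natAbs / 2) ^ (J + 1) * ((K : ℝ) ^ (J + 1))⁻¹ := by
    rw [width, ← inv_pow, ← mul_pow]; congr 1; field_simp
  have h2 : (K : ℝ) ^ (-(J : ℝ) - 3 / 2) = (√K)⁻¹ * ((K : ℝ) ^ (J + 1))⁻¹ := by
    rw [Real.sqrt_eq_rpow, ← Real.rpow_natCast, ← Real.rpow_neg hK0.le, ← Real.rpow_neg hK0.le,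
      ← Real.rpow_add hK0]
    congr 1; push_cast; ring
  rw [h1, h2, Real.sqrt_div two_pos.le]
  ring

theorem sqrt_width_le {m : ℕ} {n : ℤ} {K : ℕ} (hK : 0 < K) :
    √(width m n K) ≤ √(π * m * n.natAbs / 2) := by
  have hK1 : (1 : ℝ) ≤ K := by exact_mod_cast hK
  refine Real.sqrt_le_sqrt ?_
  rw [width, ← div_div]
  have := Real.pi_pos
  exact div_le_self (by positivity) hK1

theorem kern_eq_kernNum_div (m p : ℕ) (y : ℂ) :
    kern m p y = kernNum m p 0 y / Complex.sinh y := by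
  simpa using kern_eq m p 0 y

theorem differentiableAt_kern {m p : ℕ} {y : ℂ} (hy : Complex.sinh y ≠ 0) :
    DifferentiableAt ℂ (kern m p) y := by
  unfold kern
  fun_prop (disch := exact hy)

theorem sinh_ne_zero_of_height {σ : ℝ} {l : ℕ} {y : ℂ} (h1 : π * l < height σ y)
    (h2 : height σ y < π * (l + 1)) : Complex.sinh y ≠ 0 := by
  intro h
  obtain ⟨k, rfl⟩ := exists_eq_of_sinh_eq_zero h
  rw [show Complex.I * π * k = Complex.I * ((π * k : ℝ) : ℂ) by push_cast; ring,
    height_I_mul] at h1 h2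
  have h3 := lt_of_mul_lt_mul_left h1 Real.pi_pos.le
  have h4 := lt_of_mul_lt_mul_left h2 Real.pi_pos.le
  have h5 : (l : ℤ) < k := by exact_mod_cast h3
  have h6 : k < l + 1 := by exact_mod_cast h4
  omega

theorem exp_two_pi_mul_zpow_eq_one_iff (a : ℝ) (e : ℤ) :
    Complex.exp (2 * π * Complex.I * a) ^ e = 1 ↔ ∃ k : ℤ, e * a = k := by
  rw [← Complex.exp_int_mul, Complex.exp_eq_one_iff]
  have hpi : (2 * π * Complex.I : ℂ) ≠ 0 := Complex.two_pi_I_ne_zero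
  refine exists_congr fun k => ?_
  rw [show (e : ℂ) * (2 * π * Complex.I * a) = (e * a : ℂ) * (2 * π * Complex.I) by ring]
  constructor
  · intro h
    have := mul_right_cancel₀ hpi h
    exact_mod_cast this
  · intro h
    have h' : ((e * a : ℝ) : ℂ) = ((k : ℝ) : ℂ) := congrArg _ h
    push_cast at h'
    rw [h']

/-- As m|n|a is an integer, t = exp(2πia) satisfies t^{mn} = 1. If it is no zero of the Alexander
polynomial, then t^m = 1 or tⁿ = 1, so |n| or m divides l and one of the two sinh factors vanishes.
-/
theorem kernNum_eq_zero_of_alexander_ne_zero {m : ℕ} (hm : 0 < m) {n : ℤ} (hn : n ≠ 0)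
    (hmn : IsCoprime (m : ℤ) n) {a : ℝ}
    (hal : alexander m (BraidWord.torus m n) (Complex.exp (2 * π * Complex.I * a)) ≠ 0) {l : ℕ}
    (hl : m * n.natAbs * a = l) : kernNum m n.natAbs l 0 = 0 := by
  obtain ⟨M, rfl⟩ := Nat.exists_eq_succ_of_ne_zero hm.ne'
  have hm0 : ((M.succ : ℕ) : ℝ) ≠ 0 := by exact_mod_cast hm.ne'
  have hp0 : (n.natAbs : ℝ) ≠ 0 := by exact_mod_cast (Int.natAbs_pos.mpr hn).ne'
  have hn' : (n : ℝ) = rsign n * n.natAbs := (rsign_mul_natAbs n).symm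
  have hpow := exp_two_pi_mul_zpow_eq_one_iff a
  have h := mt (alexander_torus_eq_zero_iff (M := M) (Complex.exp_ne_zero _) hn hmn).mpr hal
  have hsin : ∀ k : ℤ, Complex.sinh (Complex.I * ((π * k : ℝ) : ℂ)) = 0 := fun k => by
    rw [sinh_I_mul_ofReal, mul_comm π, Real.sin_int_mul_pi]; simp
  have hs : ((n.sign : ℤ) : ℝ) = rsign n := rfl
  have h1 : Complex.exp (2 * π * Complex.I * a) ^ (((M + 1 : ℕ) : ℤ) * n) = 1 := by
    rw [hpow]
    refine ⟨n.sign * l, ?_⟩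
    push_cast
    rw [hs, ← hl, hn']; push_cast; ring
  have h2 : Complex.exp (2 * π * Complex.I * a) ^ (M + 1) = 1 ∨
      Complex.exp (2 * π * Complex.I * a) ^ n = 1 := by
    by_contra! hc
    exact h ⟨h1, hc.1, hc.2⟩
  rw [kernNum, mul_eq_zero]
  rcases h2 with h2 | h2
  · right
    rw [← zpow_natCast, hpow] at h2
    obtain ⟨k, hk⟩ := h2
    have : Complex.I * π * (l : ℤ) + 0 = Complex.I * ((π * k : ℝ) : ℂ) * n.natAbs := by
      have hk' : (l : ℝ) = k * n.natAbs := by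
        rw [← hl, ← hk]; push_cast; ring
      have := congrArg Complex.ofReal hk'
      push_cast at this ⊢
      rw [this]; ring
    rw [this, mul_div_cancel_right₀ _ (by exact_mod_cast hp0), hsin]
  · left
    rw [hpow] at h2
    obtain ⟨k, hk⟩ := h2
    have : Complex.I * π * (l : ℤ) + 0 =
        Complex.I * ((π * (n.sign * k : ℤ) : ℝ) : ℂ) * (M.succ : ℕ) := by
      have hk' : (l : ℝ) = (n.sign * k : ℤ) * (M.succ : ℕ) := by
        push_cast
        rw [← hl, hs, ← hk, hn']
        push_cast
        linear_combination (-((M + 1 : ℝ) * n.natAbs * a)) * rsign_mul_self hn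
      have := congrArg Complex.ofReal hk'
      push_cast at this ⊢
      rw [this]; ring
    rw [this, mul_div_cancel_right₀ _ (by exact_mod_cast hm0), hsin]

/-- Away from the zeros of the Alexander polynomial, the contour integral of the kernel consists
of the contributions of the poles and a Gaussian average of a holomorphic function. -/
theorem exists_regular_part {m : ℕ} (hm : 0 < m) {n : ℤ} (hn : n ≠ 0)
    (hmn : IsCoprime (m : ℤ) n) {a : ℝ} (ha : 0 < a)
    (hal : alexander m (BraidWord.torus m n) (Complex.exp (2 * π * Complex.I * a)) ≠ 0) :
    ∃ (h : ℂ → ℂ) (ρ M : ℝ) (L : ℕ) (y₁ : ℂ), 0 < ρ ∧ 0 ≤ M ∧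
      (∀ j : ℕ, j < L ↔ (j + 1 : ℝ) < m * n.natAbs * a) ∧
      (∀ y, |height (rsign n) y - π * (m * n.natAbs * a)| ≤ 2 * ρ → DifferentiableAt ℂ h y ∧
        ‖h y‖ ≤ M * Real.exp (2 * |y.re|) ∧ (y ≠ y₁ → h y = kern m n.natAbs y)) ∧
      ∀ b : ℝ, 0 < b → lineAvg b (rsign n) (π * (m * n.natAbs * a)) (kern m n.natAbs) 0 =
        ∑ j ∈ Finset.range L, jump m n.natAbs b (rsign n) (π * (m * n.natAbs * a)) (j + 1) +
          gavg b fun r => h (Complex.I * (π * (m * n.natAbs * a) : ℝ) + tilt (rsign n) * r) := by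
  have hσ := rsign_eq hn
  have hp : 0 < n.natAbs := Int.natAbs_pos.mpr hn
  have hpi := Real.pi_pos
  set x : ℝ := m * n.natAbs * a with hx
  have hx0 : 0 < x := by
    have h1 : (0 : ℝ) < m := by exact_mod_cast hm
    have h2 : (0 : ℝ) < n.natAbs := by exact_mod_cast hp
    positivity
  set L := ⌊x⌋₊ with hL
  have hLx : (L : ℝ) ≤ x := Nat.floor_le hx0.le
  have hxL : x < L + 1 := Nat.lt_floor_add_one x
  -- Either the centre sits on a candidate pole, whose residue vanishes by the hypothesis on the
  -- Alexander polynomial, or it lies strictly between two neighbouring ones.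
  rcases hLx.eq_or_lt with he | hlt
  · obtain ⟨l, hl⟩ : ∃ l, L = l + 1 := Nat.exists_eq_succ_of_ne_zero (by
      intro h0; rw [h0] at he; simp at he; exact hx0.ne he)
    have hk := kernNum_eq_zero_of_alexander_ne_zero hm hn hmn hal (hx.symm.trans he.symm)
    rw [hl] at he hk
    obtain ⟨C, hC, hCb⟩ := exists_norm_kernReg_le hm hp ((l + 1 : ℕ) : ℤ) hσ
      (show π / 2 < π by linarith)
    have hy : ∀ y, |height (rsign n) y - π * x| ≤ 2 * (π / 4) →
        |height (rsign n) (y - Complex.I * ((π * (l + 1 : ℕ) : ℝ) : ℂ))| ≤ π / 2 := by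
      intro y h
      rw [height_sub, height_I_mul, he]; linarith
    refine ⟨fun y => (-1) ^ (l + 1) * kernReg m n.natAbs (l + 1 : ℕ)
      (y - Complex.I * ((π * (l + 1 : ℕ) : ℝ) : ℂ)), π / 4, C, l,
      Complex.I * ((π * (l + 1 : ℕ) : ℝ) : ℂ), by positivity, hC, fun j => ?_, fun y h => ⟨?_, ?_, ?_⟩,
      fun b hb => ?_⟩
    · rw [← he]; push_cast; rw [add_lt_add_iff_right, Nat.cast_lt]
    · have h1 := differentiableAt_kernReg m n.natAbs ((l + 1 : ℕ) : ℤ) (σ := rsign n)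
        ((hy y h).trans_lt (by linarith))
      have h2 := h1.comp y (f := fun y => y - Complex.I * ((π * (l + 1 : ℕ) : ℝ) : ℂ)) (by fun_prop)
      exact h2.const_mul _
    · rw [norm_mul, norm_pow, norm_neg, norm_one, one_pow, one_mul]
      refine (hCb _ (hy y h)).trans (le_of_eq ?_)
      simp
    · intro hne
      have hu : y - Complex.I * ((π * (l + 1 : ℕ) : ℝ) : ℂ) ≠ 0 := sub_ne_zero.mpr hne
      have h1 := kern_eq m n.natAbs ((l + 1 : ℕ) : ℤ) (y - Complex.I * ((π * (l + 1 : ℕ) : ℝ) : ℂ))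
      have h2 : Complex.I * π * ((l + 1 : ℕ) : ℤ) + (y - Complex.I * ((π * (l + 1 : ℕ) : ℝ) : ℂ)) =
        y := by push_cast; ring
      rw [h2] at h1
      beta_reduce
      rw [h1, kernReg_eq _ _ _ hu, hk, zero_div, sub_zero, zpow_natCast]
    -- The half jump carries the vanishing residue as a factor, and `kernFull` reduces to `kernReg`.
    -- Hence only the l poles strictly below contribute.
    · have h1 := lineAvg_kern_eq_add_halfJump hm hp hσ hb (θ₀ := π * x) l
        (by rw [← he, sub_self, abs_zero]; exact hpi)
      rw [h1, jump, hk, ← gavg_const_mul]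
      simp only [zero_mul, mul_zero, zero_div, add_zero]
      congr 2
      funext r
      rw [← he, sub_self, mul_zero, zero_div, kernFull, hk, zero_mul, add_zero]
      congr 2
      push_cast; ring
  -- The half-width 2ρ is half of the distance from the centre to the nearest pole.
  · set ρ := min (x - L) (L + 1 - x) * π / 4 with hρ
    have hmin : 0 < min (x - L) (L + 1 - x) := lt_min (by linarith) (by linarith)
    have hρ0 : 0 < ρ := by positivity
    have hle : 4 * ρ ≤ π * (x - L) ∧ 4 * ρ ≤ π * (L + 1 - x) := by
      rw [hρ]
      constructor
      · nlinarith [min_le_left (x - L) (L + 1 - x)]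
      · nlinarith [min_le_right (x - L) (L + 1 - x)]
    have hy : ∀ y, |height (rsign n) y - π * x| ≤ 2 * ρ → Complex.sinh y ≠ 0 := by
      intro y h
      rw [abs_le] at h
      exact sinh_ne_zero_of_height (σ := rsign n) (l := L) (by nlinarith) (by nlinarith)
    obtain ⟨M, hM, hMb⟩ := exists_norm_le_exp (F := kern m n.natAbs) (σ := rsign n)
      (θ₁ := π * x - 2 * ρ) (θ₂ := π * x + 2 * ρ) (C := 1) (B := 2) hσ zero_le_two
      (fun y h => (differentiableAt_kern (hy y (by
        rw [abs_le]; constructor <;> linarith [h.1, h.2]))).continuousAt.continuousWithinAt)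
      (fun y h _ => by
        rw [one_mul, kern_eq_kernNum_div]; exact norm_kernNum_div_sinh_le hm hp 0 h)
    refine ⟨kern m n.natAbs, ρ, M, L, 0, hρ0, hM, fun j => ?_, fun y h => ⟨?_, ?_, fun _ => rfl⟩,
      fun b hb => ?_⟩
    · constructor
      · intro h
        have : (j + 1 : ℝ) ≤ L := by exact_mod_cast h
        linarith
      · intro h
        have : (j : ℝ) < L := by linarith
        exact_mod_cast this
    · exact differentiableAt_kern (hy y h)
    · rw [abs_le] at h
      exact hMb y ⟨by linarith, by linarith⟩
    · rw [lineAvg_kern_eq_sum_jump hm hp hσ hb _ L (δ := π * x - π * L) (by nlinarith)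
        (by nlinarith), add_sub_cancel, lineAvg_self]

theorem norm_jonesTorus_sub_le_of_ratio {m : ℕ} (hm : 0 < m) {n : ℤ} (hn : n ≠ 0)
    (hmn : IsCoprime (m : ℤ) n) {a : ℝ} (ha : 0 < a) (ha1 : a < 1)
    (hal : alexander m (BraidWord.torus m n) (Complex.exp (2 * π * Complex.I * a)) ≠ 0) (J : ℕ) :
    ∃ C : ℝ, ∀ K α : ℕ, 0 < K → (α : ℝ) = a * K →
      ‖jonesTorus m n K α -
          (reducible m n K J α + ∑ l ∈ irreducibleLabels m n a, irreducible m n K l α)‖ ≤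
        C * (K : ℝ) ^ (-(J : ℝ) - 3 / 2) := by
  obtain ⟨h, ρ, M, L, y₁, hρ, hM, hL, hstrip, hav⟩ := exists_regular_part hm hn hmn ha hal
  have hσ := rsign_eq hn
  refine ⟨√2 * (π * m * n.natAbs / 2) ^ (J + 1) * ((2 * J + 4) * (4 / ρ) ^ (2 * J + 2) *
    (M * Real.exp (2 * ρ)) * gaussMoment (2 * J + 2) (2 * √(π * m * n.natAbs / 2))),
    fun K α hK hα => ?_⟩
  have hK0 : (0 : ℝ) < K := by exact_mod_cast hK
  have hα0 : 0 < α := by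
    have : (0 : ℝ) < α := by rw [hα]; positivity
    exact_mod_cast this
  have hαK : α < K := by
    have : (α : ℝ) < K := by rw [hα]; nlinarith
    exact_mod_cast this
  have hb := width_pos hm hn hK
  set b := width m n K with hbdef
  -- With α = aK the centre does not depend on K, so the strip, the function h and all constants are
  -- the same for all K.
  have hθ : 2 * b * α = π * (m * n.natAbs * a) := by
    rw [hbdef, two_mul_width, hα]; field_simp
  have hZ := jonesTorus_eq_lineAvg hm hn hmn hα0 hαK
  rw [← width, ← hbdef, ← rsign, hθ, hav b hb, mul_add, Finset.mul_sum] at hZ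
  have hirr : ∑ l ∈ irreducibleLabels m n a, irreducible m n K l α =
      ∑ j ∈ Finset.range L, ((√(2 / (K : ℝ)) : ℝ) : ℂ) / Complex.I * twoLoopPhase m n K *
        jump m n.natAbs b (rsign n) (π * (m * n.natAbs * a)) (j + 1) := by
    rw [sum_irreducibleLabels hm hn ha1.le L hL]
    refine Finset.sum_congr rfl fun j _ => ?_
    rw [← hθ, sqrt_div_I_mul_jump hm hn hK]
  have hy0 : 2 * Complex.I * b * (α : ℝ) = Complex.I * ((π * (m * n.natAbs * a) : ℝ) : ℂ) := by
    rw [← hθ]; push_cast; ring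
  set U : Set ℂ := {y | |height (rsign n) y - π * (m * n.natAbs * a)| < 2 * ρ}
  have hU : IsOpen U := isOpen_lt
    (continuous_abs.comp ((continuous_height (rsign n)).sub continuous_const)) continuous_const
  have hred := reducible_eq_gaussSeries hm hn hK (x := α) (y₁ := y₁) hU
    (fun y hy => ((hstrip y (le_of_lt hy)).1).differentiableWithinAt)
    (by
      rw [← hbdef, hy0]
      change |height (rsign n) _ - π * (m * n.natAbs * a)| < 2 * ρ
      rw [height_I_mul, sub_self, abs_zero]; positivity)
    (fun y hy => (hstrip y (le_of_lt hy)).2.2) J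
  rw [← hbdef, hy0] at hred
  have hcancel : ∀ A B C : ℂ, A + B - (C + A) = B - C := fun A B C => by ring
  rw [hZ, hirr, hred, hcancel, ← mul_sub, norm_prefactor_mul]
  have hrem := norm_gavg_sub_gaussSeries_le (h := h) hσ hb hρ zero_le_two hM
    (fun y hy => (hstrip y hy).1) (fun y hy => (hstrip y hy).2.1)
    (mul_le_mul_of_nonneg_left (sqrt_width_le hK) zero_le_two) J
  refine (mul_le_mul_of_nonneg_left hrem (Real.sqrt_nonneg _)).trans (le_of_eq ?_)
  have := sqrt_mul_width_pow m n hK J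
  rw [← hbdef] at this
  linear_combination ((2 * J + 4) * (4 / ρ) ^ (2 * J + 2) *
    (M * Real.exp (2 * ρ)) * gaussMoment (2 * J + 2) (2 * √(π * m * n.natAbs / 2))) * this

/-! ### The singularity of the reducible contribution -/

theorem iteratedDeriv_kern {m p : ℕ} (l k : ℕ) {σ : ℝ} {u : ℂ} (hu : u ≠ 0)
    (hh : |height σ u| < π) :
    iteratedDeriv k (kern m p) (Complex.I * π * l + u) =
      (-1) ^ l * (iteratedDeriv k (kernReg m p l) u +
        kernNum m p l 0 * ((-1) ^ k * k.factorial * u ^ (-1 - k : ℤ))) := by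
  have h1 := congrFun (iteratedDeriv_comp_const_add k (kern m p) (Complex.I * π * l)) u
  rw [← h1]
  have h2 : (fun z => kern m p (Complex.I * π * l + z)) =ᶠ[𝓝 u]
      fun z => (-1) ^ l * (kernReg m p l z + kernNum m p l 0 * z⁻¹) := by
    filter_upwards [eventually_ne_nhds hu] with z hz
    have h3 := kern_eq m p l z
    rw [zpow_natCast, Int.cast_natCast] at h3
    rw [h3, kernReg_eq _ _ _ hz]; ring
  have hreg : ContDiffAt ℂ k (kernReg m p l) u :=
    ((differentiableOn_kernReg m p l σ).analyticAt ((isOpen_strip σ π).mem_nhds hh)).contDiffAt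
  have hinv : ContDiffAt ℂ k (fun z : ℂ => z⁻¹) u := contDiffAt_inv ℂ hu
  rw [h2.iteratedDeriv_eq, iteratedDeriv_const_mul_field, iteratedDeriv_fun_add hreg
    (contDiffAt_const.mul hinv), iteratedDeriv_const_mul_field]
  congr 3
  rw [iteratedDeriv_eq_iterate]
  exact iter_deriv_inv k u

/-- The derivatives of the simple pole have orders 1, 3, …, 2J + 1, so the term j = J dominates and
nothing can cancel it: multiplied by u^{2J+1}, the series extends continuously to u = 0 with a
nonzero value. -/
theorem tendsto_norm_gaussSeries_kern {m p : ℕ} (l J : ℕ) {b σ : ℝ} (hb : b ≠ 0)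
    (hl : kernNum m p l 0 ≠ 0) :
    Tendsto (fun u => ‖gaussSeries b σ (kern m p) (Complex.I * π * l + u) J‖) (𝓝[≠] 0) atTop := by
  set c : ℕ → ℂ := fun j => (b * tilt σ ^ 2) ^ j / j.factorial * (2 * j).factorial with hc
  set Q : ℂ → ℂ := fun u => (-1) ^ l * (u ^ (2 * J + 1) * gaussSeries b σ (kernReg m p l) u J +
    kernNum m p l 0 * ∑ j ∈ Finset.range (J + 1), c j * u ^ (2 * (J - j))) with hQ
  have h0 : (0 : ℂ) ∈ {u : ℂ | |height σ u| < π} := by simp [height, Real.pi_pos]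
  have hQc : ContinuousAt Q 0 := by
    have hg : ContinuousAt (fun u => gaussSeries b σ (kernReg m p l) u J) 0 := by
      unfold gaussSeries
      refine tendsto_finsetSum _ fun j _ => ?_
      exact ((differentiableOn_kernReg m p l σ).differentiableAt_iteratedDeriv
        (isOpen_strip σ π) (2 * j) h0).continuousAt.tendsto.const_mul _
    refine ContinuousAt.mul continuousAt_const ?_
    refine ContinuousAt.add (ContinuousAt.mul (by fun_prop) hg) (by fun_prop)
  have hQ0 : Q 0 ≠ 0 := by
    have : ∑ j ∈ Finset.range (J + 1), c j * (0 : ℂ) ^ (2 * (J - j)) = c J := by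
      rw [Finset.sum_range_succ, Finset.sum_eq_zero, Nat.sub_self, mul_zero, pow_zero, mul_one,
        zero_add]
      intro j hj
      rw [zero_pow, mul_zero]
      have := Finset.mem_range.mp hj
      omega
    simp only [hQ, this]
    rw [zero_pow (by omega), zero_mul, zero_add]
    have hcJ : c J ≠ 0 := by
      refine mul_ne_zero (div_ne_zero (pow_ne_zero _ (mul_ne_zero ?_ (pow_ne_zero _
        (tilt_ne_zero σ)))) ?_) ?_
      · exact_mod_cast hb
      · exact_mod_cast J.factorial_ne_zero
      · exact_mod_cast (2 * J).factorial_ne_zero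
    exact mul_ne_zero (pow_ne_zero _ (by norm_num)) (mul_ne_zero hl hcJ)
  have hlim : Tendsto (fun u => ‖Q u‖ * (‖u‖ ^ (2 * J + 1))⁻¹) (𝓝[≠] 0) atTop := by
    refine Tendsto.pos_mul_atTop (norm_pos_iff.mpr hQ0)
      (hQc.norm.tendsto.mono_left nhdsWithin_le_nhds) ?_
    refine tendsto_inv_nhdsGT_zero.comp (tendsto_nhdsWithin_iff.mpr ⟨?_, ?_⟩)
    · have : Tendsto (fun u : ℂ => ‖u‖ ^ (2 * J + 1)) (𝓝 0) (𝓝 (‖(0 : ℂ)‖ ^ (2 * J + 1))) :=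
        (by fun_prop : Continuous fun u : ℂ => ‖u‖ ^ (2 * J + 1)).tendsto 0
      rw [norm_zero, zero_pow (by omega)] at this
      exact this.mono_left nhdsWithin_le_nhds
    · filter_upwards [self_mem_nhdsWithin] with u hu
      exact pow_pos (norm_pos_iff.mpr hu) _
  refine hlim.congr' ?_
  filter_upwards [self_mem_nhdsWithin, nhdsWithin_le_nhds ((isOpen_strip σ π).mem_nhds h0)]
    with u hu hh
  have hu0 : u ≠ 0 := hu
  have key : gaussSeries b σ (kern m p) (Complex.I * π * l + u) J * u ^ (2 * J + 1) = Q u := by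
    simp only [hQ, gaussSeries, iteratedDeriv_kern l _ hu0 hh]
    rw [mul_comm (u ^ (2 * J + 1)), Finset.sum_mul, Finset.sum_mul, Finset.mul_sum,
      ← Finset.sum_add_distrib, Finset.mul_sum]
    refine Finset.sum_congr rfl fun j hj => ?_
    have hj' : j ≤ J := by have := Finset.mem_range.mp hj; omega
    have e : u ^ (-1 - ((2 * j : ℕ) : ℤ)) * u ^ (2 * J + 1) = u ^ (2 * (J - j)) := by
      rw [← zpow_natCast u (2 * J + 1), ← zpow_add₀ hu0, ← zpow_natCast]
      congr 1; push_cast [hj']; ring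
    rw [← e, pow_mul, neg_one_sq, one_pow, hc]
    ring
  rw [← key, norm_mul, norm_pow, mul_inv_cancel_right₀ (pow_ne_zero _ (norm_ne_zero_iff.mpr hu0))]

/-- The condition t^{mn} = 1 makes m|n|a an integer l. If a sinh factor vanished at iπl, then m or
|n| would divide l, forcing tⁿ = 1 or t^m = 1 respectively. -/
theorem exists_pole_of_alexander_eq_zero {m : ℕ} (hm : 0 < m) {n : ℤ} (hn : n ≠ 0)
    (hmn : IsCoprime (m : ℤ) n) {a : ℝ} (ha : 0 < a)
    (hal : alexander m (BraidWord.torus m n) (Complex.exp (2 * π * Complex.I * a)) = 0) :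
    ∃ l : ℕ, 0 < l ∧ m * n.natAbs * a = l ∧ kernNum m n.natAbs l 0 ≠ 0 := by
  obtain ⟨M, rfl⟩ := Nat.exists_eq_succ_of_ne_zero hm.ne'
  have hp : 0 < n.natAbs := Int.natAbs_pos.mpr hn
  have hm0 : (0 : ℝ) < (M.succ : ℕ) := by exact_mod_cast hm
  have hp0 : (0 : ℝ) < n.natAbs := by exact_mod_cast hp
  have hn' : (n : ℝ) = rsign n * n.natAbs := (rsign_mul_natAbs n).symm
  obtain ⟨h1, h2, h3⟩ := (alexander_torus_eq_zero_iff (M := M) (Complex.exp_ne_zero _) hn hmn).mp hal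
  rw [exp_two_pi_mul_zpow_eq_one_iff] at h1
  rw [← zpow_natCast, Ne, exp_two_pi_mul_zpow_eq_one_iff] at h2
  rw [Ne, exp_two_pi_mul_zpow_eq_one_iff] at h3
  obtain ⟨k, hk⟩ := h1
  have hs : ((n.sign : ℤ) : ℝ) = rsign n := rfl
  have hka : ((n.sign * k : ℤ) : ℝ) = (M.succ : ℕ) * n.natAbs * a := by
    push_cast at hk ⊢
    rw [hs, ← hk, hn']
    linear_combination ((M + 1 : ℝ) * n.natAbs * a) * rsign_mul_self hn
  have hkpos : 0 < n.sign * k := by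
    have : (0 : ℝ) < ((n.sign * k : ℤ) : ℝ) := by rw [hka]; positivity
    exact_mod_cast this
  obtain ⟨l, hl⟩ := Int.eq_ofNat_of_zero_le hkpos.le
  have hla : ((M.succ : ℕ) : ℝ) * n.natAbs * a = l := by rw [← hka, hl, Int.cast_natCast]
  refine ⟨l, by omega, hla, ?_⟩
  have hne : ∀ q : ℕ, 0 < q → (∀ j : ℤ, (l : ℝ) ≠ j * q) →
      Complex.sinh ((Complex.I * π * (l : ℤ) + 0) / q) ≠ 0 := by
    intro q hq hj h0
    have hq0 : (q : ℂ) ≠ 0 := by exact_mod_cast hq.ne'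
    have hpi : (π : ℂ) ≠ 0 := by exact_mod_cast Real.pi_ne_zero
    obtain ⟨j, hj'⟩ := exists_eq_of_sinh_eq_zero h0
    apply hj j
    rw [div_eq_iff hq0, add_zero, mul_assoc (Complex.I * π)] at hj'
    have := mul_left_cancel₀ (mul_ne_zero Complex.I_ne_zero hpi) hj'
    exact_mod_cast this
  refine mul_ne_zero (hne _ hm fun j hj => h3 ⟨n.sign * j, ?_⟩) (hne _ hp fun j hj => h2 ⟨j, ?_⟩)
  · have : n.natAbs * a = j := by
      rw [hj] at hla
      have : ((M.succ : ℕ) : ℝ) * (n.natAbs * a) = (M.succ : ℕ) * j := by rw [← mul_assoc, hla]; ring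
      exact mul_left_cancel₀ hm0.ne' this
    push_cast
    rw [hs, ← this, hn']; ring
  · rw [hj] at hla
    have : (n.natAbs : ℝ) * ((M.succ : ℕ) * a) = n.natAbs * j := by linarith
    have := mul_left_cancel₀ hp0.ne' this
    push_cast at this ⊢
    exact this

theorem reducible_singular {m : ℕ} (hm : 0 < m) {n : ℤ} (hn : n ≠ 0)
    (hmn : IsCoprime (m : ℤ) n) {a : ℝ} (ha : 0 < a)
    (hal : alexander m (BraidWord.torus m n) (Complex.exp (2 * π * Complex.I * a)) = 0) :
    (∃ l₀ : ℤ, a = l₀ / (m * n)) ∧ ∀ K J : ℕ, 0 < K →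
      Tendsto (fun x : ℝ => ‖reducible m n K J x‖) (𝓝[≠] (K * a)) atTop := by
  obtain ⟨l, hl0, hla, hker⟩ := exists_pole_of_alexander_eq_zero hm hn hmn ha hal
  have hm0 : (m : ℝ) ≠ 0 := by exact_mod_cast hm.ne'
  have hn0 : (n : ℝ) ≠ 0 := by exact_mod_cast hn
  have hn' : (n : ℝ) = rsign n * n.natAbs := (rsign_mul_natAbs n).symm
  refine ⟨⟨n.sign * l, ?_⟩, fun K J hK => ?_⟩
  · have hs : ((n.sign : ℤ) : ℝ) = rsign n := rfl
    rw [eq_div_iff (mul_ne_zero hm0 hn0)]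
    push_cast
    rw [hs, ← hla, hn']; ring
  · have hK0 : (0 : ℝ) < K := by exact_mod_cast hK
    have hb := width_pos hm hn hK
    have hlim : Tendsto (fun x : ℝ => 2 * Complex.I * width m n K * x - Complex.I * π * l)
        (𝓝[≠] (K * a)) (𝓝[≠] 0) := by
      have h0 : 2 * Complex.I * width m n K * ((K * a : ℝ) : ℂ) = Complex.I * π * l := by
        have : 2 * width m n K * (K * a) = π * l := by
          rw [two_mul_width, ← hla]; field_simp
        have := congrArg Complex.ofReal this
        push_cast at this ⊢
        linear_combination Complex.I * this
      refine tendsto_nhdsWithin_iff.mpr ⟨?_, ?_⟩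
      · have hc : Continuous fun x : ℝ => 2 * Complex.I * width m n K * (x : ℂ) - Complex.I * π * l := by
          fun_prop
        have := hc.tendsto (K * a)
        rw [h0, sub_self] at this
        exact this.mono_left nhdsWithin_le_nhds
      · filter_upwards [eventually_line_ne (width_ne_zero hm hn hK) (Complex.I * π * l) (K * a)]
          with x hx
        exact sub_ne_zero.mpr hx
    have h1 := (tendsto_norm_gaussSeries_kern l J (σ := rsign n) hb.ne' hker).comp hlim
    have h2 : Tendsto (fun x : ℝ => √(2 / (K : ℝ)) * ‖gaussSeries (width m n K) (rsign n)
        (kern m n.natAbs) (2 * Complex.I * width m n K * x) J‖) (𝓝[≠] (K * a)) atTop := by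
      refine Tendsto.const_mul_atTop (Real.sqrt_pos.mpr (by positivity)) ?_
      simpa [Function.comp_def] using h1
    refine h2.congr' ?_
    set U : Set ℂ := {y | Complex.sinh y ≠ 0}
    have hU : IsOpen U := isOpen_ne_fun (by fun_prop) continuous_const
    have hev : ∀ᶠ u in 𝓝[≠] (0 : ℂ), Complex.I * π * l + u ∈ U := by
      have h0 : (0 : ℂ) ∈ {u : ℂ | |height 1 u| < π} := by simp [height, Real.pi_pos]
      filter_upwards [self_mem_nhdsWithin, nhdsWithin_le_nhds ((isOpen_strip 1 π).mem_nhds h0)]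
        with u hu hh h3
      have h4 := sinh_add_int_mul_pi l u
      rw [Int.cast_natCast, h3, zpow_natCast] at h4
      exact hu (eq_zero_of_sinh_eq_zero (by simpa using h4.symm) hh)
    filter_upwards [hlim.eventually hev] with x hx
    rw [add_sub_cancel] at hx
    rw [reducible_eq_gaussSeries hm hn hK (h := kern m n.natAbs) (y₁ := 0) hU
      (fun y hy => (differentiableAt_kern hy).differentiableWithinAt) hx (fun _ _ _ => rfl) J,
      norm_prefactor_mul]

/-! ### The behaviour near the singularity -/

theorem analyticAt_expc (z : ℂ) : AnalyticAt ℂ expc z := differentiable_expc.analyticAt z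

theorem iteratedDeriv_kernFull (m p : ℕ) (l : ℤ) (ν : ℝ) (k : ℕ) {σ : ℝ} {u : ℂ}
    (hu : |height σ u| < π) :
    iteratedDeriv k (kernFull m p l ν) u = iteratedDeriv k (kernReg m p l) u +
      kernNum m p l 0 * (ν * (ν ^ k * iteratedDeriv k expc (ν * u))) := by
  have hreg : ContDiffAt ℂ k (kernReg m p l) u :=
    ((differentiableOn_kernReg m p l σ).analyticAt ((isOpen_strip σ π).mem_nhds hu)).contDiffAt
  have he : ContDiff ℂ k expc := differentiable_expc.contDiff
  have he' : ContDiff ℂ k fun u : ℂ => expc (ν * u) := he.comp (by fun_prop)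
  unfold kernFull
  rw [iteratedDeriv_fun_add hreg (by fun_prop), iteratedDeriv_const_mul_field,
    iteratedDeriv_const_mul_field, iteratedDeriv_comp_const_mul he]

theorem gaussSeries_kernFull (m p : ℕ) (l : ℤ) (ν b τ : ℝ) {σ : ℝ} {u : ℂ}
    (hu : |height σ u| < π) (J : ℕ) :
    gaussSeries b τ (kernFull m p l ν) u J = gaussSeries b τ (kernReg m p l) u J +
      kernNum m p l 0 * (ν * gaussSeries b τ (fun u => expc (ν * u)) u J) := by
  have he : ∀ k : ℕ, ContDiff ℂ k expc := fun k => differentiable_expc.contDiff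
  simp only [gaussSeries, iteratedDeriv_kernFull m p l ν _ hu, Finset.mul_sum,
    iteratedDeriv_comp_const_mul (he _)]
  rw [← Finset.sum_add_distrib]
  exact Finset.sum_congr rfl fun j _ => by ring

/-- The function expc(νu) varies on the scale 1/|ν|, which is therefore the radius of the Taylor
discs and produces the powers of |ν|. The bounds A and β keep the other constants uniform while ν
grows like b^{-1/2}. -/
theorem norm_gavg_expc_sub_le {σ ν b δ₀ A β : ℝ} (hb : 0 < b) (hν : ν ≠ 0)
    (hA : |ν| * |δ₀| ≤ A) (hβ : |ν| * √b ≤ β) (J : ℕ) :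
    ‖gavg b (fun r => expc (ν * (Complex.I * δ₀ + tilt σ * r))) -
        gaussSeries b σ (fun u => expc (ν * u)) (Complex.I * δ₀) J‖ ≤
      (2 * J + 4) * (4 * |ν|) ^ (2 * J + 2) * Real.exp (A + 1) * b ^ (J + 1) *
        gaussMoment (2 * J + 2) β := by
  have hν0 : 0 < |ν| := abs_pos.mpr hν
  have hnorm : ∀ z : ℂ, ‖(ν : ℂ) * (Complex.I * δ₀ + z)‖ ≤ A + |ν| * ‖z‖ := by
    intro z
    rw [norm_mul, Complex.norm_real, Real.norm_eq_abs]
    have : ‖Complex.I * (δ₀ : ℂ) + z‖ ≤ |δ₀| + ‖z‖ := by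
      refine (norm_add_le _ _).trans ?_
      rw [norm_mul, Complex.norm_I, one_mul, Complex.norm_real, Real.norm_eq_abs]
    nlinarith
  have hd : Differentiable ℂ fun u : ℂ => expc (ν * u) :=
    differentiable_expc.comp (by fun_prop)
  have h := norm_gavg_sub_le (h := fun u => expc (ν * u)) (y₀ := Complex.I * δ₀) (ρ := 1 / |ν|)
    (M := Real.exp (A + 1)) hb (norm_tilt σ) (by positivity) hd.differentiableOn
    (fun y hy => ?_) (abs_nonneg ν) hβ (hd.continuous.comp (by fun_prop)) (fun r => ?_) J
  · rwa [show 4 / (1 / |ν|) = 4 * |ν| by field_simp] at h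
  · rw [mem_ball_iff_norm] at hy
    have h1 := hnorm (y - Complex.I * δ₀)
    rw [add_sub_cancel] at h1
    refine (norm_expc_le _).trans (Real.exp_le_exp.mpr (h1.trans ?_))
    have : |ν| * ‖y - Complex.I * δ₀‖ ≤ |ν| * (1 / |ν|) := by gcongr
    rw [mul_one_div_cancel hν0.ne'] at this
    linarith
  · have h1 := hnorm (tilt σ * r)
    have e : ‖tilt σ * (r : ℂ)‖ = |r| := by
      rw [norm_mul, norm_tilt, one_mul, Complex.norm_real, Real.norm_eq_abs]
    rw [e] at h1
    refine (norm_expc_le _).trans ?_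
    rw [← Real.exp_add]
    exact Real.exp_le_exp.mpr (by linarith)

theorem integrable_gauss_mul_kernReg {m p : ℕ} (hm : 0 < m) (hp : 0 < p) (l : ℤ) {b σ δ₀ : ℝ}
    (hσ : σ = 1 ∨ σ = -1) (hb : 0 < b) (hδ : |δ₀| < π) :
    MeasureTheory.Integrable fun r : ℝ =>
      gauss b r * kernReg m p l (Complex.I * δ₀ + tilt σ * r) := by
  obtain ⟨C, hC, h⟩ := exists_norm_kernReg_le hm hp l hσ hδ
  have hh : ∀ r, |height σ (linePt σ δ₀ r)| = |δ₀| := fun r => by rw [height_linePt hσ]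
  refine integrable_gauss_mul hb (M := C) (B := 2) (k := 0) ?_ fun r => ?_
  · refine continuous_iff_continuousAt.mpr fun r => ?_
    have h1 : ContinuousAt (kernReg m p l) (linePt σ δ₀ r) :=
      (differentiableAt_kernReg m p l ((hh r).trans_lt hδ)).continuousAt
    exact h1.comp (continuous_linePt σ δ₀).continuousAt
  · rw [pow_zero, mul_one]
    refine (h _ (hh r).le).trans ?_
    have := abs_re_linePt_le hσ δ₀ r
    gcongr

theorem integrable_gauss_mul_expc {b : ℝ} (hb : 0 < b) (ν σ δ₀ : ℝ) :
    MeasureTheory.Integrable fun r : ℝ =>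
      gauss b r * expc (ν * (Complex.I * δ₀ + tilt σ * r)) := by
  refine integrable_gauss_mul hb (M := Real.exp (|ν| * |δ₀|)) (B := |ν|) (k := 0) ?_ fun r => ?_
  · exact differentiable_expc.continuous.comp (by fun_prop)
  · rw [pow_zero, mul_one, ← Real.exp_add]
    refine (norm_expc_le _).trans (Real.exp_le_exp.mpr ?_)
    rw [norm_mul, Complex.norm_real, Real.norm_eq_abs, ← mul_add]
    refine mul_le_mul_of_nonneg_left ((norm_add_le _ _).trans (le_of_eq ?_)) (abs_nonneg ν)
    rw [norm_mul, norm_mul, Complex.norm_I, norm_tilt, one_mul, one_mul, Complex.norm_real,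
      Complex.norm_real, Real.norm_eq_abs, Real.norm_eq_abs]

/-- The fixed function `kernReg` and the ν-dependent correction are estimated separately, because
only the second requires small discs. The exponent 2J + 3 consists of 2J + 2 from the radius 1/|ν|
and one more factor ν in front of `expc`. -/
theorem exists_norm_gavg_kernFull_sub_le {m p : ℕ} (hm : 0 < m) (hp : 0 < p) (l : ℤ) {σ : ℝ}
    (hσ : σ = 1 ∨ σ = -1) (A β : ℝ) (J : ℕ) :
    ∃ C : ℝ, 0 ≤ C ∧ ∀ b ν δ₀ : ℝ, 0 < b → |δ₀| ≤ π / 4 → |ν| * |δ₀| ≤ A → |ν| * √b ≤ β → √b ≤ β →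
      ‖gavg b (fun r => kernFull m p l ν (Complex.I * δ₀ + tilt σ * r)) -
        gaussSeries b σ (kernFull m p l ν) (Complex.I * δ₀) J‖ ≤
      C * (1 + |ν|) ^ (2 * J + 3) * b ^ (J + 1) := by
  have hpi := Real.pi_pos
  obtain ⟨M, hM, hMb⟩ := exists_norm_kernReg_le hm hp l hσ (show π / 2 < π by linarith)
  set C₁ := (2 * J + 4) * (4 / (π / 8)) ^ (2 * J + 2) * (M * Real.exp (2 * (π / 8))) *
    gaussMoment (2 * J + 2) (2 * β) with hC₁
  set C₂ := ‖kernNum m p l 0‖ * ((2 * J + 4) * 4 ^ (2 * J + 2) * Real.exp (A + 1) *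
    gaussMoment (2 * J + 2) β) with hC₂
  have hg1 := gaussMoment_nonneg (2 * J + 2) (2 * β)
  have hg2 := gaussMoment_nonneg (2 * J + 2) β
  have hC₁0 : 0 ≤ C₁ := by positivity
  have hC₂0 : 0 ≤ C₂ := by positivity
  refine ⟨C₁ + C₂, by positivity, fun b ν δ₀ hb hδ hA hβ hβ' => ?_⟩
  have hδπ : |δ₀| < π := by linarith
  have hh : |height σ (Complex.I * (δ₀ : ℂ))| < π := by rwa [height_I_mul]
  have hi1 := integrable_gauss_mul_kernReg hm hp l hσ hb hδπ
  have hi2 := (integrable_gauss_mul_expc hb ν σ δ₀).const_mul (kernNum m p l 0 * ν)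
  have hsplit : gavg b (fun r => kernFull m p l ν (Complex.I * δ₀ + tilt σ * r)) =
      gavg b (fun r => kernReg m p l (Complex.I * δ₀ + tilt σ * r)) + kernNum m p l 0 *
        (ν * gavg b fun r => expc (ν * (Complex.I * δ₀ + tilt σ * r))) := by
    rw [← gavg_const_mul, ← gavg_const_mul, ← gavg_add hi1]
    · rfl
    · refine hi2.congr (MeasureTheory.ae_of_all _ fun r => ?_)
      simp only; ring
  rw [hsplit, gaussSeries_kernFull m p l ν b σ hh]
  have h1 : ‖gavg b (fun r => kernReg m p l (Complex.I * δ₀ + tilt σ * r)) -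
      gaussSeries b σ (kernReg m p l) (Complex.I * δ₀) J‖ ≤ C₁ * b ^ (J + 1) := by
    have hst : ∀ y, |height σ y - δ₀| ≤ 2 * (π / 8) → |height σ y| ≤ π / 2 := fun y hy => by
      have := abs_add_le (height σ y - δ₀) δ₀
      rw [sub_add_cancel] at this
      linarith
    have := norm_gavg_sub_gaussSeries_le (h := kernReg m p l) (B := 2) (β := 2 * β) hσ hb
      (show 0 < π / 8 by positivity) zero_le_two hM
      (fun y hy => differentiableAt_kernReg m p l ((hst y hy).trans_lt (by linarith)))
      (fun y hy => hMb y (hst y hy)) (by linarith) J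
    rw [hC₁]
    linarith
  have h2 : ‖kernNum m p l 0 * (ν * gavg b fun r => expc (ν * (Complex.I * δ₀ + tilt σ * r))) -
      kernNum m p l 0 * (ν * gaussSeries b σ (fun u => expc (ν * u)) (Complex.I * δ₀) J)‖ ≤
      C₂ * |ν| ^ (2 * J + 3) * b ^ (J + 1) := by
    rcases eq_or_ne ν 0 with rfl | hν
    · simp
    · rw [← mul_sub, ← mul_sub, norm_mul, norm_mul, Complex.norm_real, Real.norm_eq_abs]
      have := norm_gavg_expc_sub_le (σ := σ) hb hν hA hβ J
      refine (mul_le_mul_of_nonneg_left (mul_le_mul_of_nonneg_left this (abs_nonneg ν))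
        (norm_nonneg _)).trans (le_of_eq ?_)
      rw [hC₂, mul_pow, show 2 * J + 3 = 2 * J + 2 + 1 by ring, pow_succ |ν| (2 * J + 2)]
      ring
  have h3 : (1 : ℝ) ≤ (1 + |ν|) ^ (2 * J + 3) := one_le_pow₀ (by linarith [abs_nonneg ν])
  have h4 : |ν| ^ (2 * J + 3) ≤ (1 + |ν|) ^ (2 * J + 3) :=
    pow_le_pow_left₀ (abs_nonneg ν) (by linarith) _
  rw [add_sub_add_comm]
  refine (norm_add_le _ _).trans ((add_le_add h1 h2).trans ?_)
  rw [add_mul, add_mul]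
  gcongr
  exact le_mul_of_one_le_right hC₁0 h3

/-- For |γ| ≤ √K the centre is at the distance |2bγ| ≤ π m|n|/√K from the pole, and the lower bound
on K makes this at most π/4. -/
theorem norm_jonesTorus_sub_critical_le {m : ℕ} (hm : 0 < m) {n : ℤ} (hn : n ≠ 0)
    (hmn : IsCoprime (m : ℤ) n) (l J : ℕ) (hl : l + 1 < m * n.natAbs) :
    ∃ C : ℝ, 0 ≤ C ∧ ∀ (K α : ℕ) (γ : ℝ), 0 < α → α < K → 16 * (m * n.natAbs) ^ 2 ≤ K →
      (α : ℝ) = K * ((n.sign * (l + 1 : ℕ) : ℤ) / (m * n)) + γ → |γ| ≤ √(K : ℝ) →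
      ‖jonesTorus m n K α - (critical m n K J (n.sign * (l + 1 : ℕ)) γ +
          ∑ j ∈ irreducibleLabels m n ((n.sign * (l + 1 : ℕ) : ℤ) / (m * n)),
            irreducible m n K j α)‖ ≤
        C * (1 + |γ|) ^ (2 * J + 3) * (K : ℝ) ^ (-(J : ℝ) - 3 / 2) := by
  have hσ := rsign_eq hn
  have hp : 0 < n.natAbs := Int.natAbs_pos.mpr hn
  have hpi := Real.pi_pos
  have hm0 : (0 : ℝ) < m := by exact_mod_cast hm
  have hp0 : (0 : ℝ) < n.natAbs := by exact_mod_cast hp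
  have hr0 : rsign n ≠ 0 := left_ne_zero_of_mul_eq_one (rsign_mul_self hn)
  -- Since |ν| = |γ| ≤ √K, the products are |ν||δ₀| = 2bγ² ≤ 2bK = π m|n| and |ν|√b ≤ √(Kb) = √(π
  -- m|n|/2); these are the values of A and β.
  obtain ⟨C, hC, hbound⟩ := exists_norm_gavg_kernFull_sub_le hm hp ((l + 1 : ℕ) : ℤ) hσ
    (π * m * n.natAbs) (√(π * m * n.natAbs / 2)) J
  refine ⟨√2 * (π * m * n.natAbs / 2) ^ (J + 1) * C, by positivity,
    fun K α γ hα hαK hKlarge hγ hγK => ?_⟩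
  have hK : 0 < K := hα.trans hαK
  have hK0 : (0 : ℝ) < K := by exact_mod_cast hK
  have hb := width_pos hm hn hK
  have hbdef : width m n K = π * m * n.natAbs / (2 * K) := rfl
  set b := width m n K
  have hdiv : ((n.sign * (l + 1 : ℕ) : ℤ) : ℝ) / (m * n) = (l + 1 : ℕ) / (m * n.natAbs) := by
    have : ((n.sign * (l + 1 : ℕ) : ℤ) : ℝ) = rsign n * (l + 1 : ℕ) := by
      rw [rsign]; push_cast; ring
    rw [this, ← rsign_mul_natAbs n, mul_left_comm, mul_div_mul_left _ _ hr0]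
  rw [hdiv] at hγ ⊢
  have hθ : 2 * b * α - π * (l + 1 : ℕ) = 2 * b * γ := by
    rw [hγ, hbdef]; field_simp; ring
  have hγ2 : γ ^ 2 ≤ K := by
    have := mul_self_le_mul_self (abs_nonneg γ) hγK
    rwa [abs_mul_abs_self, Real.mul_self_sqrt hK0.le, ← pow_two] at this
  have hsK : 4 * (m * n.natAbs : ℝ) ≤ √(K : ℝ) := by
    refine Real.le_sqrt_of_sq_le ?_
    have : ((16 * (m * n.natAbs) ^ 2 : ℕ) : ℝ) ≤ K := by exact_mod_cast hKlarge
    push_cast at this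
    linarith
  have hsK0 : 0 < √(K : ℝ) := Real.sqrt_pos.mpr hK0
  have hδ : |2 * b * γ| ≤ π / 4 := by
    rw [abs_mul, abs_of_pos (by positivity), hbdef]
    calc 2 * (π * m * n.natAbs / (2 * K)) * |γ|
        ≤ 2 * (π * m * n.natAbs / (2 * K)) * √(K : ℝ) := by gcongr
      _ = π * (m * n.natAbs) / √(K : ℝ) := by
        rw [eq_div_iff hsK0.ne', mul_assoc, Real.mul_self_sqrt hK0.le]; field_simp
      _ ≤ π / 4 := by
        rw [div_le_div_iff₀ hsK0 (by norm_num)]; nlinarith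
  have hνabs : |rsign n * γ| = |γ| := by
    rw [abs_mul]; rcases hσ with h | h <;> rw [h] <;> simp
  have hν : rsign n * (2 * b * γ) / (2 * b) = rsign n * γ := by field_simp
  have hZ := jonesTorus_eq_lineAvg hm hn hmn hα hαK
  rw [← hbdef, ← rsign, lineAvg_kern_eq_add_halfJump hm hp hσ hb l (by rw [hθ]; linarith),
    hθ, hν, mul_add, mul_add, Finset.mul_sum] at hZ
  have hirr : ∑ j ∈ irreducibleLabels m n ((l + 1 : ℕ) / (m * n.natAbs)), irreducible m n K j α =
      ∑ j ∈ Finset.range l, ((√(2 / (K : ℝ)) : ℝ) : ℂ) / Complex.I * twoLoopPhase m n K *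
        jump m n.natAbs b (rsign n) (2 * b * α) (j + 1) := by
    have hl' : ((l + 1 : ℕ) : ℝ) ≤ m * n.natAbs := by exact_mod_cast hl.le
    rw [sum_irreducibleLabels hm hn (div_le_one_of_le₀ hl' (by positivity)) l fun j => ?_]
    · refine Finset.sum_congr rfl fun j _ => ?_
      rw [← sqrt_div_I_mul_jump hm hn hK]
    · rw [mul_div_cancel₀ _ (by positivity)]; push_cast
      rw [add_lt_add_iff_right, Nat.cast_lt]
  have hcrit := critical_eq hm hn hK (l + 1) J γ (show |2 * b * γ| < π by linarith)
  have hy0 : 2 * Complex.I * (b : ℂ) * γ = Complex.I * ((2 * b * γ : ℝ) : ℂ) := by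
    push_cast; ring
  have hjump : jump m n.natAbs b (rsign n) (2 * b * α) (l + 1) / 2 =
      (-1) ^ (l + 1) * (kernNum m n.natAbs (l + 1 : ℕ) 0 * halfJump b (rsign n) (2 * b * γ)) := by
    rw [jump, hθ]; ring
  have hcancel : ∀ P S H G T : ℂ, S + P * ((-1) ^ (l + 1) * H) + P * ((-1) ^ (l + 1) * G) -
      (P * ((-1) ^ (l + 1) * (H + T)) + S) = P * ((-1) ^ (l + 1) * (G - T)) :=
    fun P S H G T => by ring
  rw [hZ, hirr, hcrit, hjump, hcancel, norm_prefactor_mul, norm_mul, norm_pow, norm_neg, norm_one,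
    one_pow, one_mul, hy0]
  have h1 := hbound b (rsign n * γ) (2 * b * γ) hb hδ (by
    rw [hνabs, abs_mul, abs_of_pos (show 0 < 2 * b by positivity), mul_left_comm, abs_mul_abs_self,
      ← pow_two, hbdef]
    calc 2 * (π * m * n.natAbs / (2 * K)) * γ ^ 2 ≤ 2 * (π * m * n.natAbs / (2 * K)) * K := by gcongr
      _ = π * m * n.natAbs := by field_simp) (by
    rw [hνabs]
    calc |γ| * √b ≤ √(K : ℝ) * √b := by gcongr
      _ = √(π * m * n.natAbs / 2) := by
        rw [← Real.sqrt_mul hK0.le, hbdef]; congr 1; field_simp) (sqrt_width_le hK)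
  rw [hνabs] at h1
  refine (mul_le_mul_of_nonneg_left h1 (Real.sqrt_nonneg _)).trans (le_of_eq ?_)
  have h2 : √(2 / K) * b ^ (J + 1) = _ := sqrt_mul_width_pow m n hK J
  linear_combination (C * (1 + |γ|) ^ (2 * J + 3)) * h2

/-- Finitely many levels are absorbed into the constant. -/
theorem exists_le_mul_rpow_of_lt (f : ℕ → ℝ) (K₀ : ℕ) (s : ℝ) :
    ∃ C, 0 ≤ C ∧ ∀ K, 0 < K → K < K₀ → f K ≤ C * (K : ℝ) ^ s := by
  refine ⟨∑ K ∈ Finset.range K₀, |f K| * (K : ℝ) ^ (-s),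
    Finset.sum_nonneg fun K _ => by positivity, fun K hK hK₀ => ?_⟩
  have hK0 : (0 : ℝ) < K := by exact_mod_cast hK
  have h := Finset.single_le_sum (f := fun K : ℕ => |f K| * (K : ℝ) ^ (-s))
    (fun K _ => by positivity) (Finset.mem_range.mpr hK₀)
  refine le_trans ?_ (mul_le_mul_of_nonneg_right h (by positivity))
  rw [mul_assoc, ← Real.rpow_add hK0, neg_add_cancel, Real.rpow_zero, mul_one]
  exact le_abs_self _

theorem exists_label {m : ℕ} (hm : 0 < m) {n : ℤ} (hn : n ≠ 0) {l₀ : ℤ}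
    (h0 : 0 < (l₀ : ℝ) / (m * n)) (h1 : (l₀ : ℝ) / (m * n) < 1) :
    ∃ l : ℕ, l₀ = n.sign * (l + 1 : ℕ) ∧ l + 1 < m * n.natAbs := by
  have hr0 : rsign n ≠ 0 := left_ne_zero_of_mul_eq_one (rsign_mul_self hn)
  have hm0 : (0 : ℝ) < m := by exact_mod_cast hm
  have hp0 : (0 : ℝ) < n.natAbs := by exact_mod_cast Int.natAbs_pos.mpr hn
  have hss : n.sign * n.sign = 1 := by
    have : ((n.sign * n.sign : ℤ) : ℝ) = (1 : ℤ) := by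
      push_cast; exact rsign_mul_self hn
    exact Int.cast_injective this
  have hdiv : (l₀ : ℝ) / (m * n) = (n.sign * l₀ : ℤ) / (m * n.natAbs) := by
    have : (l₀ : ℝ) = rsign n * (n.sign * l₀ : ℤ) := by
      rw [rsign]; norm_cast; rw [← mul_assoc, hss, one_mul]
    rw [this, ← rsign_mul_natAbs n, mul_left_comm (m : ℝ), mul_div_mul_left _ _ hr0]
  rw [hdiv] at h0 h1
  have h2 : (0 : ℝ) < (n.sign * l₀ : ℤ) := (div_pos_iff_of_pos_right (by positivity)).mp h0
  rw [div_lt_one (by positivity)] at h1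
  have h3 : 0 < n.sign * l₀ := by exact_mod_cast h2
  have h4 : n.sign * l₀ < (m * n.natAbs : ℕ) := by
    rw [← Int.cast_natCast (n.natAbs), ← Int.cast_natCast m, ← Int.cast_mul, Int.cast_lt] at h1
    rwa [Nat.cast_mul]
  refine ⟨(n.sign * l₀).toNat - 1, ?_, ?_⟩
  · have : (((n.sign * l₀).toNat - 1 + 1 : ℕ) : ℤ) = n.sign * l₀ := by omega
    rw [this, ← mul_assoc, hss, one_mul]
  · omega

/-- Below the threshold only finitely many pairs (K, α) occur, and γ is determined by them; the
factor (1 + |γ|)^{2J+3} ≥ 1 does no harm. -/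
theorem exists_norm_jonesTorus_sub_critical_le {m : ℕ} (hm : 0 < m) {n : ℤ} (hn : n ≠ 0)
    (hmn : IsCoprime (m : ℤ) n) {l₀ : ℤ} (h0 : 0 < (l₀ : ℝ) / (m * n))
    (h1 : (l₀ : ℝ) / (m * n) < 1) (J : ℕ) :
    ∃ C : ℝ, ∀ (K α : ℕ) (γ : ℝ), 0 < α → α < K →
      (α : ℝ) = K * (l₀ / (m * n)) + γ → |γ| ≤ √(K : ℝ) →
      ‖jonesTorus m n K α - (critical m n K J l₀ γ +
          ∑ l ∈ irreducibleLabels m n (l₀ / (m * n)), irreducible m n K l α)‖ ≤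
        C * (1 + |γ|) ^ (2 * J + 3) * (K : ℝ) ^ (-(J : ℝ) - 3 / 2) := by
  obtain ⟨l, rfl, hl⟩ := exists_label hm hn h0 h1
  obtain ⟨C₁, hC₁, hlarge⟩ := norm_jonesTorus_sub_critical_le hm hn hmn l J hl
  set a : ℝ := ((n.sign * (l + 1 : ℕ) : ℤ) : ℝ) / (m * n)
  set E : ℕ → ℕ → ℝ := fun K α => ‖jonesTorus m n K α -
    (critical m n K J (n.sign * (l + 1 : ℕ)) (α - K * a) +
      ∑ j ∈ irreducibleLabels m n a, irreducible m n K j α)‖ with hE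
  obtain ⟨C₂, hC₂, hsmall⟩ := exists_le_mul_rpow_of_lt (fun K => ∑ α ∈ Finset.range K, E K α)
    (16 * (m * n.natAbs) ^ 2) (-(J : ℝ) - 3 / 2)
  refine ⟨C₁ + C₂, fun K α γ hα hαK hγ hγK => ?_⟩
  have hpow : 1 ≤ (1 + |γ|) ^ (2 * J + 3) := one_le_pow₀ (by linarith [abs_nonneg γ])
  have hKs : 0 ≤ (K : ℝ) ^ (-(J : ℝ) - 3 / 2) := by positivity
  rcases le_or_gt (16 * (m * n.natAbs) ^ 2) K with hK | hK
  · refine (hlarge K α γ hα hαK hK hγ hγK).trans ?_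
    gcongr
    linarith
  · have h2 := hsmall K (hα.trans hαK) hK
    have h3 : E K α ≤ ∑ α ∈ Finset.range K, E K α :=
      Finset.single_le_sum (f := E K) (fun _ _ => norm_nonneg _) (Finset.mem_range.mpr hαK)
    have h4 : γ = α - K * a := by linarith
    rw [h4] at hpow ⊢
    refine (h3.trans h2).trans ?_
    gcongr
    nlinarith

theorem halfJump_contDiff (b σ c : ℝ) : ContDiff ℝ (⊤ : ℕ∞) fun x : ℝ => halfJump b σ (c * x) := by
  have h : ContDiff ℝ (⊤ : ℕ∞) fun x : ℝ => (x : ℂ) := Complex.ofRealCLM.contDiff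
  unfold halfJump
  simp only [Complex.ofReal_mul, div_eq_mul_inv]
  fun_prop

theorem contDiffAt_comp_line {f : ℂ → ℂ} {c : ℂ} {x : ℝ} (hf : AnalyticAt ℂ f (c * x)) :
    ContDiffAt ℝ (⊤ : ℕ∞) (fun x : ℝ => f (c * x)) x := by
  have h : ContDiff ℝ (⊤ : ℕ∞) fun x : ℝ => (x : ℂ) := Complex.ofRealCLM.contDiff
  exact (hf.contDiffAt.restrict_scalars ℝ).comp (f := fun x : ℝ => c * (x : ℂ)) x (by fun_prop)

/-- The variable enters both as the point and as the parameter of `kernFull`. By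
`iteratedDeriv_kernFull` each derivative is an explicit combination of holomorphic functions of the
two, so both dependences are smooth together. -/
theorem contDiffAt_gaussSeries_kernFull {m p : ℕ} (l : ℤ) {b τ σ ν : ℝ} {c : ℂ} {x : ℝ}
    (hx : |height σ (c * x)| < π) (J : ℕ) :
    ContDiffAt ℝ (⊤ : ℕ∞) (fun x : ℝ => gaussSeries b τ (kernFull m p l (ν * x)) (c * x) J) x := by
  have hev : ∀ᶠ x : ℝ in 𝓝 x, |height σ (c * x)| < π :=
    (by fun_prop : Continuous fun x : ℝ => c * (x : ℂ)).continuousAt.eventually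
      ((isOpen_strip σ π).mem_nhds hx)
  have h : ContDiff ℝ (⊤ : ℕ∞) fun x : ℝ => (x : ℂ) := Complex.ofRealCLM.contDiff
  have hreg : AnalyticAt ℂ (kernReg m p l) (c * x) :=
    (differentiableOn_kernReg m p l σ).analyticAt ((isOpen_strip σ π).mem_nhds hx)
  have hder : ∀ k, ContDiffAt ℝ (⊤ : ℕ∞) (fun x : ℝ =>
      iteratedDeriv k (kernFull m p l (ν * x)) (c * x)) x := fun k => by
    have h1 : ContDiffAt ℝ (⊤ : ℕ∞) (fun x : ℝ => iteratedDeriv k (kernReg m p l) (c * x)) x := by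
      refine contDiffAt_comp_line ?_
      rw [iteratedDeriv_eq_iterate]
      exact hreg.iterated_deriv k
    have h2 : ContDiffAt ℝ (⊤ : ℕ∞) (fun x : ℝ => iteratedDeriv k expc (ν * x * (c * x))) x := by
      have h3 : AnalyticAt ℂ (iteratedDeriv k expc) (ν * x * (c * x)) := by
        rw [iteratedDeriv_eq_iterate]
        exact (analyticAt_expc _).iterated_deriv k
      exact (h3.contDiffAt.restrict_scalars ℝ).comp
        (f := fun x : ℝ => (ν * x * (c * x) : ℂ)) x (by fun_prop)
    refine ContDiffAt.congr_of_eventuallyEq (f := fun x : ℝ =>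
      iteratedDeriv k (kernReg m p l) (c * x) + kernNum m p l 0 * (((ν * x : ℝ) : ℂ) *
        (((ν * x : ℝ) : ℂ) ^ k * iteratedDeriv k expc (ν * x * (c * x))))) ?_ ?_
    · simp only [Complex.ofReal_mul]
      fun_prop
    · filter_upwards [hev] with y hy
      rw [iteratedDeriv_kernFull m p l _ k hy, Complex.ofReal_mul]
  unfold gaussSeries
  exact ContDiffAt.sum fun j _ => contDiffAt_const.mul (hder (2 * j))

/-- The condition |γ| < K/|mn| is |2bγ| < π: the centre stays below the distance to the neighbouring
candidate poles, and the pole in the middle has been compensated. -/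
theorem contDiffOn_critical {m : ℕ} (hm : 0 < m) {n : ℤ} (hn : n ≠ 0) {l₀ : ℤ}
    (h0 : 0 < (l₀ : ℝ) / (m * n)) (h1 : (l₀ : ℝ) / (m * n) < 1) (J : ℕ) {K : ℕ} (hK : 0 < K) :
    ContDiffOn ℝ (⊤ : ℕ∞) (critical m n K J l₀)
      (Set.Ioo (-(K / |(m * n : ℝ)|)) (K / |(m * n : ℝ)|)) := by
  obtain ⟨l, rfl, -⟩ := exists_label hm hn h0 h1
  have hK0 : (0 : ℝ) < K := by exact_mod_cast hK
  have hm0 : (0 : ℝ) < m := by exact_mod_cast hm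
  have hp0 : (0 : ℝ) < n.natAbs := by exact_mod_cast Int.natAbs_pos.mpr hn
  have hpi := Real.pi_pos
  have habs : |(m * n : ℝ)| = m * n.natAbs := by
    rw [abs_mul, Nat.abs_cast, ← Int.cast_abs, Int.abs_eq_natAbs, Int.cast_natCast]
  have hset : ∀ x ∈ Set.Ioo (-(K / |(m * n : ℝ)|)) (K / |(m * n : ℝ)|),
      |2 * width m n K * x| < π := by
    intro x hx
    have hx' : |x| < K / |(m * n : ℝ)| := abs_lt.mpr hx
    rw [habs, lt_div_iff₀ (by positivity)] at hx'
    rw [two_mul_width, abs_mul, abs_of_pos (by positivity), div_mul_eq_mul_div, div_mul_eq_mul_div,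
      div_lt_iff₀ hK0]
    nlinarith
  refine ContDiffOn.congr ?_ fun x hx => critical_eq hm hn hK (l + 1) J x (hset x hx)
  intro x hx
  have hser := contDiffAt_gaussSeries_kernFull (m := m) (p := n.natAbs) ((l + 1 : ℕ) : ℤ)
    (b := width m n K) (τ := rsign n) (σ := 1) (ν := rsign n) (c := 2 * Complex.I * width m n K)
    (x := x) (by rw [abs_height_two_I_width]; exact hset x hx) J
  have hhalf := (halfJump_contDiff (width m n K) (rsign n) (2 * width m n K)).contDiffAt (x := x)
  exact (contDiffAt_const.mul (contDiffAt_const.mul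
    ((contDiffAt_const.mul hhalf).add hser))).contDiffWithinAt

/-! ### The expansion for a fixed colour -/

theorem exists_le_of_isBigO {f : ℕ → ℂ} {s : ℝ} (h : f =O[atTop] fun K : ℕ => (K : ℝ) ^ s) :
    ∃ C, 0 ≤ C ∧ ∀ K, 0 < K → ‖f K‖ ≤ C * (K : ℝ) ^ s := by
  obtain ⟨C₁, hC₁, h⟩ := h.exists_nonneg
  obtain ⟨K₀, hK₀⟩ := eventually_atTop.mp h.bound
  obtain ⟨C₂, hC₂, h₂⟩ := exists_le_mul_rpow_of_lt (fun K => ‖f K‖) K₀ s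
  refine ⟨C₁ + C₂, by positivity, fun K hK => ?_⟩
  have hKs : 0 ≤ (K : ℝ) ^ s := by positivity
  rw [add_mul]
  rcases le_or_gt K₀ K with h' | h'
  · have := hK₀ K h'
    rw [Real.norm_eq_abs, abs_of_nonneg hKs] at this
    have := mul_nonneg hC₂ hKs
    linarith
  · have := h₂ K hK h'
    have := mul_nonneg hC₁ hKs
    linarith

theorem AnalyticAt.exists_isBigO_sub_sum {f : ℂ → ℂ} (hf : AnalyticAt ℂ f 0) :
    ∃ d : ℕ → ℂ, ∀ N, (fun z => f z - ∑ i ∈ Finset.range N, d i * z ^ i) =O[𝓝 0]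
      fun z => z ^ N := by
  obtain ⟨p, hp⟩ := hf
  refine ⟨p.coeff, fun N => ?_⟩
  have h := hp.isBigO_sub_partialSum_pow N
  simp only [zero_add, FormalMultilinearSeries.partialSum,
    FormalMultilinearSeries.apply_eq_pow_smul_coeff, smul_eq_mul] at h
  refine Asymptotics.IsBigO.trans (h.congr_left fun z => ?_) (Asymptotics.isBigO_of_le _ fun z => ?_)
  · simp only [mul_comm]
  · simp

theorem differentiableOn_kern_strip (m p : ℕ) (σ : ℝ) :
    DifferentiableOn ℂ (kern m p) {u | |height σ u| < π} := fun _ hu =>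
  ((differentiableAt_kernFull m p 0 0 hu).congr_of_eventuallyEq
    (Filter.eventually_of_mem ((isOpen_strip σ π).mem_nhds hu)
      fun _ => kern_eq_kernFull)).differentiableWithinAt

/-- The kernel is odd. This is the source of the additional factor 1/K at fixed colour. -/
theorem iteratedDeriv_even_kern_zero (m p j : ℕ) : iteratedDeriv (2 * j) (kern m p) 0 = 0 := by
  have h := iteratedDeriv_comp_neg (2 * j) (kern m p) 0
  simp only [kern_neg, neg_zero, pow_mul, neg_one_sq, one_pow, one_smul] at h
  rw [iteratedDeriv_fun_neg] at h
  exact self_eq_neg.mp h.symm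

theorem analyticAt_iteratedDeriv_kern (m p k : ℕ) :
    AnalyticAt ℂ (iteratedDeriv k (kern m p)) 0 := by
  rw [iteratedDeriv_eq_iterate]
  refine AnalyticAt.iterated_deriv ?_ k
  refine (differentiableOn_kern_strip m p 1).analyticAt ((isOpen_strip 1 π).mem_nhds ?_)
  simp [height, Real.pi_pos]

theorem two_I_width_eq (m : ℕ) (n : ℤ) (K : ℕ) (x : ℂ) :
    2 * Complex.I * width m n K * x = Complex.I * π * m * n.natAbs * x * (K : ℂ)⁻¹ := by
  rw [width]; push_cast; ring

theorem tendsto_natCast_inv : Tendsto (fun K : ℕ => (K : ℂ)⁻¹) atTop (𝓝 0) :=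
  tendsto_inv_atTop_nhds_zero_nat

theorem tendsto_two_I_width (m : ℕ) (n : ℤ) (x : ℂ) :
    Tendsto (fun K : ℕ => 2 * Complex.I * width m n K * x) atTop (𝓝 0) := by
  simp only [two_I_width_eq]
  simpa using tendsto_natCast_inv.const_mul (Complex.I * π * m * n.natAbs * x)

theorem reducible_eq_gaussSeries_kern {m : ℕ} (hm : 0 < m) {n : ℤ} (hn : n ≠ 0) {K : ℕ}
    (hK : 0 < K) {x : ℝ} (hx : |2 * width m n K * x| < π) (J : ℕ) :
    reducible m n K J x = ((√(2 / (K : ℝ)) : ℝ) : ℂ) / Complex.I * twoLoopPhase m n K *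
      gaussSeries (width m n K) (rsign n) (kern m n.natAbs) (2 * Complex.I * width m n K * x) J :=
  reducible_eq_gaussSeries hm hn hK (y₁ := 0) (isOpen_strip 1 π)
    (differentiableOn_kern_strip m n.natAbs 1)
    (by change |height 1 _| < π; rwa [abs_height_two_I_width]) (fun _ _ _ => rfl) J

theorem eventually_abs_two_width_le (m : ℕ) (n : ℤ) (x : ℝ) :
    ∀ᶠ K : ℕ in atTop, |2 * width m n K * x| ≤ π / 4 := by
  have h := (tendsto_two_I_width m n x).norm
  rw [norm_zero] at h
  filter_upwards [h.eventually_le_const (show 0 < π / 4 by positivity)] with K hK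
  rwa [show (2 * Complex.I * width m n K * x : ℂ) =
    Complex.I * ((2 * width m n K * x : ℝ) : ℂ) by push_cast; ring, norm_mul, Complex.norm_I,
    one_mul, Complex.norm_real] at hK

theorem gaussSeries_kern_eq (m p : ℕ) (b τ : ℝ) {σ : ℝ} {u : ℂ} (hu : |height σ u| < π) (J : ℕ) :
    gaussSeries b τ (kern m p) u J = gaussSeries b τ (kernFull m p 0 0) u J := by
  have : kern m p =ᶠ[𝓝 u] kernFull m p 0 0 :=
    Filter.eventually_of_mem ((isOpen_strip σ π).mem_nhds hu) fun _ => kern_eq_kernFull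
  simp only [gaussSeries, this.iteratedDeriv_eq]

theorem gaussSeries_succ (b σ : ℝ) (h : ℂ → ℂ) (y₀ : ℂ) (J : ℕ) :
    gaussSeries b σ h y₀ (J + 1) = gaussSeries b σ h y₀ J +
      (b * tilt σ ^ 2) ^ (J + 1) / (J + 1).factorial * iteratedDeriv (2 * (J + 1)) h y₀ := by
  rw [gaussSeries, Finset.sum_range_succ, ← gaussSeries]

/-- For fixed α the centre 2bα tends to 0, so no pole is crossed. The series is taken one term
further, with remainder of order b^{J+2}; the extra term is b^{J+1} times an even derivative at a
point of size O(1/K), hence of the same order. -/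
theorem jonesTorus_sub_reducible_isBigO {m : ℕ} (hm : 0 < m) {n : ℤ} (hn : n ≠ 0)
    (hmn : IsCoprime (m : ℤ) n) {α : ℕ} (hα : 0 < α) (J : ℕ) :
    (fun K : ℕ => jonesTorus m n K α - reducible m n K J α) =O[atTop]
      fun K : ℕ => (K : ℝ) ^ (-(J : ℝ) - 5 / 2) := by
  have hσ := rsign_eq hn
  have hp : 0 < n.natAbs := Int.natAbs_pos.mpr hn
  have hpi := Real.pi_pos
  obtain ⟨C₁, hC₁, hbound⟩ := exists_norm_gavg_kernFull_sub_le hm hp 0 hσ 0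
    (√(π * m * n.natAbs / 2)) (J + 1)
  obtain ⟨C₂, hC₂, hder⟩ := ((analyticAt_iteratedDeriv_kern m n.natAbs
    (2 * (J + 1))).differentiableAt.isBigO_sub).exists_nonneg
  simp only [iteratedDeriv_even_kern_zero, sub_zero] at hder
  refine Asymptotics.IsBigO.of_bound
    ((C₁ + C₂ * (2 * α)) * (√2 * (π * m * n.natAbs / 2) ^ (J + 2))) ?_
  filter_upwards [eventually_gt_atTop α, eventually_abs_two_width_le m n α,
    (tendsto_two_I_width m n α).eventually hder.bound] with K hαK hδ hg
  have hK : 0 < K := hα.trans hαK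
  have hb := width_pos hm hn hK
  have hred := reducible_eq_gaussSeries_kern hm hn hK (x := α)
    (show |2 * width m n K * (α : ℝ)| < π by linarith) J
  have hZ := jonesTorus_eq_lineAvg hm hn hmn hα hαK
  have hpow := sqrt_mul_width_pow m n hK (J + 1)
  rw [← width, ← rsign] at hZ
  set b := width m n K with hbdef
  have hy0 : 2 * Complex.I * (b : ℂ) * (α : ℝ) = Complex.I * ((2 * b * α : ℝ) : ℂ) := by
    push_cast; ring
  have hh : |height (rsign n) (Complex.I * ((2 * b * α : ℝ) : ℂ))| < π := by
    rw [height_I_mul]; linarith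
  have hline : lineAvg b (rsign n) (2 * b * α) (kern m n.natAbs) 0 =
      gavg b fun r => kernFull m n.natAbs 0 0
        (Complex.I * (2 * b * α : ℝ) + tilt (rsign n) * r) := by
    rw [← lineAvg_self, lineAvg_congr (G := kernFull m n.natAbs 0 0) fun r => ?_]
    · exact lineAvg_kernFull_eq hm hp 0 0 hσ hb (by rwa [abs_zero]) (by linarith)
    · exact kern_eq_kernFull (σ := rsign n) (by rw [height_linePt hσ, abs_zero]; exact hpi)
  have h1 := hbound b 0 (2 * b * α) hb hδ (by simp) (by
    rw [abs_zero, zero_mul]; positivity) (sqrt_width_le hK)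
  rw [abs_zero, add_zero, one_pow, mul_one, ← hline, ← gaussSeries_kern_eq _ _ _ _ hh,
    gaussSeries_succ] at h1
  rw [hZ, hred, ← mul_sub, norm_prefactor_mul, hy0]
  rw [← Complex.ofReal_natCast, hy0] at hg
  set G := lineAvg b (rsign n) (2 * b * α) (kern m n.natAbs) 0
  set y₀ := Complex.I * ((2 * b * α : ℝ) : ℂ) with hy₀
  have h2 : ‖(b * tilt (rsign n) ^ 2) ^ (J + 1) / ((J + 1).factorial : ℂ) *
      iteratedDeriv (2 * (J + 1)) (kern m n.natAbs) y₀‖ ≤ C₂ * (2 * α) * b ^ (J + 2) := by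
    have h3 : ‖y₀‖ = 2 * b * α := by
      rw [hy₀, norm_mul, Complex.norm_I, one_mul, Complex.norm_real, Real.norm_eq_abs,
        abs_of_nonneg (by positivity)]
    rw [h3] at hg
    have h4 : (1 : ℝ) ≤ (J + 1).factorial := by exact_mod_cast (J + 1).factorial_pos
    rw [norm_mul, norm_div, norm_pow, norm_mul, norm_pow, norm_tilt, one_pow, mul_one,
      Complex.norm_real, Real.norm_eq_abs, abs_of_pos hb, Complex.norm_natCast]
    calc b ^ (J + 1) / (J + 1).factorial * ‖iteratedDeriv (2 * (J + 1)) (kern m n.natAbs) y₀‖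
        ≤ b ^ (J + 1) * (C₂ * (2 * b * α)) := by
          gcongr
          exact div_le_self (by positivity) h4
      _ = _ := by ring
  have h5 : ‖G - gaussSeries b (rsign n) (kern m n.natAbs) y₀ J‖ ≤
      (C₁ + C₂ * (2 * α)) * b ^ (J + 2) := by
    have := norm_add_le _ _ |>.trans (add_le_add h1 h2)
    rw [sub_add_eq_sub_sub, sub_add_cancel] at this
    rw [add_mul]
    exact this
  rw [Real.norm_eq_abs, abs_of_nonneg (by positivity)]
  refine (mul_le_mul_of_nonneg_left h5 (Real.sqrt_nonneg _)).trans (le_of_eq ?_)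
  have h6 : (-((J + 1 : ℕ) : ℝ) - 3 / 2) = -(J : ℝ) - 5 / 2 := by push_cast; ring
  rw [h6] at hpow
  linear_combination (C₁ + C₂ * (2 * α)) * hpow

/-- The coefficients of the product of power series, when the last one is to be evaluated at a
multiple of the variable. -/
def tripleCoeff (e : ℕ → ℂ) (d : ℕ → ℕ → ℂ) (p q : ℕ) : ℂ :=
  ∑ j ∈ Finset.range (q + 1), ∑ s ∈ Finset.range (q + 1), if j + s + p = q then e s * d j p else 0

theorem tripleCoeff_eq_zero (e : ℕ → ℂ) (d : ℕ → ℕ → ℂ) {p q : ℕ} (h : q < p) :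
    tripleCoeff e d p q = 0 :=
  Finset.sum_eq_zero fun j _ => Finset.sum_eq_zero fun s _ => if_neg (by omega)

/-- The triple product of expansions is regrouped by the total power q = j + s + p of the variable.
-/
theorem sum_tripleCoeff (e : ℕ → ℂ) (d : ℕ → ℕ → ℂ) (a z : ℂ) (N : ℕ) :
    ∑ q ∈ Finset.range N, ∑ p ∈ Finset.range (q + 1), tripleCoeff e d p q * a ^ p * z ^ q =
      ∑ j ∈ Finset.range N, ∑ s ∈ Finset.range N, ∑ p ∈ Finset.range N,
        if j + s + p < N then e s * d j p * a ^ p * z ^ (j + s + p) else 0 := by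
  have hext : ∀ (q : ℕ) (F : ℕ → ℂ), q ∈ Finset.range N → (∀ k, q < k → F k = 0) →
      ∑ k ∈ Finset.range (q + 1), F k = ∑ k ∈ Finset.range N, F k := fun q F hq hF =>
    Finset.sum_subset (Finset.range_subset_range.mpr (Finset.mem_range.mp hq)) fun k _ hk =>
      hF k (by simpa using hk)
  have h1 : ∀ q ∈ Finset.range N,
      ∑ p ∈ Finset.range (q + 1), tripleCoeff e d p q * a ^ p * z ^ q =
        ∑ p ∈ Finset.range N, ∑ j ∈ Finset.range N, ∑ s ∈ Finset.range N,
          if j + s + p = q then e s * d j p * a ^ p * z ^ (j + s + p) else 0 := by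
    intro q hq
    rw [hext q _ hq fun p hp => by rw [tripleCoeff_eq_zero e d hp, zero_mul, zero_mul]]
    refine Finset.sum_congr rfl fun p _ => ?_
    rw [tripleCoeff, hext q _ hq fun j hj => Finset.sum_eq_zero fun s _ => if_neg (by omega),
      mul_assoc, Finset.sum_mul]
    refine Finset.sum_congr rfl fun j _ => ?_
    rw [hext q _ hq fun s hs => if_neg (by omega), Finset.sum_mul]
    refine Finset.sum_congr rfl fun s _ => ?_
    split_ifs with h
    · rw [h]; ring
    · rw [zero_mul]
  rw [Finset.sum_congr rfl h1, Finset.sum_comm]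
  have h2 : ∀ j s p : ℕ, ∑ q ∈ Finset.range N,
      (if j + s + p = q then e s * d j p * a ^ p * z ^ (j + s + p) else 0) =
      if j + s + p < N then e s * d j p * a ^ p * z ^ (j + s + p) else 0 := fun j s p => by
    rw [Finset.sum_ite_eq]; simp
  simp only [← h2]
  rw [Finset.sum_congr rfl fun p _ => (Finset.sum_comm : ∑ q ∈ Finset.range N,
    ∑ j ∈ Finset.range N, _ = _)]
  rw [Finset.sum_comm]
  refine Finset.sum_congr rfl fun j _ => ?_
  rw [Finset.sum_congr rfl fun p _ => (Finset.sum_comm : ∑ q ∈ Finset.range N,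
    ∑ s ∈ Finset.range N, _ = _), Finset.sum_comm]

/-- The expansion of a sum of products of two functions and powers of the variable. -/
theorem sum_mul_sub_sum_tripleCoeff_isBigO {ι : Type*} {l : Filter ι} {z : ι → ℂ}
    (hz : Tendsto z l (𝓝 0)) (e : ℕ → ℂ) (d : ℕ → ℕ → ℂ) {E : ι → ℂ} {D : ℕ → ι → ℂ} (a : ℂ) (N : ℕ)
    (hE : (fun i => E i - ∑ s ∈ Finset.range N, e s * z i ^ s) =O[l] fun i => z i ^ N)
    (hE1 : E =O[l] fun _ => (1 : ℂ))
    (hD : ∀ j, (fun i => D j i - ∑ p ∈ Finset.range N, d j p * (a * z i) ^ p) =O[l]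
      fun i => z i ^ N) :
    (fun i => ∑ j ∈ Finset.range N, z i ^ j * (E i * D j i) -
      ∑ q ∈ Finset.range N, ∑ p ∈ Finset.range (q + 1), tripleCoeff e d p q * a ^ p * z i ^ q)
      =O[l] fun i => z i ^ N := by
  have hz1 : ∀ c : ℂ, ∀ k, (fun i => c * z i ^ k) =O[l] fun _ => (1 : ℂ) := fun c k =>
    ((hz.pow k).const_mul c).isBigO_one ℂ
  have hP : ∀ j, (fun i => ∑ p ∈ Finset.range N, d j p * (a * z i) ^ p) =O[l]
      fun _ => (1 : ℂ) := fun j => by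
    refine Asymptotics.IsBigO.fun_sum fun p _ => (hz1 (d j p * a ^ p) p).congr_left fun i => ?_
    rw [mul_pow]; ring
  have hmain : ∀ j, (fun i => z i ^ j * (E i * D j i) - ∑ s ∈ Finset.range N,
      ∑ p ∈ Finset.range N, e s * d j p * a ^ p * z i ^ (j + s + p)) =O[l] fun i => z i ^ N := by
    intro j
    have h1 := hE1.mul (hD j)
    have h1' := hE.mul (hP j)
    simp only [one_mul, mul_one] at h1 h1'
    have h2 := (hz1 1 j).mul (h1.add h1')
    simp only [one_mul] at h2
    refine h2.congr_left fun i => ?_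
    have : ∑ s ∈ Finset.range N, ∑ p ∈ Finset.range N,
        e s * d j p * a ^ p * z i ^ (j + s + p) = z i ^ j *
        ((∑ s ∈ Finset.range N, e s * z i ^ s) * ∑ p ∈ Finset.range N, d j p * (a * z i) ^ p) := by
      rw [Finset.sum_mul_sum, Finset.mul_sum]
      refine Finset.sum_congr rfl fun s _ => ?_
      rw [Finset.mul_sum]
      refine Finset.sum_congr rfl fun p _ => ?_
      rw [mul_pow, pow_add, pow_add]; ring
    rw [this]; ring
  -- The products of the truncated expansions whose total power is N or more are of the order of the
  -- error.
  have htail : (fun i => ∑ j ∈ Finset.range N, ∑ s ∈ Finset.range N, ∑ p ∈ Finset.range N,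
      if j + s + p < N then 0 else e s * d j p * a ^ p * z i ^ (j + s + p)) =O[l]
      fun i => z i ^ N := by
    refine Asymptotics.IsBigO.fun_sum fun j _ => Asymptotics.IsBigO.fun_sum fun s _ =>
      Asymptotics.IsBigO.fun_sum fun p _ => ?_
    split_ifs with h
    · exact Asymptotics.isBigO_zero _ _
    · obtain ⟨k, hk⟩ := Nat.exists_eq_add_of_le (not_lt.mp h)
      have := (hz1 (e s * d j p * a ^ p) k).mul (Asymptotics.isBigO_refl (fun i => z i ^ N) l)
      simp only [one_mul] at this
      refine this.congr_left fun i => ?_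
      rw [hk, pow_add]; ring
  refine ((Asymptotics.IsBigO.fun_sum (s := Finset.range N) fun j _ => hmain j).add htail).congr_left fun i => ?_
  rw [sum_tripleCoeff, ← Finset.sum_sub_distrib, ← Finset.sum_add_distrib]
  refine Finset.sum_congr rfl fun j _ => ?_
  rw [sub_add, sub_right_inj, ← Finset.sum_sub_distrib]
  refine Finset.sum_congr rfl fun s _ => ?_
  rw [← Finset.sum_sub_distrib]
  refine Finset.sum_congr rfl fun p _ => ?_
  split_ifs <;> simp

theorem sqrt_mul_inv_pow {K : ℕ} (hK : 0 < K) (J : ℕ) :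
    √(2 / (K : ℝ)) * (K : ℝ)⁻¹ ^ (J + 1) = √2 * (K : ℝ) ^ (-(J : ℝ) - 3 / 2) := by
  have hK0 : (0 : ℝ) < K := by exact_mod_cast hK
  rw [Real.sqrt_div zero_le_two, Real.sqrt_eq_rpow (K : ℝ), div_eq_mul_inv, ← Real.rpow_neg hK0.le,
    ← Real.rpow_neg_one, ← Real.rpow_natCast, ← Real.rpow_mul hK0.le, mul_assoc,
    ← Real.rpow_add hK0]
  congr 2
  push_cast; ring

/-- Powers of 1/K have three sources: j from the j-th term of the series, s from the two-loop phase,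
and p from the derivative of the kernel at a multiple of α/K. Only the last brings powers of α, and
j + s + p = q, so α^p occurs only with p ≤ q. -/
theorem exists_reducible_expansion {m : ℕ} (hm : 0 < m) {n : ℤ} (hn : n ≠ 0) :
    ∃ c : ℕ → ℕ → ℂ, (∀ p q : ℕ, q < p → c p q = 0) ∧ ∀ α J : ℕ,
      (fun K : ℕ => reducible m n K J α - (√(2 / (K : ℝ)) : ℝ) *
        ∑ q ∈ Finset.range (J + 1), ∑ p ∈ Finset.range (q + 1),
          c p q * (α : ℂ) ^ p / (K : ℂ) ^ q) =O[atTop]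
        fun K : ℕ => (K : ℝ) ^ (-(J : ℝ) - 3 / 2) := by
  have hpi := Real.pi_pos
  set κ : ℂ := Complex.I * π / 2 *
    (((m : ℂ) ^ 2 * (n : ℂ) ^ 2 - (m : ℂ) ^ 2 - (n : ℂ) ^ 2) / ((m : ℂ) * (n : ℂ))) with hκ
  have hE : AnalyticAt ℂ (fun z : ℂ => Complex.exp (κ * z)) 0 := by fun_prop
  obtain ⟨e, he⟩ := hE.exists_isBigO_sub_sum
  set f : ℕ → ℂ → ℂ := fun j w => ((π * m * n.natAbs / 2 : ℂ) * tilt (rsign n) ^ 2) ^ j /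
    j.factorial / Complex.I *
      iteratedDeriv (2 * j) (kern m n.natAbs) (Complex.I * π * m * n.natAbs * w) with hf
  have hD : ∀ j, AnalyticAt ℂ (f j) 0 := fun j => by
    refine analyticAt_const.mul (AnalyticAt.comp_of_eq (analyticAt_iteratedDeriv_kern m n.natAbs
      (2 * j)) (by fun_prop) (by simp))
  choose d hd using fun j => (hD j).exists_isBigO_sub_sum
  refine ⟨tripleCoeff e d, fun p q h => tripleCoeff_eq_zero e d h, fun α J => ?_⟩
  have hz := tendsto_natCast_inv
  have hαz : Tendsto (fun K : ℕ => (α : ℂ) * (K : ℂ)⁻¹) atTop (𝓝 0) := by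
    simpa using hz.const_mul (α : ℂ)
  have hE1 : (fun K : ℕ => Complex.exp (κ * (K : ℂ)⁻¹)) =O[atTop] fun _ => (1 : ℂ) :=
    (hE.continuousAt.tendsto.comp hz).isBigO_one ℂ
  have hmain := sum_mul_sub_sum_tripleCoeff_isBigO hz e d (α : ℂ) (J + 1)
    ((he (J + 1)).comp_tendsto hz) hE1 (D := fun j K => f j (α * (K : ℂ)⁻¹)) fun j =>
      ((hd j (J + 1)).comp_tendsto hαz).trans (by
        simp only [Function.comp_def, mul_pow]
        exact (Asymptotics.isBigO_refl _ _).const_mul_left _)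
  obtain ⟨C, hC⟩ := hmain.bound
  refine Asymptotics.IsBigO.of_bound (C * √2) ?_
  filter_upwards [hC, eventually_gt_atTop 0, eventually_abs_two_width_le m n α] with K h hK hδ
  have hred := reducible_eq_gaussSeries_kern hm hn hK (x := α)
    (show |2 * width m n K * (α : ℝ)| < π by linarith) J
  have hsum : (1 / Complex.I) * twoLoopPhase m n K * gaussSeries (width m n K) (rsign n)
      (kern m n.natAbs) (2 * Complex.I * width m n K * (α : ℝ)) J =
      ∑ j ∈ Finset.range (J + 1), ((K : ℂ)⁻¹) ^ j *
        (Complex.exp (κ * (K : ℂ)⁻¹) * f j (α * (K : ℂ)⁻¹)) := by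
    have h1 : twoLoopPhase m n K = Complex.exp (κ * (K : ℂ)⁻¹) := by
      rw [twoLoopPhase, hκ]; congr 1
      rw [div_eq_mul_inv, mul_inv]; ring
    rw [gaussSeries, Finset.mul_sum, h1]
    refine Finset.sum_congr rfl fun j _ => ?_
    have h2 : (width m n K : ℂ) = (π * m * n.natAbs / 2 : ℂ) * (K : ℂ)⁻¹ := by
      rw [width]; push_cast; rw [div_eq_mul_inv, mul_inv]; ring
    rw [two_I_width_eq, h2, hf, Complex.ofReal_natCast, mul_right_comm, mul_pow]
    simp only [mul_assoc]
    ring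
  have hcancel : ∀ s T : ℂ, s / Complex.I * twoLoopPhase m n K * T =
      s * (1 / Complex.I * twoLoopPhase m n K * T) := fun s T => by ring
  rw [hred, hcancel, hsum, ← mul_sub, norm_mul, Complex.norm_real, Real.norm_eq_abs,
    abs_of_nonneg (Real.sqrt_nonneg _), Real.norm_eq_abs, abs_of_nonneg (by positivity)]
  simp only [inv_pow, ← div_eq_mul_inv] at h ⊢
  refine (mul_le_mul_of_nonneg_left h (Real.sqrt_nonneg _)).trans (le_of_eq ?_)
  have := sqrt_mul_inv_pow hK J
  rw [norm_inv, norm_pow, Complex.norm_natCast, ← inv_pow]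
  linear_combination C * this

end

/-! ### The four statements together. -/

theorem propositionA1 (m : ℕ) (n : ℤ) (hm : 0 < m) (hn : n ≠ 0) (hmn : IsCoprime (m : ℤ) n) :
    -- the limit in which `a = α/K` is fixed and is not a zero of the Alexander polynomial
    (∀ a : ℝ, 0 < a → a < 1 →
      alexander m (BraidWord.torus m n) (Complex.exp (2 * π * Complex.I * a)) ≠ 0 →
      ∀ J : ℕ, ∃ C : ℝ, ∀ K α : ℕ, 0 < K → (α : ℝ) = a * K →
        ‖jonesTorus m n K α -
            (reducible m n K J α + ∑ l ∈ irreducibleLabels m n a, irreducible m n K l α)‖ ≤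
          C * (K : ℝ) ^ (-(J : ℝ) - 3 / 2)) ∧
    -- the limit in which `α` is fixed, and the `1/K` expansion
    (∃ c : ℕ → ℕ → ℂ, (∀ p q : ℕ, q < p → c p q = 0) ∧
      ∀ α J : ℕ, 0 < α → ∃ C : ℝ, ∀ K : ℕ, α < K →
        ‖jonesTorus m n K α - reducible m n K J α‖ ≤ C * (K : ℝ) ^ (-(J : ℝ) - 5 / 2) ∧
        ‖reducible m n K J α - (√(2 / (K : ℝ)) : ℝ) *
            ∑ q ∈ Finset.range (J + 1), ∑ p ∈ Finset.range (q + 1),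
              c p q * (α : ℂ) ^ p / (K : ℂ) ^ q‖ ≤ C * (K : ℝ) ^ (-(J : ℝ) - 3 / 2)) ∧
    -- the reducible contribution is singular at the zeros of the Alexander polynomial
    (∀ a : ℝ, 0 < a → a < 1 →
      alexander m (BraidWord.torus m n) (Complex.exp (2 * π * Complex.I * a)) = 0 →
      (∃ l₀ : ℤ, a = l₀ / (m * n)) ∧
      ∀ K J : ℕ, 0 < K →
        Tendsto (fun x : ℝ => ‖reducible m n K J x‖) (𝓝[≠] (K * a)) atTop) ∧
    -- the whole Jones polynomial is smooth there
    (∀ l₀ : ℤ, 0 < (l₀ : ℝ) / (m * n) → (l₀ : ℝ) / (m * n) < 1 → ∀ J : ℕ,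
      (∀ K : ℕ, 0 < K →
        ContDiffOn ℝ (⊤ : ℕ∞) (critical m n K J l₀)
          (Set.Ioo (-(K / |(m * n : ℝ)|)) (K / |(m * n : ℝ)|))) ∧
      ∃ C : ℝ, ∀ (K α : ℕ) (γ : ℝ), 0 < α → α < K →
        (α : ℝ) = K * (l₀ / (m * n)) + γ → |γ| ≤ √(K : ℝ) →
        ‖jonesTorus m n K α -
            (critical m n K J l₀ γ +
              ∑ l ∈ irreducibleLabels m n (l₀ / (m * n)), irreducible m n K l α)‖ ≤
          C * (1 + |γ|) ^ (2 * J + 3) * (K : ℝ) ^ (-(J : ℝ) - 3 / 2)) := by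
  refine ⟨fun a ha ha1 hal J => norm_jonesTorus_sub_le_of_ratio hm hn hmn ha ha1 hal J, ?_,
    fun a ha ha1 hal => reducible_singular hm hn hmn ha hal, fun l₀ h0 h1 J =>
      ⟨fun K hK => contDiffOn_critical hm hn h0 h1 J hK,
        exists_norm_jonesTorus_sub_critical_le hm hn hmn h0 h1 J⟩⟩
  obtain ⟨c, hc, hexp⟩ := exists_reducible_expansion hm hn
  refine ⟨c, hc, fun α J hα => ?_⟩
  obtain ⟨C₁, hC₁, h₁⟩ := exists_le_of_isBigO (jonesTorus_sub_reducible_isBigO hm hn hmn hα J)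
  obtain ⟨C₂, hC₂, h₂⟩ := exists_le_of_isBigO (hexp α J)
  refine ⟨C₁ + C₂, fun K hK => ⟨(h₁ K (hα.trans hK)).trans ?_, (h₂ K (hα.trans hK)).trans ?_⟩⟩
  · gcongr; linarith
  · gcongr; linarith
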